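/- Let $D=\{z\in\mathbb C:|z|<1\}$, let $\gamma$ be Euler's constant and $\zeta$ the Riemann zeta function, and for $z\in D$ put $$\ell_1(z)=\gamma z-\sum_{k\ge2}\zeta(k)\frac{(-z)^k}{k},\qquad \ell_r(z)=-\sum_{k\ge1}\zeta(kr)\frac{(-z^r)^k}{k}\quad(r\ge2),$$ and $\Gamma_{y_r}(1+z)=e^{-\ell_r(z)}$. Let $L=\mathrm{span}_{\mathbb C}\{\ell_r\}_{r\ge1}$ and $E=\mathrm{span}_{\mathbb C}\{e^{\ell_r}\}_{r\ge1}$, as spaces of functions on $D$, and let $1$ be the constant function. Let $Y=\{y_r\}_{r\ge1}$ be an alphabet, $\mathbb CY=\mathrm{span}_{\mathbb C}\{y_r\}_{r\ge1}$, and let $y_r^*=\sum_{n\ge0}y_r^n$ be the Kleene star of $y_r$ among the noncommutative formal power series over $Y$. For holomorphic functions $u_{y_r}$ on $D$ ($r\ge1$) put, for words, $$\alpha_0^z(y_{i_1}\cdots y_{i_k})=\int_0^z u_{y_{i_1}}(z_1)\,dz_1\int_0^{z_1}u_{y_{i_2}}(z_2)\,dz_2\cdots\int_0^{z_{k-1}}u_{y_{i_k}}(z_k)\,dz_k$$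 (with value $1$ on the empty word), and $\alpha_0^z(S)=\sum_w\langle S|w\rangle\,\alpha_0^z(w)$ for the series $S$ for which this sum converges. Then: 1. The families $(\ell_r)_{r\ge1}$ and $(e^{\ell_r})_{r\ge1}$ are $\mathbb C$-linearly free, and free from $1$ (that is, $1\notin L$ and $1\notin E$). Moreover: (a) With $u_{y_r}=e^{\ell_r}\partial\ell_r$ one has $\alpha_0^z(y_r)=e^{\ell_r(z)}-1$ and $\alpha_0^z(y_r^*)=e^{e^{\ell_r(z)}-1}$ for all $r\ge1$ and $z\in D$, and the restriction $\alpha_0^z:\mathbb CY\to E+\mathbb C\cdot1$ is (well defined and) injective. (b) With $u_{y_r}=\partial\ell_r$ one has $\alpha_0^z(y_r)=\ell_r(z)$ and $\alpha_0^z(y_r^*)=e^{\ell_r(z)}$ for all $r\ge1$ and $z\in D$, and the restrictions $\alpha_0^z:\mathbb CY\to L$ and $\alpha_0^z:\mathrm{span}_{\mathbb C}\{y_r^*\}_{r\ge1}\to E$ are (well defined and) injective. (Here $\alpha_0^z(S)$ is regarded as a function of $z\in D$.) 2. The family $(\ell_r)_{r\ge1}$ is $\mathbb C$-algebraically independent,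 and so is the family $(e^{\ell_r})_{r\ge1}$. 3. For every $r\ge1$: (a) the two functions $\ell_r$ and $e^{\ell_r}$ are $\mathbb C$-algebraically independent; (b) the series defining $\ell_r$ converges on $D$, and $\ell_r$ is holomorphic on $D$; (c) $e^{\ell_r}=\Gamma_{y_r}(1+z)^{-1}$ extends to an entire function and $e^{-\ell_r}=\Gamma_{y_r}(1+z)$ extends to a meromorphic function on $\mathbb C$; the set of zeros of the former and the set of poles of the latter are both equal to $\biguplus_{\chi\in G_r}\chi\,\mathbb Z_{\le-1}$ (a disjoint union), which is countable and consists of isolated points, where $G_r=\{\chi\in\mathbb C:\chi^r=(-1)^{r-1}\}$. -/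

import Mathlib

open Topology

namespace Eulerian

noncomputable section

/-- The open unit disc `D` of the complex plane. -/
abbrev disc : Set ℂ := Metric.ball (0 : ℂ) 1

/-- The `k`-th term of the power series defining `ℓ_r`. For `r = 1` it is the term of
index `k + 2` of `∑_{k ≥ 2} ζ(k) (-z)^k / k`; for `r ≥ 2` it is the term of index `k + 1` of
`∑_{k ≥ 1} ζ(kr) (-z^r)^k / k`. -/
def ellTerm (r : ℕ+) (z : ℂ) (k : ℕ) : ℂ :=
  if r = 1 then riemannZeta ((k + 2 : ℕ) : ℂ) * (-z) ^ (k + 2) / ((k + 2 : ℕ) : ℂ)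
  else riemannZeta (((k + 1) * (r : ℕ) : ℕ) : ℂ) * (-z ^ (r : ℕ)) ^ (k + 1) / ((k + 1 : ℕ) : ℂ)

/-- `ℓ_1(z) = γ z - ∑_{k ≥ 2} ζ(k) (-z)^k / k` and, for `r ≥ 2`,
`ℓ_r(z) = - ∑_{k ≥ 1} ζ(kr) (-z^r)^k / k`; meaningful for `|z| < 1`. -/
def ell (r : ℕ+) (z : ℂ) : ℂ :=
  (if r = 1 then (Real.eulerMascheroniConstant : ℂ) * z else 0) - ∑' k : ℕ, ellTerm r z k

/-- The function `Γ_{y_r}`, given by `Γ_{y_r}(1 + z) = e^{-ℓ_r(z)}` for `|z| < 1`. -/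
def gammaY (r : ℕ+) (w : ℂ) : ℂ := Complex.exp (-ell r (w - 1))

/-- `ℓ_r` as an element of the algebra of complex functions on the disc. -/
def ellD (r : ℕ+) : disc → ℂ := fun z => ell r z

/-- `e^{ℓ_r}` as an element of the algebra of complex functions on the disc. -/
def expEllD (r : ℕ+) : disc → ℂ := fun z => Complex.exp (ell r z)

/-- `L`, the linear span of the functions `ℓ_r`. -/
def spanL : Submodule ℂ (disc → ℂ) := Submodule.span ℂ (Set.range ellD)

/-- `E`, the linear span of the functions `e^{ℓ_r}`. -/
def spanE : Submodule ℂ (disc → ℂ) := Submodule.span ℂ (Set.range expEllD)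

/-- `G_r`, the set of solutions of `χ^r = (-1)^(r-1)`. -/
def rootsG (r : ℕ+) : Set ℂ := {χ | χ ^ (r : ℕ) = (-1) ^ ((r : ℕ) - 1)}

/-- The set `χ ℤ_{≤ -1}`. -/
def negRay (χ : ℂ) : Set ℂ := {z | ∃ n : ℤ, n ≤ -1 ∧ z = χ * (n : ℂ)}

/-- Words over the alphabet `Y = {y_r : r ≥ 1}`, the letter `y_r` being represented by `r`. -/
abbrev Word : Type := List ℕ+

/-- Noncommutative formal power series over `Y` with complex coefficients. -/
abbrev Series : Type := Word → ℂ

/-- The series reduced to the letter `y_r`. -/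
def letter (r : ℕ+) : Series := fun w => if w = [r] then 1 else 0

/-- The unit series, reduced to the empty word. -/
def oneSeries : Series := fun w => if w = [] then 1 else 0

/-- The concatenation product, `⟨ST|w⟩ = ∑_{uv = w} ⟨S|u⟩⟨T|v⟩`. -/
def conc (S T : Series) : Series := fun w =>
  ∑ i ∈ Finset.range (w.length + 1), S (w.take i) * T (w.drop i)

/-- The powers of a series for concatenation. -/
def concPow (S : Series) : ℕ → Series
  | 0 => oneSeries
  | n + 1 => conc S (concPow S n)

/-- The Kleene star `S^* = 1 + S + S^2 + ...` of a series `S` without constant term: then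
`⟨S^n|w⟩ = 0` as soon as `n` exceeds the length of `w`. -/
def kleeneStar (S : Series) : Series := fun w =>
  ∑ n ∈ Finset.range (w.length + 1), concPow S n w

/-- The iterated integral `α_0^z(y_{i_1} ... y_{i_k}) =
∫_0^z u_{i_1}(z_1) dz_1 ∫_0^{z_1} u_{i_2}(z_2) dz_2 ... ∫_0^{z_{k-1}} u_{i_k}(z_k) dz_k` of the
forms `u_r(z) dz`, along line segments issued from `0`
(`∫_0^z f(s) ds = z ∫_0^1 f(tz) dt`). -/
def iterInt (u : ℕ+ → ℂ → ℂ) : Word → ℂ → ℂ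
  | [], _ => 1
  | r :: w, z => z * ∫ t in (0 : ℝ)..1, u r ((t : ℂ) * z) * iterInt u w ((t : ℂ) * z)

/-- The extension of `α_0^z` to series, `α_0^z(S) = ∑_w ⟨S|w⟩ α_0^z(w)`
(for the series `S` for which this sum converges), as a function of `z` in the disc. -/
def alpha (u : ℕ+ → ℂ → ℂ) (S : Series) : disc → ℂ := fun z =>
  ∑' w : Word, S w * iterInt u w z

/-- The inputs `u_{y_r} = e^{ℓ_r} ∂ℓ_r`. -/
def inputExp (r : ℕ+) (z : ℂ) : ℂ := Complex.exp (ell r z) * deriv (ell r) z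

/-- The inputs `u_{y_r} = ∂ℓ_r`. -/
def inputLog (r : ℕ+) (z : ℂ) : ℂ := deriv (ell r) z

/-- The linear span of the letters. -/
def spanY : Submodule ℂ Series := Submodule.span ℂ (Set.range letter)

/-- The linear span of the series `y_r^*`. -/
def spanYStar : Submodule ℂ Series := Submodule.span ℂ (Set.range fun r => kleeneStar (letter r))

end

end Eulerian

namespace Eulerian

open Filter

/-! ### Convergence, holomorphy and boundary growth of the functions ℓ_r -/

section PowerSeries

/-! Interchanging the sum over k with the series defining the zeta values shows that e^{ℓ_r} is the
restriction to D of an entire function F_r (`entireExp`): F_1(z) = 1/Γ(1+z), and F_r(z) = ∏_{n≥1} (1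
+ z^r/n^r) for r ≥ 2. Zeros, poles and extensions are read off from F_r. Linear freeness, also from
1, follows from algebraic independence, and the statements on α_0^z follow from α_0^z(y_r^n) =
G^n/n!, where G is the primitive of u_{y_r} vanishing at 0.

Both independence proofs rest on one remark: finitely many nonvanishing functions, any two of which
are related by little-o, cannot add up to zero (`not_sum_eventuallyEq_zero`).

For the ℓ_r, look at the boundary point e^{iπ/n}, a zero of F_n but not of F_r for r < n. The ℓ_r
with r < n continue analytically there, while ℓ_n tends to infinity along the radius, more slowly
than any positive power of 1/(1-|z|). Hence ℓ_n is transcendental over the functions analytic at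
that point, and one inducts on the largest index. Since F_n is itself analytic there, the pair ℓ_n,
e^{ℓ_n} is handled in the same way.

For the e^{ℓ_r}, compare monomials in the F_r at -x with x = m + 1/2. Here log|F_1(-x)| outgrows x,
and for r ≥ 2 the quotient log|F_r(-x)|/x tends to π C_r, with C_r = 1/sin(π/r) for even r and
cot(π/r) for odd r. Rational relations between the C_r are relations between numbers cot(π/N). They
are stable under Galois conjugation, so they can be twisted by an odd character mod N that does not
factor through any N/p; the twist isolates cot(π/N), with a coefficient that is nonzero because L(1,
χ) ≠ 0. Among the N that arise only N = 12 lacks such a character. It belongs to r = 6, and all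
relations come from C_6 = 2 C_2. This last tie is broken by |F_6(-x)| ≤ 4 |F_2(-x)|²/(πx)
(`norm_entireExp_six_le`), so distinct monomials always have different orders of magnitude. -/

theorem hasSum_zeta_nat {k : ℕ} (hk : 1 < k) :
    HasSum (fun n : ℕ => (((n + 1 : ℕ) : ℂ) ^ k)⁻¹) (riemannZeta k) := by
  have hs : Summable (fun n : ℕ => 1 / (n : ℂ) ^ k) := by
    rw [← summable_norm_iff]
    simpa using (Real.summable_one_div_nat_pow.mpr hk)
  have h := hs.hasSum
  rw [← zeta_nat_eq_tsum_of_gt_one hk, ← hasSum_nat_add_iff' 1] at h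
  simpa [show k ≠ 0 by omega] using h

theorem norm_zeta_nat_le {k : ℕ} (hk : 1 < k) : ‖riemannZeta k‖ ≤ 2 := by
  have h2 : HasSum (fun n : ℕ => (((n + 1 : ℕ) : ℝ) ^ 2)⁻¹) (Real.pi ^ 2 / 6) := by
    have h := hasSum_zeta_two
    rw [← hasSum_nat_add_iff' 1] at h
    simpa using h
  have h1 := (hasSum_zeta_nat hk).tsum_eq
  rw [← h1]
  refine (tsum_of_norm_bounded h2 fun n => ?_).trans ?_
  · rw [norm_inv, norm_pow, Complex.norm_natCast]
    exact inv_anti₀ (by positivity) (pow_le_pow_right₀ (by simp) hk)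
  · nlinarith [Real.pi_lt_d2, Real.pi_pos]

theorem norm_ellTerm_le (r : ℕ+) {z : ℂ} (hz : ‖z‖ ≤ 1) (k : ℕ) :
    ‖ellTerm r z k‖ ≤ 2 * (‖z‖ ^ (k + 1) / (k + 1)) := by
  unfold ellTerm
  split_ifs with h
  · rw [norm_div, norm_mul, norm_pow, norm_neg, Complex.norm_natCast, mul_div_assoc]
    refine mul_le_mul (norm_zeta_nat_le (by omega)) (div_le_div₀ (by positivity)
      (pow_le_pow_of_le_one (norm_nonneg _) hz (by omega)) (by positivity) ?_)
      (by positivity) (by norm_num)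
    push_cast; linarith
  · have hr : 2 ≤ (r : ℕ) := by
      have h1 : (r : ℕ) ≠ 1 := fun h' => h (PNat.coe_eq_one_iff.mp h')
      have := r.pos
      omega
    rw [norm_div, norm_mul, norm_pow, norm_neg, norm_pow, Complex.norm_natCast, mul_div_assoc,
      ← pow_mul]
    refine mul_le_mul (norm_zeta_nat_le (by nlinarith)) (div_le_div₀ (by positivity)
      (pow_le_pow_of_le_one (norm_nonneg _) hz (by nlinarith)) (by positivity) ?_)
      (by positivity) (by norm_num)
    push_cast; linarith

theorem hasSum_pow_succ_div {x : ℝ} (h0 : 0 ≤ x) (hx : x < 1) :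
    HasSum (fun k : ℕ => 2 * (x ^ (k + 1) / (k + 1))) (2 * (-Real.log (1 - x))) :=
  (Real.hasSum_pow_div_log_of_abs_lt_one (by rwa [abs_of_nonneg h0])).mul_left 2

theorem mem_disc {z : ℂ} : z ∈ disc ↔ ‖z‖ < 1 := by simp [disc]

theorem summable_ellTerm (r : ℕ+) {z : ℂ} (hz : z ∈ disc) : Summable (ellTerm r z) :=
  Summable.of_norm_bounded (hasSum_pow_succ_div (norm_nonneg z) (mem_disc.mp hz)).summable
    fun k => norm_ellTerm_le r (mem_disc.mp hz).le k

/-- What matters later is the logarithmic order at the unit circle, which makes ℓ_r smaller than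
every positive power of 1/(1-|z|). The constant 2 bounds the zeta values and 1 bounds γ|z|. -/
theorem norm_ell_le (r : ℕ+) {z : ℂ} (hz : z ∈ disc) :
    ‖ell r z‖ ≤ 1 + 2 * (-Real.log (1 - ‖z‖)) := by
  have hz' := mem_disc.mp hz
  unfold ell
  refine (norm_sub_le _ _).trans (add_le_add ?_ ?_)
  · split_ifs
    · rw [norm_mul, Complex.norm_real, Real.norm_of_nonneg
        (Real.one_half_lt_eulerMascheroniConstant.le.trans' (by norm_num))]
      have := Real.eulerMascheroniConstant_lt_two_thirds
      have := Real.one_half_lt_eulerMascheroniConstant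
      nlinarith [norm_nonneg z]
    · simp
  · exact tsum_of_norm_bounded (hasSum_pow_succ_div (norm_nonneg z) hz')
      fun k => norm_ellTerm_le r hz'.le k

theorem ell_zero (r : ℕ+) : ell r 0 = 0 := by
  have h : ∀ k, ellTerm r 0 k = 0 := fun k => by
    have := norm_ellTerm_le r (z := 0) (by simp) k
    simpa using this
  simp [ell, h]

theorem differentiableOn_ell (r : ℕ+) : DifferentiableOn ℂ (ell r) disc := by
  intro z hz
  obtain ⟨ρ, hzρ, hρ⟩ := exists_between (mem_disc.mp hz)
  have hρ0 : 0 ≤ ρ := (norm_nonneg z).trans hzρ.le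
  have h : DifferentiableOn ℂ (fun w => ∑' k, ellTerm r w k) (Metric.ball 0 ρ) := by
    refine Complex.differentiableOn_tsum_of_summable_norm
      (hasSum_pow_succ_div hρ0 hρ).summable (fun k => ?_) Metric.isOpen_ball fun k w hw => ?_
    · unfold ellTerm
      split_ifs <;> fun_prop
    · have hw' : ‖w‖ < ρ := by simpa using hw
      refine (norm_ellTerm_le r (hw'.le.trans hρ.le) k).trans ?_
      gcongr
  have h' : DifferentiableOn ℂ (ell r) (Metric.ball 0 ρ) := by
    refine DifferentiableOn.sub ?_ h
    split_ifs <;> fun_prop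
  exact (h'.differentiableAt (Metric.isOpen_ball.mem_nhds (by simpa using hzρ))).differentiableWithinAt

theorem summable_inv_succ_sq : Summable (fun n : ℕ => (((n + 1 : ℕ) : ℝ) ^ 2)⁻¹) :=
  (summable_nat_add_iff (f := fun n : ℕ => ((n : ℝ) ^ 2)⁻¹) 1).mpr
    (Real.summable_nat_pow_inv.mpr one_lt_two)

theorem summable_mul_inv_pow {x : ℝ} (h0 : 0 ≤ x) (hx : x < 1) (a : ℕ → ℕ) (ha : ∀ k, 2 ≤ a k)
    (c : ℕ → ℂ) (hc : ∀ k, ‖c k‖ ≤ x ^ k) :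
    Summable (fun p : ℕ × ℕ => c p.1 * (((p.2 + 1 : ℕ) : ℂ) ^ a p.1)⁻¹) := by
  have hg : Summable (fun k : ℕ => x ^ k) := summable_geometric_of_lt_one h0 hx
  have hm := hg.mul_of_nonneg summable_inv_succ_sq (fun k => by positivity)
    (fun n => by positivity)
  refine Summable.of_norm_bounded hm fun p => ?_
  rw [norm_mul, norm_inv, norm_pow, Complex.norm_natCast]
  exact mul_le_mul (hc _) (inv_anti₀ (by positivity) (pow_le_pow_right₀ (by simp) (ha _)))
    (by positivity) (by positivity)

/-- Interchange of summation in `∑ ζ(a k) c k`. -/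
theorem hasSum_zeta_mul {x : ℝ} (h0 : 0 ≤ x) (hx : x < 1) (a : ℕ → ℕ) (ha : ∀ k, 2 ≤ a k)
    (c : ℕ → ℂ) (hc : ∀ k, ‖c k‖ ≤ x ^ k) :
    HasSum (fun n : ℕ => ∑' k, c k * (((n + 1 : ℕ) : ℂ) ^ a k)⁻¹)
      (∑' k, riemannZeta (a k) * c k) := by
  have hsum := summable_mul_inv_pow h0 hx a ha c hc
  have h1 : ∀ k, riemannZeta (a k) * c k = ∑' n : ℕ, c k * (((n + 1 : ℕ) : ℂ) ^ a k)⁻¹ := by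
    intro k
    rw [tsum_mul_left, (hasSum_zeta_nat (ha k)).tsum_eq, mul_comm]
  rw [tsum_congr h1]
  have h2 := hsum.prod_symm.prod.hasSum
  rwa [← Summable.tsum_comm (f := fun k n => c k * (((n + 1 : ℕ) : ℂ) ^ a k)⁻¹) hsum]

end PowerSeries

/-! ### Entire extension of e^{ℓ_r} by Γ and by infinite products -/

section EntireExtension

/-- The entire function extending `e^{ℓ_r}`. -/
noncomputable def entireExp (r : ℕ+) (z : ℂ) : ℂ :=
  if r = 1 then (Complex.Gamma (1 + z))⁻¹
  else ∏' n : ℕ, (1 + z ^ (r : ℕ) / ((n + 1 : ℕ) : ℂ) ^ (r : ℕ))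

theorem two_le_of_ne_one {r : ℕ+} (h : r ≠ 1) : 2 ≤ (r : ℕ) := by
  have h1 : (r : ℕ) ≠ 1 := fun h' => h (PNat.coe_eq_one_iff.mp h')
  have := r.pos
  omega

theorem summable_norm_pow_div {r : ℕ} (hr : 2 ≤ r) (z : ℂ) :
    Summable (fun n : ℕ => ‖z ^ r / ((n + 1 : ℕ) : ℂ) ^ r‖) := by
  have h2 : Summable (fun n : ℕ => (((n + 1 : ℕ) : ℝ) ^ r)⁻¹) :=
    (summable_nat_add_iff 1).mpr (Real.summable_nat_pow_inv.mpr hr)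
  refine (h2.mul_left (‖z‖ ^ r)).congr fun n => ?_
  rw [norm_div, norm_pow, norm_pow, Complex.norm_natCast, div_eq_mul_inv]

theorem differentiable_tprod_one_add {r : ℕ} (hr : 2 ≤ r) :
    Differentiable ℂ (fun z : ℂ => ∏' n : ℕ, (1 + z ^ r / ((n + 1 : ℕ) : ℂ) ^ r)) := by
  intro z
  set ρ : ℝ := ‖z‖ + 1
  have hu := summable_norm_pow_div hr (ρ : ℂ)
  have h := (hu.hasProdLocallyUniformlyOn_nat_one_add
    (f := fun n (w : ℂ) => w ^ r / ((n + 1 : ℕ) : ℂ) ^ r) (K := Metric.ball 0 ρ)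
    Metric.isOpen_ball (.of_forall fun n w hw => ?_) (fun n => by fun_prop)).differentiableOn
    (.of_forall fun _ => by simpa [Finset.prod_fn] using
      DifferentiableOn.finsetProd (fun _ _ => by fun_prop)) Metric.isOpen_ball
  · exact h.differentiableAt (Metric.isOpen_ball.mem_nhds (by simp [ρ]))
  · rw [norm_div, norm_div, norm_pow, norm_pow, norm_pow, Complex.norm_real]
    have hw' : ‖w‖ ≤ ‖ρ‖ := by
      rw [Real.norm_of_nonneg (by positivity)]
      simpa using (Metric.mem_ball.mp hw).le
    gcongr

theorem differentiable_entireExp (r : ℕ+) : Differentiable ℂ (entireExp r) := by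
  by_cases h : r = 1
  · have : entireExp r = fun z => (Complex.Gamma (1 + z))⁻¹ := by ext; simp [entireExp, h]
    rw [this]
    exact Complex.differentiable_one_div_Gamma.comp (differentiable_id.const_add 1)
  · have : entireExp r = fun z => ∏' n : ℕ, (1 + z ^ (r : ℕ) / ((n + 1 : ℕ) : ℂ) ^ (r : ℕ)) := by
      ext; simp [entireExp, h]
    rw [this]
    exact differentiable_tprod_one_add (two_le_of_ne_one h)

theorem hasProd_entireExp {r : ℕ+} (h : r ≠ 1) (z : ℂ) :
    HasProd (fun n : ℕ => 1 + z ^ (r : ℕ) / ((n + 1 : ℕ) : ℂ) ^ (r : ℕ)) (entireExp r z) := by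
  rw [entireExp, if_neg h]
  exact (multipliable_one_add_of_summable
    (summable_norm_pow_div (two_le_of_ne_one h) z)).hasProd

theorem tprod_ne_zero_of_summable_norm {u : ℕ → ℂ} (hu : Summable fun n => ‖u n‖) :
    ∏' n, (1 + u n) = 0 ↔ ∃ n, 1 + u n = 0 := by
  constructor
  · intro h
    by_contra! hne
    exact tprod_one_add_ne_zero_of_summable hne hu h
  · rintro ⟨n, hn⟩
    exact tprod_of_exists_eq_zero ⟨n, hn⟩

/-- This sign identity turns χ^r = (-1)^(r-1) into (-χ)^r = -1. -/
theorem neg_one_pow_mul_self (r : ℕ+) : (-1 : ℂ) ^ ((r : ℕ) - 1) * (-1) ^ (r : ℕ) = -1 := by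
  obtain ⟨k, hk⟩ : ∃ k, (r : ℕ) = k + 1 := ⟨r - 1, by have := r.pos; omega⟩
  rw [hk, Nat.add_sub_cancel, pow_succ, ← mul_assoc, ← pow_add, ← two_mul, pow_mul]
  simp

theorem entireExp_eq_zero_iff (r : ℕ+) (z : ℂ) :
    entireExp r z = 0 ↔ z ∈ ⋃ χ ∈ rootsG r, negRay χ := by
  simp only [Set.mem_iUnion, exists_prop, rootsG, negRay, Set.mem_ofPred_eq]
  by_cases h : r = 1
  · subst h
    simp only [entireExp, if_true, inv_eq_zero, Complex.Gamma_eq_zero_iff, PNat.one_coe, pow_one,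
      Nat.sub_self, pow_zero, exists_eq_left, one_mul]
    constructor
    · rintro ⟨m, hm⟩
      exact ⟨-(m + 1), by omega, by push_cast; linear_combination hm⟩
    · rintro ⟨n, hn, rfl⟩
      refine ⟨(-1 - n).toNat, ?_⟩
      rw [← Int.cast_natCast (R := ℂ), Int.toNat_of_nonneg (by omega)]
      push_cast; ring
  · rw [entireExp, if_neg h,
      tprod_ne_zero_of_summable_norm (summable_norm_pow_div (two_le_of_ne_one h) z)]
    have hs := neg_one_pow_mul_self r
    constructor
    · rintro ⟨n, hn⟩
      have hn0 : ((n + 1 : ℕ) : ℂ) ≠ 0 := Nat.cast_ne_zero.mpr (by omega)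
      -- The vanishing factor says (z/(n+1))^r = -1, so -z/(n+1) lies in G_r.
      refine ⟨-(z / ((n + 1 : ℕ) : ℂ)), ?_, -(n + 1), by omega, ?_⟩
      · rw [neg_pow, div_pow, eq_neg_of_add_eq_zero_right hn]
        have h1 : (-1 : ℂ) ^ (r : ℕ) * (-1) ^ (r : ℕ) = 1 := by rw [← mul_pow]; simp
        linear_combination -(-1 : ℂ) ^ (r : ℕ) * hs + (-1 : ℂ) ^ ((r : ℕ) - 1) * h1
      · push_cast at hn0 ⊢
        field_simp
    · rintro ⟨χ, hχ, n, hn, rfl⟩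
      obtain ⟨m, rfl⟩ : ∃ m : ℕ, n = -((m + 1 : ℕ) : ℤ) := ⟨(-1 - n).toNat, by omega⟩
      have hn0 : ((m + 1 : ℕ) : ℂ) ≠ 0 := Nat.cast_ne_zero.mpr (by omega)
      refine ⟨m, ?_⟩
      rw [mul_pow, hχ, Int.cast_neg, Int.cast_natCast, neg_pow ((m + 1 : ℕ) : ℂ), ← mul_assoc, hs,
        mul_div_assoc, div_self (pow_ne_zero _ hn0)]
      ring

/-- After the interchange the sum over k is the Taylor series of -log(1 + z^r/n^r); summing over n
and exponentiating gives the product. -/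
theorem exp_ell_of_ne_one {r : ℕ+} (h : r ≠ 1) {z : ℂ} (hz : z ∈ disc) :
    Complex.exp (ell r z) = entireExp r z := by
  have hr := two_le_of_ne_one h
  have hz' := mem_disc.mp hz
  have h1 := hasSum_zeta_mul (norm_nonneg z) hz' (fun k => (k + 1) * (r : ℕ))
    (fun k => by nlinarith) (fun k => (-z ^ (r : ℕ)) ^ (k + 1) / ((k + 1 : ℕ) : ℂ)) (fun k => by
      rw [norm_div, norm_pow, norm_neg, norm_pow, Complex.norm_natCast, ← pow_mul]
      refine (div_le_self (by positivity) (by simp)).trans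
        (pow_le_pow_of_le_one (norm_nonneg _) hz'.le (by nlinarith)))
  have hw : ∀ n : ℕ, ‖z ^ (r : ℕ) / ((n + 1 : ℕ) : ℂ) ^ (r : ℕ)‖ < 1 := fun n => by
    rw [norm_div, norm_pow, norm_pow, Complex.norm_natCast]
    refine (div_le_self (by positivity) (one_le_pow₀ (by simp))).trans_lt ?_
    exact pow_lt_one₀ (norm_nonneg _) hz' (by omega)
  have h2 : ∀ n : ℕ, ∑' k : ℕ, (-z ^ (r : ℕ)) ^ (k + 1) / ((k + 1 : ℕ) : ℂ) *
      (((n + 1 : ℕ) : ℂ) ^ ((k + 1) * (r : ℕ)))⁻¹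
      = -Complex.log (1 + z ^ (r : ℕ) / ((n + 1 : ℕ) : ℂ) ^ (r : ℕ)) := by
    intro n
    have h3 := Complex.hasSum_taylorSeries_neg_log
      (z := -(z ^ (r : ℕ) / ((n + 1 : ℕ) : ℂ) ^ (r : ℕ))) (by rw [norm_neg]; exact hw n)
    -- The term of index 0 is a division by zero, hence 0, and can be dropped.
    rw [← hasSum_nat_add_iff' 1] at h3
    simp only [Finset.range_one, Finset.sum_singleton, Nat.cast_zero, div_zero, sub_zero,
      sub_neg_eq_add] at h3
    rw [← h3.tsum_eq]
    refine tsum_congr fun k => ?_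
    rw [← neg_div, div_pow, ← pow_mul, mul_comm (k + 1)]
    field_simp
  simp_rw [h2] at h1
  have h4 : ell r z = -∑' k, riemannZeta (((k + 1) * (r : ℕ) : ℕ) : ℂ) *
      ((-z ^ (r : ℕ)) ^ (k + 1) / ((k + 1 : ℕ) : ℂ)) := by
    simp only [ell, ellTerm, if_neg h, zero_sub, mul_div_assoc]
  have h5 := h1.neg
  simp only [neg_neg] at h5
  rw [← h4] at h5
  have h6 := Complex.hasProd_of_hasSum_log (fun n => ?_) h5
  · rw [entireExp, if_neg h, h6.tprod_eq]
  · intro h0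
    have := hw n
    rw [eq_neg_of_add_eq_zero_right h0] at this
    simp at this

/-- This inverts `GammaSeq` at 1 + z, after division by its last factor (1 + z + N)/N, which tends
to 1. -/
theorem tendsto_prod_inv_Gamma {z : ℂ} (hz : Complex.Gamma (1 + z) ≠ 0) :
    Tendsto (fun N : ℕ => (N : ℂ) ^ (-z) * ∏ n ∈ Finset.range N, (1 + z / ((n + 1 : ℕ) : ℂ)))
      atTop (𝓝 (Complex.Gamma (1 + z))⁻¹) := by
  have h1 := (Complex.GammaSeq_tendsto_Gamma (1 + z)).inv₀ hz
  have h2 : Tendsto (fun N : ℕ => 1 + (1 + z) * ((N : ℂ))⁻¹) atTop (𝓝 1) := by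
    simpa using (tendsto_inv_atTop_nhds_zero_nat (𝕜 := ℂ)).const_mul (1 + z) |>.const_add 1
  have h3 := h1.div h2 one_ne_zero
  rw [div_one] at h3
  have hne : ∀ᶠ N : ℕ in atTop, 1 + (1 + z) * ((N : ℂ))⁻¹ ≠ 0 :=
    h2.eventually_ne one_ne_zero
  refine h3.congr' ?_
  filter_upwards [eventually_gt_atTop 0, hne] with N hN hN1
  have hN0 : (N : ℂ) ≠ 0 := Nat.cast_ne_zero.mpr hN.ne'
  have hf : ∀ M : ℕ, ∏ j ∈ Finset.range M, (1 + z + j)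
      = (M.factorial : ℂ) * ∏ n ∈ Finset.range M, (1 + z / ((n + 1 : ℕ) : ℂ)) := by
    intro M
    induction M with
    | zero => simp
    | succ M ih =>
      have hM : (M : ℂ) + 1 ≠ 0 := Nat.cast_add_one_ne_zero M
      rw [Finset.prod_range_succ, ih, Finset.prod_range_succ, Nat.factorial_succ]
      push_cast
      field_simp
      ring
  have hfac : (N.factorial : ℂ) ≠ 0 := Nat.cast_ne_zero.mpr (Nat.factorial_ne_zero N)
  have hpow : (N : ℂ) ^ z ≠ 0 := by rw [Complex.cpow_def_of_ne_zero hN0]; exact Complex.exp_ne_zero _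
  rw [Pi.div_apply, Complex.GammaSeq, inv_div, Finset.prod_range_succ, hf,
    Complex.cpow_add _ _ hN0, Complex.cpow_one, Complex.cpow_neg, div_eq_iff hN1]
  field_simp
  ring

/-- For r = 1 the logarithms log(1 + z/n) are summable only after subtracting z/n. The subtracted
terms add up to z times a harmonic number, and γ = lim (H_N - log N) trades this for the factor
N^{-z} of the limit formula for 1/Γ(1+z). -/
theorem exp_ell_one {z : ℂ} (hz : z ∈ disc) :
    Complex.exp (ell 1 z) = entireExp 1 z := by
  have hz' := mem_disc.mp hz
  have h1 := hasSum_zeta_mul (norm_nonneg z) hz' (fun k => k + 2)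
    (fun k => by omega) (fun k => (-z) ^ (k + 2) / ((k + 2 : ℕ) : ℂ)) (fun k => by
      rw [norm_div, norm_pow, norm_neg, Complex.norm_natCast]
      refine (div_le_self (by positivity) (by push_cast; linarith)).trans
        (pow_le_pow_of_le_one (norm_nonneg _) hz'.le (by omega)))
  have hw : ∀ n : ℕ, ‖z / ((n + 1 : ℕ) : ℂ)‖ < 1 := fun n => by
    rw [norm_div, Complex.norm_natCast]
    exact (div_le_self (by positivity) (by simp)).trans_lt hz'
  have h2 : ∀ n : ℕ, ∑' k : ℕ, (-z) ^ (k + 2) / ((k + 2 : ℕ) : ℂ) *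
      (((n + 1 : ℕ) : ℂ) ^ (k + 2))⁻¹
      = -Complex.log (1 + z / ((n + 1 : ℕ) : ℂ)) + z / ((n + 1 : ℕ) : ℂ) := by
    intro n
    have h3 := Complex.hasSum_taylorSeries_neg_log
      (z := -(z / ((n + 1 : ℕ) : ℂ))) (by rw [norm_neg]; exact hw n)
    -- Index 0 contributes nothing; index 1 is the linear term, which becomes the compensating z/n.
    rw [← hasSum_nat_add_iff' 2] at h3
    simp only [Finset.sum_range_succ, Finset.range_zero, Finset.sum_empty, Nat.cast_zero, div_zero,
      sub_neg_eq_add, Nat.cast_one, div_one, pow_one, zero_add] at h3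
    rw [← h3.tsum_eq]
    refine tsum_congr fun k => ?_
    rw [← neg_div, div_pow]
    field_simp
  simp_rw [h2] at h1
  have h4 : ell 1 z = Real.eulerMascheroniConstant * z - ∑' k : ℕ, riemannZeta ((k + 2 : ℕ) : ℂ) *
      ((-z) ^ (k + 2) / ((k + 2 : ℕ) : ℂ)) := by
    simp only [ell, ellTerm, if_true, mul_div_assoc]
  have hγ : Tendsto (fun N : ℕ => (((harmonic N : ℝ) - Real.log N : ℝ) : ℂ)) atTop
      (𝓝 (Real.eulerMascheroniConstant : ℂ)) :=
    (Complex.continuous_ofReal.tendsto _).comp Real.tendsto_harmonic_sub_log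
  have h5 := (Complex.continuous_exp.tendsto _).comp ((hγ.mul_const z).sub h1.tendsto_sum_nat)
  rw [← h4] at h5
  have h6 := tendsto_prod_inv_Gamma (z := z) (Complex.Gamma_ne_zero_of_re_pos (by
    have := (abs_lt.mp ((Complex.abs_re_le_norm z).trans_lt hz')).1
    simp only [Complex.add_re, Complex.one_re]
    linarith))
  rw [entireExp, if_pos rfl]
  refine tendsto_nhds_unique (h5.congr' ?_) h6
  filter_upwards [eventually_gt_atTop 0] with N hN
  have hN0 : (N : ℂ) ≠ 0 := Nat.cast_ne_zero.mpr hN.ne'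
  have hne : ∀ n : ℕ, 1 + z / ((n + 1 : ℕ) : ℂ) ≠ 0 := fun n h0 => by
    have := hw n
    rw [eq_neg_of_add_eq_zero_right h0] at this
    simp at this
  have hprod : ∏ n ∈ Finset.range N, (1 + z / ((n + 1 : ℕ) : ℂ))
      = Complex.exp (∑ n ∈ Finset.range N, Complex.log (1 + z / ((n + 1 : ℕ) : ℂ))) := by
    rw [Complex.exp_sum]
    exact Finset.prod_congr rfl fun n _ => (Complex.exp_log (hne n)).symm
  have hh : ((harmonic N : ℝ) : ℂ) * z = ∑ n ∈ Finset.range N, z / ((n + 1 : ℕ) : ℂ) := by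
    rw [harmonic, Finset.sum_congr rfl fun n _ => div_eq_mul_inv z _, ← Finset.mul_sum, mul_comm]
    push_cast
    rfl
  rw [Function.comp_apply, hprod, Complex.cpow_def_of_ne_zero hN0, ← Complex.exp_add,
    Finset.sum_add_distrib, Finset.sum_neg_distrib, Complex.ofReal_sub, sub_mul, hh,
    ← Complex.natCast_log]
  congr 1
  ring

theorem exp_ell (r : ℕ+) {z : ℂ} (hz : z ∈ disc) : Complex.exp (ell r z) = entireExp r z := by
  by_cases h : r = 1
  · rw [h]; exact exp_ell_one hz
  · exact exp_ell_of_ne_one h hz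

end EntireExtension
end Eulerian

namespace Eulerian

open Filter

/-! ### Zeros of the entire extension and poles of its inverse -/

section ZeroSet

theorem entireExp_zero (r : ℕ+) : entireExp r 0 = 1 := by
  rw [← exp_ell r (mem_disc.mpr (by simp)), ell_zero, Complex.exp_zero]

theorem entireExp_ne_zero_of_mem_disc (r : ℕ+) {z : ℂ} (hz : z ∈ disc) : entireExp r z ≠ 0 := by
  rw [← exp_ell r hz]
  exact Complex.exp_ne_zero _

theorem analyticAt_entireExp (r : ℕ+) (z : ℂ) : AnalyticAt ℂ (entireExp r) z :=
  (differentiable_entireExp r).analyticAt z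

theorem eventually_entireExp_ne_zero (r : ℕ+) (z : ℂ) : ∀ᶠ w in 𝓝[≠] z, entireExp r w ≠ 0 := by
  refine (analyticAt_entireExp r z).eventually_eq_zero_or_eventually_ne_zero.resolve_left fun h => ?_
  have h1 : AnalyticOnNhd ℂ (entireExp r) Set.univ := fun w _ => analyticAt_entireExp r w
  have h2 := h1.eqOn_zero_of_preconnected_of_eventuallyEq_zero isPreconnected_univ
    (Set.mem_univ z) h (Set.mem_univ 0)
  rw [entireExp_zero] at h2
  exact one_ne_zero h2

/-- Isolated zeros make the order of F_r finite, and inversion changes its sign. -/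
theorem meromorphicOrderAt_inv_entireExp_neg_iff (r : ℕ+) (z : ℂ) :
    meromorphicOrderAt (entireExp r)⁻¹ z < 0 ↔ entireExp r z = 0 := by
  have ha := analyticAt_entireExp r z
  have htop : analyticOrderAt (entireExp r) z ≠ ⊤ := by
    rw [Ne, analyticOrderAt_eq_top]
    intro h
    obtain ⟨w, hw1, hw2⟩ :=
      ((h.filter_mono nhdsWithin_le_nhds).and (eventually_entireExp_ne_zero r z)).exists
    exact hw2 hw1
  rw [meromorphicOrderAt_inv, ha.meromorphicOrderAt_eq]
  obtain ⟨n, hn⟩ := ENat.ne_top_iff_exists.mp htop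
  have h0 := ha.analyticOrderAt_eq_zero
  rw [← hn] at h0 ⊢
  rcases n with _ | n
  · simpa using h0
  · have h1 : entireExp r z = 0 := by
      by_contra h
      simpa using h0.mpr h
    simp only [h1, iff_true]
    have h2 : ENat.map (Nat.cast : ℕ → ℤ) ((n + 1 : ℕ) : ℕ∞) = (((n + 1 : ℕ) : ℤ) : WithTop ℤ) := rfl
    rw [h2, ← WithTop.LinearOrderedAddCommGroup.coe_neg]
    exact_mod_cast (by omega : -((n + 1 : ℕ) : ℤ) < 0)

theorem norm_eq_one_of_mem_rootsG {r : ℕ+} {χ : ℂ} (h : χ ∈ rootsG r) : ‖χ‖ = 1 := by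
  have h1 : ‖χ‖ ^ (r : ℕ) = 1 := by
    rw [← norm_pow, show χ ^ (r : ℕ) = _ from h]
    simp
  exact (pow_eq_one_iff_of_nonneg (norm_nonneg _) r.pos.ne').mp h1

/-- Since |χ| = 1, the modulus of a point determines the negative integer, and the point then
determines χ. -/
theorem pairwiseDisjoint_negRay (r : ℕ+) : (rootsG r).PairwiseDisjoint negRay := by
  intro χ hχ χ' hχ' hne
  refine Set.disjoint_left.mpr ?_
  rintro z ⟨n, hn, rfl⟩ ⟨m, hm, h⟩
  have h1 := congrArg norm h
  rw [norm_mul, norm_mul, norm_eq_one_of_mem_rootsG hχ, norm_eq_one_of_mem_rootsG hχ', one_mul,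
    one_mul, Complex.norm_intCast, Complex.norm_intCast] at h1
  have h2 : |n| = |m| := by exact_mod_cast h1
  rw [abs_of_neg (by omega), abs_of_neg (by omega), neg_inj] at h2
  subst h2
  exact hne (mul_right_cancel₀ (Int.cast_ne_zero.mpr (by omega)) h)

theorem finite_rootsG (r : ℕ+) : (rootsG r).Finite := by
  have h : rootsG r ⊆ ((Polynomial.X ^ (r : ℕ) - Polynomial.C ((-1 : ℂ) ^ ((r : ℕ) - 1))).roots.toFinset : Set ℂ) := by
    intro χ hχ
    have hne := Polynomial.X_pow_sub_C_ne_zero r.pos ((-1 : ℂ) ^ ((r : ℕ) - 1))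
    simp only [Finset.mem_coe, Multiset.mem_toFinset, Polynomial.mem_roots hne, Polynomial.IsRoot.def,
      Polynomial.eval_sub, Polynomial.eval_pow, Polynomial.eval_X, Polynomial.eval_C]
    exact sub_eq_zero.mpr hχ
  exact (Finset.finite_toSet _).subset h

theorem countable_iUnion_negRay (r : ℕ+) : (⋃ χ ∈ rootsG r, negRay χ).Countable := by
  refine (finite_rootsG r).countable.biUnion fun χ _ => ?_
  refine (Set.countable_range fun n : ℤ => χ * (n : ℂ)).mono ?_
  rintro z ⟨n, -, rfl⟩
  exact ⟨n, rfl⟩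

theorem eventually_notMem_iUnion_negRay (r : ℕ+) (z : ℂ) :
    ∀ᶠ w in 𝓝[≠] z, w ∉ ⋃ χ ∈ rootsG r, negRay χ :=
  (eventually_entireExp_ne_zero r z).mono fun w hw h => hw ((entireExp_eq_zero_iff r w).mpr h)

end ZeroSet

end Eulerian

namespace Eulerian

open Filter Asymptotics

/-! ### Sums of functions of pairwise different orders of magnitude -/

section Dominance

/-- Finitely many functions of pairwise incomparable size cannot add up to zero. -/
theorem exists_isLittleO_max {ι α : Type*} {l : Filter α} (T : Finset ι) (hT : T.Nonempty)
    (a : ι → α → ℂ)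
    (h : ∀ s ∈ T, ∀ t ∈ T, s ≠ t → (a s =o[l] a t) ∨ (a t =o[l] a s)) :
    ∃ s ∈ T, ∀ t ∈ T, t ≠ s → a t =o[l] a s := by
  classical
  induction hT using Finset.Nonempty.cons_induction with
  | singleton i => exact ⟨i, by simp, by simp⟩
  | cons i T hi hT ih =>
    obtain ⟨s, hs, hmax⟩ := ih fun s hs t ht => h s (Finset.mem_cons_of_mem hs) t
      (Finset.mem_cons_of_mem ht)
    have his : i ≠ s := fun h => hi (h ▸ hs)
    rcases h i (Finset.mem_cons_self _ _) s (Finset.mem_cons_of_mem hs) his with h1 | h1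
    · refine ⟨s, Finset.mem_cons_of_mem hs, fun t ht hts => ?_⟩
      rcases Finset.mem_cons.mp ht with rfl | ht
      · exact h1
      · exact hmax t ht hts
    · refine ⟨i, Finset.mem_cons_self _ _, fun t ht hti => ?_⟩
      have ht := (Finset.mem_cons.mp ht).resolve_left hti
      by_cases hts : t = s
      · exact hts ▸ h1
      · exact (hmax t ht hts).trans h1

/-- If the sum vanished, the dominant term would be minus the sum of the others, hence little-o of
itself, although it does not vanish. -/
theorem not_sum_eventuallyEq_zero {ι α : Type*} {l : Filter α} [l.NeBot] (T : Finset ι)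
    (hT : T.Nonempty) (a : ι → α → ℂ) (hne : ∀ s ∈ T, ∀ᶠ x in l, a s x ≠ 0)
    (h : ∀ s ∈ T, ∀ t ∈ T, s ≠ t → (a s =o[l] a t) ∨ (a t =o[l] a s)) :
    ¬ ∀ᶠ x in l, ∑ s ∈ T, a s x = 0 := by
  classical
  intro h0
  obtain ⟨s, hs, hmax⟩ := exists_isLittleO_max T hT a h
  have h1 : (fun x => ∑ t ∈ T.erase s, a t x) =o[l] a s :=
    IsLittleO.fun_sum fun t ht => hmax t (Finset.mem_of_mem_erase ht) (Finset.ne_of_mem_erase ht)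
  have h2 : (fun x => -a s x) =o[l] a s := by
    refine h1.congr' ?_ EventuallyEq.rfl
    filter_upwards [h0] with x hx
    rw [← Finset.add_sum_erase T _ hs] at hx
    exact eq_neg_of_add_eq_zero_right hx
  rw [isLittleO_neg_left] at h2
  exact isLittleO_irrefl (hne s hs).frequently h2

end Dominance

/-! ### Transcendence of ℓ_r over functions analytic at a boundary point -/

section AnalyticSubalgebra

/-- The algebra of functions on the disc which are holomorphic and continue analytically to a
neighbourhood of `z₀`. -/
def analyticSubalgebra (z₀ : ℂ) : Subalgebra ℂ (disc → ℂ) where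
  carrier := {f | ∃ F : ℂ → ℂ, DifferentiableOn ℂ F disc ∧ AnalyticAt ℂ F z₀ ∧
    ∀ z : disc, f z = F z}
  mul_mem' := by
    rintro f g ⟨F, hF, hF', hf⟩ ⟨G, hG, hG', hg⟩
    exact ⟨fun z => F z * G z, hF.mul hG, hF'.mul hG', fun z => by simp [hf, hg]⟩
  add_mem' := by
    rintro f g ⟨F, hF, hF', hf⟩ ⟨G, hG, hG', hg⟩
    exact ⟨fun z => F z + G z, hF.add hG, hF'.add hG', fun z => by simp [hf, hg]⟩
  algebraMap_mem' c := ⟨fun _ => c, differentiableOn_const c, analyticAt_const, fun _ => rfl⟩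

/-- The radial path `s ↦ (1 - e^{-s}) z₀` in the disc, for `s > 0` and `|z₀| = 1`. -/
noncomputable def radial (z₀ : ℂ) (s : ℝ) : ℂ := ((1 - Real.exp (-s) : ℝ) : ℂ) * z₀

theorem norm_radial {z₀ : ℂ} (h : ‖z₀‖ = 1) {s : ℝ} (hs : 0 ≤ s) :
    ‖radial z₀ s‖ = 1 - Real.exp (-s) := by
  rw [radial, norm_mul, h, mul_one, Complex.norm_real, Real.norm_of_nonneg]
  have := Real.exp_le_one_iff.mpr (neg_nonpos.mpr hs)
  linarith

theorem radial_mem_disc {z₀ : ℂ} (h : ‖z₀‖ = 1) {s : ℝ} (hs : 0 ≤ s) : radial z₀ s ∈ disc := by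
  rw [mem_disc, norm_radial h hs]
  linarith [Real.exp_pos (-s)]

theorem radial_sub (z₀ : ℂ) (s : ℝ) : radial z₀ s - z₀ = -(Real.exp (-s) : ℂ) * z₀ := by
  rw [radial]; push_cast; ring

theorem tendsto_radial (z₀ : ℂ) : Tendsto (radial z₀) atTop (𝓝 z₀) := by
  have h1 : Tendsto (fun s : ℝ => Real.exp (-s)) atTop (𝓝 0) :=
    Real.tendsto_exp_atBot.comp tendsto_neg_atTop_atBot
  have h2 := ((Complex.continuous_ofReal.tendsto _).comp (h1.const_sub 1)).mul_const z₀
  rwa [sub_zero, Complex.ofReal_one, one_mul] at h2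

/-- The point z₀ is on the boundary of D, so the identity theorem is started from a nearby point of
the radius. -/
theorem eqOn_zero_of_eventuallyEq_zero {z₀ : ℂ} (h : ‖z₀‖ = 1) {F : ℂ → ℂ}
    (hF : DifferentiableOn ℂ F disc) (h0 : ∀ᶠ z in 𝓝 z₀, F z = 0) : ∀ z ∈ disc, F z = 0 := by
  obtain ⟨s, hs, hs0⟩ := (((tendsto_radial z₀).eventually h0.eventually_nhds).and
    (eventually_ge_atTop (0 : ℝ))).exists
  exact (hF.analyticOnNhd Metric.isOpen_ball).eqOn_zero_of_preconnected_of_eventuallyEq_zero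
    (convex_ball 0 1).isPreconnected (radial_mem_disc h hs0) hs

/-- A function growing like a logarithm at the boundary point `z₀` is transcendental over the
functions that are analytic at `z₀`. -/
theorem transcendental_of_radial_growth {z₀ : ℂ} (h : ‖z₀‖ = 1) (f : ℂ → ℂ)
    (hinf : Tendsto (fun s => ‖f (radial z₀ s)‖) atTop atTop)
    (hsmall : ∀ k : ℕ, Tendsto (fun s => Real.exp (-s) * ‖f (radial z₀ s)‖ ^ k) atTop (𝓝 0)) :
    Transcendental (analyticSubalgebra z₀) (fun z : disc => f z) := by
  rintro ⟨p, hp, hp0⟩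
  have hz0 : z₀ ≠ 0 := by rintro rfl; simp at h
  choose F hFd hFa hF using fun k => (p.coeff k).2
  -- A coefficient vanishing near z₀ would vanish on D, so each nonzero coefficient has a finite
  -- order n k at z₀.
  have hfac : ∀ k ∈ p.support, ∃ n : ℕ, ∃ g : ℂ → ℂ, AnalyticAt ℂ g z₀ ∧ g z₀ ≠ 0 ∧
      ∀ᶠ z in 𝓝 z₀, F k z = (z - z₀) ^ n • g z := by
    intro k hk
    rw [(hFa k).exists_eventuallyEq_pow_smul_nonzero_iff]
    intro h0
    refine Polynomial.mem_support_iff.mp hk (Subtype.ext (funext fun z => ?_))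
    rw [hF k z]
    exact eqOn_zero_of_eventuallyEq_zero h (hFd k) h0 z z.2
  choose! n g hg hg0 hfac using hfac
  set u : ℝ → ℂ := fun s => (Real.exp (-s) : ℂ) with hu
  set L : ℝ → ℂ := fun s => f (radial z₀ s) with hL
  have hune : ∀ s, u s ≠ 0 := fun s => by simp [hu, Complex.exp_ne_zero]
  have hLne : ∀ᶠ s in atTop, L s ≠ 0 := by
    filter_upwards [hinf.eventually_gt_atTop 0] with s hs
    exact norm_pos_iff.mp hs
  -- On the radius z - z₀ = -e^{-s} z₀, so the k-th term has the exact size e^{-s n_k} |f|^k.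
  have hΘ : ∀ k ∈ p.support, (fun s => F k (radial z₀ s) * L s ^ k) =Θ[atTop]
      (fun s => u s ^ n k * L s ^ k) := by
    intro k hk
    refine IsTheta.mul ?_ (isTheta_refl _ _)
    have h1 : Tendsto (fun s => (-z₀) ^ n k * g k (radial z₀ s)) atTop
        (𝓝 ((-z₀) ^ n k * g k z₀)) :=
      (((hg k hk).continuousAt.tendsto).comp (tendsto_radial z₀)).const_mul _
    have h2 : (fun s => (-z₀) ^ n k * g k (radial z₀ s)) =Θ[atTop] (fun _ => (1 : ℂ)) :=
      by
      have hc := mul_ne_zero (pow_ne_zero (n k) (neg_ne_zero.mpr hz0)) (hg0 k hk)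
      exact ⟨h1.isBigO_one ℂ, (isBigO_const_left_iff_pos_le_norm one_ne_zero).mpr
        ⟨‖(-z₀) ^ n k * g k z₀‖ / 2, by positivity,
          (h1.norm.eventually_const_lt (by
            have := norm_pos_iff.mpr hc
            linarith)).mono fun s hs => hs.le⟩⟩
    have h3 := (isTheta_refl (fun s => u s ^ n k) atTop).mul h2
    simp only [mul_one] at h3
    refine IsTheta.trans (EventuallyEq.isTheta ?_) h3
    filter_upwards [(tendsto_radial z₀).eventually (hfac k hk)] with s hs
    rw [hs, radial_sub, smul_eq_mul, neg_mul, neg_mul_eq_mul_neg, mul_pow, mul_assoc]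
  have hLinv : Tendsto (fun s => (L s)⁻¹) atTop (𝓝 0) := by
    rw [tendsto_zero_iff_norm_tendsto_zero]
    simp only [norm_inv]
    exact hinf.inv_tendsto_atTop
  -- A higher order of vanishing is negligible whatever the powers of f, since e^{-s} beats them
  -- all; at equal orders the larger power of f dominates.
  have hlt : ∀ m k k', (∀ j : ℕ, (fun s => u s ^ (m + 1 + j) * L s ^ k) =o[atTop]
      (fun s => u s ^ m * L s ^ k')) := by
    intro m k k' j
    have h1 : Tendsto (fun s => u s ^ (j + 1) * L s ^ k * (L s)⁻¹ ^ k') atTop (𝓝 0) := by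
      have ha : Tendsto (fun s => u s * L s ^ k) atTop (𝓝 0) := by
        rw [tendsto_zero_iff_norm_tendsto_zero]
        refine (hsmall k).congr fun s => ?_
        rw [norm_mul, norm_pow, Complex.norm_real, Real.norm_of_nonneg (Real.exp_pos _).le]
      have hb : Tendsto u atTop (𝓝 0) := by
        rw [tendsto_zero_iff_norm_tendsto_zero]
        refine (hsmall 0).congr fun s => ?_
        rw [pow_zero, mul_one, Complex.norm_real, Real.norm_of_nonneg (Real.exp_pos _).le]
      have hc := (ha.mul (hb.pow j)).mul (hLinv.pow k')
      rw [zero_mul, zero_mul] at hc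
      exact hc.congr fun s => by ring
    refine (((isLittleO_one_iff ℂ).mpr h1).mul_isBigO
      (isBigO_refl (fun s => u s ^ m * L s ^ k') atTop)).congr' ?_ ?_
    · filter_upwards [hLne] with s hs
      simp only [inv_pow]
      have hs' := hune s
      field_simp
      try ring
    · exact Eventually.of_forall fun s => by simp
  have hlt' : ∀ m k j, (fun s => u s ^ m * L s ^ k) =o[atTop]
      (fun s => u s ^ m * L s ^ (k + 1 + j)) := by
    intro m k j
    have h1 : Tendsto (fun s => (L s)⁻¹ ^ (j + 1)) atTop (𝓝 0) := by
      simpa using hLinv.pow (j + 1)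
    refine (((isLittleO_one_iff ℂ).mpr h1).mul_isBigO
      (isBigO_refl (fun s => u s ^ m * L s ^ (k + 1 + j)) atTop)).congr' ?_ ?_
    · filter_upwards [hLne] with s hs
      simp only [inv_pow]
      have hs' := hune s
      field_simp
      try ring
    · exact Eventually.of_forall fun s => by simp
  refine not_sum_eventuallyEq_zero p.support (Polynomial.support_nonempty.mpr hp)
    (fun k s => F k (radial z₀ s) * L s ^ k) ?_ ?_ (l := atTop) ?_
  · intro k hk
    have h1 := ((hg k hk).continuousAt.tendsto.comp (tendsto_radial z₀)).eventually_ne (hg0 k hk)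
    filter_upwards [hLne, h1, (tendsto_radial z₀).eventually (hfac k hk)] with s hs1 hs2 hs3
    rw [hs3, radial_sub, smul_eq_mul]
    exact mul_ne_zero (mul_ne_zero (pow_ne_zero _ (mul_ne_zero (neg_ne_zero.mpr (hune s)) hz0))
      hs2) (pow_ne_zero _ hs1)
  · intro k hk k' hk' hne
    rw [(hΘ k hk).isLittleO_congr_left, (hΘ k hk).isLittleO_congr_right,
      (hΘ k' hk').isLittleO_congr_left, (hΘ k' hk').isLittleO_congr_right]
    rcases lt_trichotomy (n k) (n k') with hn | hn | hn
    · obtain ⟨j, hj⟩ := Nat.exists_eq_add_of_lt hn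
      right
      rw [hj, add_right_comm]
      exact hlt _ _ _ j
    · rw [hn]
      rcases hne.lt_or_gt with hk | hk
      · obtain ⟨j, rfl⟩ := Nat.exists_eq_add_of_lt hk
        left
        rw [add_right_comm]
        exact hlt' _ _ j
      · obtain ⟨j, rfl⟩ := Nat.exists_eq_add_of_lt hk
        right
        rw [add_right_comm]
        exact hlt' _ _ j
    · obtain ⟨j, hj⟩ := Nat.exists_eq_add_of_lt hn
      left
      rw [hj, add_right_comm]
      exact hlt _ _ _ j
  · filter_upwards [eventually_ge_atTop (0 : ℝ)] with s hs
    have h1 := congrFun hp0 ⟨radial z₀ s, radial_mem_disc h hs⟩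
    rw [Polynomial.aeval_def, Polynomial.eval₂_eq_sum, Polynomial.sum_def, Finset.sum_apply] at h1
    rw [← Pi.zero_apply (M := fun _ : disc => ℂ) ⟨radial z₀ s, radial_mem_disc h hs⟩, ← h1]
    refine Finset.sum_congr rfl fun k _ => ?_
    rw [← hF k ⟨radial z₀ s, radial_mem_disc h hs⟩]
    rfl

theorem entireExp_mem_analyticSubalgebra (r : ℕ+) (z₀ : ℂ) :
    expEllD r ∈ analyticSubalgebra z₀ :=
  ⟨entireExp r, (differentiable_entireExp r).differentiableOn, analyticAt_entireExp r z₀,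
    fun z => exp_ell r z.2⟩

/-- Near z₀ there is a branch of log F_r. It has the same derivative F_r'/F_r as ℓ_r on the convex
intersection with D, so the two differ there by a constant. -/
theorem ellD_mem_analyticSubalgebra (r : ℕ+) {z₀ : ℂ} (hr : entireExp r z₀ ≠ 0) :
    ellD r ∈ analyticSubalgebra z₀ := by
  classical
  set g : ℂ → ℂ := fun z => Complex.log (entireExp r z / entireExp r z₀) with hg
  have hgF : ∀ᶠ z in 𝓝 z₀, entireExp r z / entireExp r z₀ ∈ Complex.slitPlane := by
    have h1 : ContinuousAt (fun z => entireExp r z / entireExp r z₀) z₀ :=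
      (analyticAt_entireExp r z₀).continuousAt.div_const _
    refine h1.eventually_mem (Complex.isOpen_slitPlane.mem_nhds ?_)
    rw [div_self hr]
    exact Complex.one_mem_slitPlane
  obtain ⟨ε, hε, hball⟩ := Metric.eventually_nhds_iff_ball.mp hgF
  have hgd : ∀ z ∈ Metric.ball z₀ ε, HasDerivAt g (deriv (entireExp r) z / entireExp r z) z := by
    intro z hz
    have h1 := (((differentiable_entireExp r) z).hasDerivAt.div_const (entireExp r z₀)).clog
      (hball z hz)
    refine h1.congr_deriv ?_
    rw [div_div_div_cancel_right₀ hr]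
  have hld : ∀ z ∈ disc, HasDerivAt (ell r) (deriv (entireExp r) z / entireExp r z) z := by
    intro z hz
    have h1 := ((differentiableOn_ell r).differentiableAt
      (Metric.isOpen_ball.mem_nhds hz)).hasDerivAt
    have h2 : deriv (entireExp r) z = Complex.exp (ell r z) * deriv (ell r) z := by
      rw [← h1.cexp.deriv]
      refine EventuallyEq.deriv_eq ?_
      filter_upwards [Metric.isOpen_ball.mem_nhds hz] with w hw
      exact (exp_ell r hw).symm
    refine h1.congr_deriv ?_
    rw [h2, ← exp_ell r hz, mul_div_cancel_left₀ _ (Complex.exp_ne_zero _)]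
  obtain ⟨c, hc⟩ : ∃ c : ℂ, ∀ z ∈ disc ∩ Metric.ball z₀ ε, ell r z = g z + c := by
    have hconv : Convex ℝ (disc ∩ Metric.ball z₀ ε) := (convex_ball 0 1).inter (convex_ball z₀ ε)
    have hopen : IsOpen (disc ∩ Metric.ball z₀ ε) := Metric.isOpen_ball.inter Metric.isOpen_ball
    obtain ⟨c, hc⟩ := hopen.exists_is_const_of_deriv_eq_zero hconv.isPreconnected
      (f := fun z => ell r z - g z)
      (fun z hz => ((hld z hz.1).sub (hgd z hz.2)).differentiableAt.differentiableWithinAt)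
      (fun z hz => by
        have h1 := (hld z hz.1).sub (hgd z hz.2)
        rw [sub_self] at h1
        exact h1.deriv)
    exact ⟨c, fun z hz => by rw [← hc z hz]; ring⟩
  -- One function has to equal ℓ_r on D and be analytic at z₀, hence the gluing.
  refine ⟨fun z => if z ∈ disc then ell r z else g z + c, ?_, ?_, fun z => by simp [ellD]⟩
  · exact (differentiableOn_ell r).congr fun z hz => if_pos hz
  · have h1 : DifferentiableOn ℂ (fun z => g z + c) (Metric.ball z₀ ε) := fun z hz =>
      ((hgd z hz).add_const c).differentiableAt.differentiableWithinAt
    refine (h1.analyticAt (Metric.ball_mem_nhds z₀ hε)).congr ?_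
    filter_upwards [Metric.ball_mem_nhds z₀ hε] with z hz
    split_ifs with hzd
    · exact (hc z ⟨hzd, hz⟩).symm
    · rfl

/-- One has |ℓ_r| ≥ -Re ℓ_r = -log|F_r|, and F_r tends to 0. -/
theorem tendsto_norm_ell_radial (r : ℕ+) {z₀ : ℂ} (h : ‖z₀‖ = 1) (hr : entireExp r z₀ = 0) :
    Tendsto (fun s => ‖ell r (radial z₀ s)‖) atTop atTop := by
  have h1 : Tendsto (fun s => ‖entireExp r (radial z₀ s)‖) atTop (𝓝[>] 0) := by
    rw [tendsto_nhdsWithin_iff]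
    constructor
    · have := ((analyticAt_entireExp r z₀).continuousAt.tendsto.comp (tendsto_radial z₀)).norm
      rwa [hr, norm_zero] at this
    · filter_upwards [eventually_ge_atTop (0 : ℝ)] with s hs
      exact norm_pos_iff.mpr (entireExp_ne_zero_of_mem_disc r (radial_mem_disc h hs))
  have h2 := tendsto_neg_atBot_atTop.comp (Real.tendsto_log_nhdsGT_zero.comp h1)
  refine tendsto_atTop_mono' _ ?_ h2
  filter_upwards [eventually_ge_atTop (0 : ℝ)] with s hs
  simp only [Function.comp_apply]
  rw [← exp_ell r (radial_mem_disc h hs), Complex.norm_exp, Real.log_exp]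
  exact (neg_le_abs _).trans (Complex.abs_re_le_norm _)

/-- On the radius 1-|z| = e^{-s}, so the bound on ℓ_r becomes 1 + 2s, which is at most 3s for s ≥ 1.
-/
theorem tendsto_exp_mul_norm_ell_radial (r : ℕ+) {z₀ : ℂ} (h : ‖z₀‖ = 1) (k : ℕ) :
    Tendsto (fun s => Real.exp (-s) * ‖ell r (radial z₀ s)‖ ^ k) atTop (𝓝 0) := by
  have h1 := (Real.tendsto_pow_mul_exp_neg_atTop_nhds_zero k).const_mul ((3 : ℝ) ^ k)
  rw [mul_zero] at h1
  refine squeeze_zero' (Eventually.of_forall fun s => by positivity) ?_ h1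
  filter_upwards [eventually_ge_atTop (1 : ℝ)] with s hs
  have hs0 : 0 ≤ s := by linarith
  have h2 := norm_ell_le r (radial_mem_disc h hs0)
  rw [norm_radial h hs0, sub_sub_cancel, Real.log_exp, neg_neg] at h2
  rw [← mul_assoc, ← mul_pow, mul_comm]
  gcongr
  linarith

theorem transcendental_ellD (r : ℕ+) {z₀ : ℂ} (h : ‖z₀‖ = 1) (hr : entireExp r z₀ = 0) :
    Transcendental (analyticSubalgebra z₀) (ellD r) :=
  transcendental_of_radial_growth h (ell r) (tendsto_norm_ell_radial r h hr)
    (tendsto_exp_mul_norm_ell_radial r h)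

/-- The zero `e^{iπ/n}` of `e^{ℓ_n}` on the unit circle. -/
noncomputable def circleZero (n : ℕ+) : ℂ := Complex.exp (Real.pi / (n : ℕ) * Complex.I)

theorem norm_circleZero (n : ℕ+) : ‖circleZero n‖ = 1 := by
  rw [circleZero, show ((Real.pi : ℂ) / (n : ℕ) * Complex.I)
    = ((Real.pi / (n : ℕ) : ℝ) : ℂ) * Complex.I by push_cast; rfl, Complex.norm_exp_ofReal_mul_I]

theorem entireExp_eq_zero_iff_of_norm_eq_one (r : ℕ+) {z : ℂ} (hz : ‖z‖ = 1) :
    entireExp r z = 0 ↔ z ^ (r : ℕ) = -1 := by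
  have h1 : (-1 : ℂ) ^ (r : ℕ) * (-1) ^ (r : ℕ) = 1 := by rw [← mul_pow]; simp
  have h2 := neg_one_pow_mul_self r
  rw [entireExp_eq_zero_iff]
  simp only [Set.mem_iUnion, exists_prop]
  constructor
  · rintro ⟨χ, hχ, n, hn, rfl⟩
    rw [norm_mul, norm_eq_one_of_mem_rootsG hχ, one_mul, Complex.norm_intCast] at hz
    have h3 : |n| = 1 := by exact_mod_cast hz
    rw [abs_of_neg (by omega)] at h3
    rw [mul_pow, show χ ^ (r : ℕ) = _ from hχ, show n = -1 by omega]
    simpa using h2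
  · intro h
    refine ⟨-z, ?_, -1, le_rfl, by simp⟩
    change (-z) ^ (r : ℕ) = _
    rw [neg_pow, h]
    linear_combination -(-1 : ℂ) ^ (r : ℕ) * h2 + (-1 : ℂ) ^ ((r : ℕ) - 1) * h1

theorem circleZero_pow (n : ℕ+) (k : ℕ) :
    circleZero n ^ k = Complex.exp (((Real.pi * k / (n : ℕ) : ℝ) : ℂ) * Complex.I) := by
  rw [circleZero, ← Complex.exp_nat_mul]
  congr 1
  push_cast
  ring

theorem entireExp_circleZero (n : ℕ+) : entireExp n (circleZero n) = 0 := by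
  rw [entireExp_eq_zero_iff_of_norm_eq_one n (norm_circleZero n), circleZero_pow,
    mul_div_cancel_right₀ _ (Nat.cast_ne_zero.mpr n.pos.ne'), Complex.exp_pi_mul_I]

/-- The r-th power of e^{iπ/n} has argument in (0, π), so it is not -1. -/
theorem entireExp_circleZero_ne_zero {r n : ℕ+} (h : r < n) :
    entireExp r (circleZero n) ≠ 0 := by
  rw [Ne, entireExp_eq_zero_iff_of_norm_eq_one r (norm_circleZero n), circleZero_pow]
  intro h1
  have h2 := congrArg Complex.im h1
  rw [Complex.exp_ofReal_mul_I_im, Complex.neg_im, Complex.one_im, neg_zero] at h2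
  have hr : (0 : ℝ) < (r : ℕ) := Nat.cast_pos.mpr r.pos
  have hn : (0 : ℝ) < (n : ℕ) := Nat.cast_pos.mpr n.pos
  have hrn : ((r : ℕ) : ℝ) < (n : ℕ) := Nat.cast_lt.mpr (by exact_mod_cast h)
  refine (Real.sin_pos_of_pos_of_lt_pi (by positivity) ?_).ne' h2
  rw [div_lt_iff₀ hn]
  exact mul_lt_mul_of_pos_left hrn Real.pi_pos

end AnalyticSubalgebra

/-! ### Algebraic independence of the ℓ_r, and of ℓ_r with e^{ℓ_r} -/

section AlgebraicIndependence

theorem transcendental_adjoin_ellD {n : ℕ+} {S : Set (disc → ℂ)}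
    (hS : S ⊆ analyticSubalgebra (circleZero n)) :
    Transcendental (Algebra.adjoin ℂ S) (ellD n) :=
  (transcendental_ellD n (norm_circleZero n) (entireExp_circleZero n)).of_tower_top_of_subalgebra_le
    (Algebra.adjoin_le hS)

/-- Adding indices in increasing order keeps all previous ℓ_r analytic at `circleZero n`, where ℓ_n
is singular. -/
theorem algebraicIndependent_ellD : AlgebraicIndependent ℂ ellD := by
  refine algebraicIndependent_of_finite_type fun t ht => ?_
  lift t to Finset ℕ+ using ht
  induction t using Finset.induction_on_max with
  | empty =>
    rw [Finset.coe_empty]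
    exact algebraicIndependent_empty_type_iff.mpr (FaithfulSMul.algebraMap_injective _ _)
  | insert n t hn ih =>
    rw [Finset.coe_insert]
    refine AlgebraicIndepOn.insert ih (transcendental_adjoin_ellD ?_)
    rintro _ ⟨r, hr, rfl⟩
    exact ellD_mem_analyticSubalgebra r (entireExp_circleZero_ne_zero (hn r hr))

theorem algebraicIndependent_ellD_expEllD {r : ℕ+} (hr : Transcendental ℂ (expEllD r)) :
    AlgebraicIndependent ℂ ![ellD r, expEllD r] := by
  have h0 : AlgebraicIndependent ℂ (fun _ : Fin 1 => expEllD r) :=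
    (algebraicIndependent_singleton_iff 0).mpr hr
  have h1 := (h0.option_iff_transcendental (ellD r)).mpr
    (transcendental_adjoin_ellD (by
      rintro _ ⟨_, rfl⟩
      exact entireExp_mem_analyticSubalgebra r _))
  have h2 := h1.comp ![none, some 0] (by
    intro i j; fin_cases i <;> fin_cases j <;> simp)
  convert h2 using 1
  ext i : 1
  fin_cases i <;> rfl

end AlgebraicIndependence

end Eulerian

namespace Eulerian

open Filter

/-! ### Cotangent values and the nonvanishing of L(1, χ) -/

section CotangentSums

/-- Both powers lie between (n+1)^{-s} and n^{-s}, whose gap is O(n^{-2}) uniformly in s. This lets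
a series of differences pass to s = 1, where the separate series diverge. -/
theorem abs_rpow_neg_sub_rpow_neg_le {n : ℕ} (hn : 1 ≤ n) {x y s : ℝ} (hx : (n : ℝ) ≤ x)
    (hx' : x ≤ n + 1) (hy : (n : ℝ) ≤ y) (hy' : y ≤ n + 1) (hs : 1 ≤ s) (hs' : s ≤ 2) :
    |x ^ (-s) - y ^ (-s)| ≤ 2 / (n : ℝ) ^ 2 := by
  have hn0 : (1 : ℝ) ≤ n := by exact_mod_cast hn
  have hmono : ∀ w : ℝ, (n : ℝ) ≤ w → w ≤ n + 1 →
      ((n : ℝ) + 1) ^ (-s) ≤ w ^ (-s) ∧ w ^ (-s) ≤ (n : ℝ) ^ (-s) := fun w h1 h2 =>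
    ⟨Real.rpow_le_rpow_of_nonpos (by linarith) h2 (by linarith),
      Real.rpow_le_rpow_of_nonpos (by linarith) h1 (by linarith)⟩
  have h1 : |x ^ (-s) - y ^ (-s)| ≤ (n : ℝ) ^ (-s) - ((n : ℝ) + 1) ^ (-s) := by
    have h2 := hmono x hx hx'
    have h3 := hmono y hy hy'
    rw [abs_le]
    constructor <;> linarith
  refine h1.trans ?_
  have h4 : ((n : ℝ) + 1) ^ (-s) = (n : ℝ) ^ (-s) * ((n : ℝ) / (n + 1)) ^ s := by
    rw [Real.div_rpow (by linarith) (by linarith), Real.rpow_neg (by linarith),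
      Real.rpow_neg (by linarith)]
    have : (n : ℝ) ^ s ≠ 0 := (Real.rpow_pos_of_pos (by linarith) s).ne'
    field_simp
  have hq0 : 0 < (n : ℝ) / (n + 1) := by positivity
  have hq1 : (n : ℝ) / (n + 1) ≤ 1 := by rw [div_le_one (by linarith)]; linarith
  have h5 : ((n : ℝ) / (n + 1)) ^ (2 : ℝ) ≤ ((n : ℝ) / (n + 1)) ^ s :=
    Real.rpow_le_rpow_of_exponent_ge hq0 hq1 hs'
  have h6 : (n : ℝ) ^ (-s) ≤ (n : ℝ) ^ (-1 : ℝ) :=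
    Real.rpow_le_rpow_of_exponent_le hn0 (by linarith)
  rw [Real.rpow_neg_one] at h6
  rw [Real.rpow_two] at h5
  have h7 : 0 < (n : ℝ) ^ (-s) := Real.rpow_pos_of_pos (by linarith) _
  have h8 : 1 - ((n : ℝ) / (n + 1)) ^ 2 ≤ 2 / n := by
    rw [div_pow, sub_le_iff_le_add, ← sub_le_iff_le_add', le_div_iff₀ (by positivity)]
    have : (1 - 2 / (n : ℝ)) * (n + 1) ^ 2 = (n : ℝ) ^ 2 - 3 - 2 / n := by
      field_simp; ring
    rw [this]
    have : 0 < 2 / (n : ℝ) := by positivity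
    linarith
  calc (n : ℝ) ^ (-s) - ((n : ℝ) + 1) ^ (-s)
      = (n : ℝ) ^ (-s) * (1 - ((n : ℝ) / (n + 1)) ^ s) := by rw [h4]; ring
    _ ≤ (n : ℝ)⁻¹ * (2 / n) := by
        refine mul_le_mul h6 (by linarith) ?_ (by positivity)
        have : ((n : ℝ) / (n + 1)) ^ s ≤ 1 := Real.rpow_le_one hq0.le hq1 (by linarith)
        linarith
    _ = 2 / (n : ℝ) ^ 2 := by field_simp

theorem one_div_cpow_ofReal {x : ℝ} (hx : 0 < x) (s : ℝ) :
    1 / (x : ℂ) ^ (s : ℂ) = ((x ^ (-s) : ℝ) : ℂ) := by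
  rw [Real.rpow_neg hx.le, Complex.ofReal_inv, Complex.ofReal_cpow hx.le, one_div]

/-- Let s decrease to 1 in the Dirichlet series. Pairing n + a with n + 1 - a gives domination for n
≥ 1, and the limit is a regrouped partial fraction series of the cotangent. -/
theorem hurwitzZetaOdd_one {a : ℝ} (h0 : 0 < a) (h1 : a < 1) :
    HurwitzZeta.hurwitzZetaOdd (a : UnitAddCircle) 1 = Real.pi / 2 * Complex.cot (Real.pi * a) := by
  set g : ℕ → ℝ → ℝ := fun n s => ((n + a) ^ (-s) - (n + 1 - a) ^ (-s)) / 2 with hg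
  have hsum : ∀ s : ℝ, 1 < s →
      HasSum (fun n => (g n s : ℂ)) (HurwitzZeta.hurwitzZetaOdd (a : UnitAddCircle) s) := by
    intro s hs
    refine (HurwitzZeta.hasSum_nat_hurwitzZetaOdd_of_mem_Icc ⟨h0.le, h1.le⟩
      (s := (s : ℂ)) (by simpa using hs)).congr_fun fun n => ?_
    have hn : (0 : ℝ) ≤ n := Nat.cast_nonneg n
    have e1 : ((n : ℂ) + a) = ((n + a : ℝ) : ℂ) := by push_cast; rfl
    have e2 : ((n : ℂ) + 1 - a) = ((n + 1 - a : ℝ) : ℂ) := by push_cast; rfl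
    rw [e1, e2, one_div_cpow_ofReal (by linarith), one_div_cpow_ofReal (by linarith), hg]
    push_cast
    rfl
  have hcont : ∀ n, Tendsto (fun s => (g n s : ℂ)) (𝓝[>] 1) (𝓝 (g n 1 : ℂ)) := by
    intro n
    have hn : (0 : ℝ) ≤ n := Nat.cast_nonneg n
    have : Continuous (fun s => (g n s : ℂ)) := by
      refine Complex.continuous_ofReal.comp (Continuous.div_const (Continuous.sub ?_ ?_) 2)
      · exact (Real.continuous_const_rpow (by linarith)).comp continuous_neg
      · exact (Real.continuous_const_rpow (by linarith)).comp continuous_neg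
    exact (this.tendsto 1).mono_left nhdsWithin_le_nhds
  have hbound : ∀ n : ℕ, ∀ s ∈ Set.Icc (1 : ℝ) 2, ‖(g (n + 1) s : ℂ)‖ ≤ 1 / ((n + 1 : ℕ) : ℝ) ^ 2 := by
    intro n s hs
    have h := abs_rpow_neg_sub_rpow_neg_le (n := n + 1) (by omega) (x := (n + 1 : ℕ) + a)
      (y := (n + 1 : ℕ) + 1 - a) (s := s) (by linarith) (by linarith) (by linarith) (by linarith)
      hs.1 hs.2
    rw [Complex.norm_real, hg, Real.norm_eq_abs, abs_div, abs_two, div_le_iff₀ two_pos]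
    refine h.trans (le_of_eq ?_)
    ring
  have hbs : Summable (fun n : ℕ => 1 / ((n + 1 : ℕ) : ℝ) ^ 2) :=
    (summable_nat_add_iff (f := fun n : ℕ => 1 / (n : ℝ) ^ 2) 1).mpr
      (Real.summable_one_div_nat_pow.mpr one_lt_two)
  have hlim : Tendsto (fun s => ∑' n, (g (n + 1) s : ℂ)) (𝓝[>] 1) (𝓝 (∑' n, (g (n + 1) 1 : ℂ))) := by
    refine tendsto_tsum_of_dominated_convergence hbs (fun n => hcont (n + 1)) ?_
    filter_upwards [Ioo_mem_nhdsGT (one_lt_two (α := ℝ))] with s hs n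
    exact hbound n s ⟨hs.1.le, hs.2.le⟩
  have hS1 : Summable (fun n => (g (n + 1) 1 : ℂ)) :=
    Summable.of_norm_bounded hbs fun n => hbound n 1 ⟨le_rfl, by norm_num⟩
  have hL : Tendsto (fun s : ℝ => HurwitzZeta.hurwitzZetaOdd (a : UnitAddCircle) s) (𝓝[>] 1)
      (𝓝 (HurwitzZeta.hurwitzZetaOdd (a : UnitAddCircle) 1)) := by
    have h := ((HurwitzZeta.differentiable_hurwitzZetaOdd (a : UnitAddCircle)).continuous.comp
      Complex.continuous_ofReal).tendsto 1
    rw [Function.comp_apply, Complex.ofReal_one] at h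
    exact h.mono_left nhdsWithin_le_nhds
  have hval : HurwitzZeta.hurwitzZetaOdd (a : UnitAddCircle) 1
      = g 0 1 + ∑' n, (g (n + 1) 1 : ℂ) := by
    refine tendsto_nhds_unique hL (((hcont 0).add hlim).congr' ?_)
    filter_upwards [self_mem_nhdsWithin] with s hs
    rw [← (hsum s hs).tsum_eq, (hsum s hs).summable.tsum_eq_zero_add]
  have hS : Summable (fun n => (g n 1 : ℂ)) := (summable_nat_add_iff 1).mp hS1
  rw [← hS.tsum_eq_zero_add] at hval
  have hx : (a : ℂ) ∈ Complex.integerComplement := by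
    rintro ⟨m, hm⟩
    have hm' : (m : ℝ) = a := by exact_mod_cast hm
    rw [← hm'] at h0 h1
    have : (0 : ℤ) < m := by exact_mod_cast h0
    have : m < (1 : ℤ) := by exact_mod_cast h1
    omega
  have hcot := (summable_cotTerm hx).hasSum.tendsto_sum_nat
  have hcot' : ∑' n, cotTerm (a : ℂ) n = Real.pi * Complex.cot (Real.pi * a) - 1 / a :=
    (cot_series_rep' hx).symm
  rw [hcot'] at hcot
  have hinv : Tendsto (fun N : ℕ => (1 : ℂ) / (N + a)) atTop (𝓝 0) := by
    have h : Tendsto (fun N : ℕ => ((1 / (N + a) : ℝ) : ℂ)) atTop (𝓝 ((0 : ℝ) : ℂ)) :=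
      (Complex.continuous_ofReal.tendsto 0).comp (tendsto_const_nhds.div_atTop
        (tendsto_atTop_add_const_right _ a tendsto_natCast_atTop_atTop))
    simpa using h
  have hne : ∀ N : ℕ, (N : ℂ) + a ≠ 0 := fun N => by
    have : (0 : ℝ) < N + a := by positivity
    exact_mod_cast this.ne'
  -- The pairings in `g` and in `cotTerm` are offset by one index, which leaves 1/a and the
  -- vanishing boundary term 1/(N + a).
  have hpart : ∀ N : ℕ, ∑ n ∈ Finset.range N, (g n 1 : ℂ)
      = (∑ n ∈ Finset.range N, cotTerm (a : ℂ) n + 1 / a - 1 / (N + a)) / 2 := by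
    intro N
    induction N with
    | zero => simp
    | succ N ih =>
      have hn1 : (N : ℂ) + 1 - a ≠ 0 := by
        have : (0 : ℝ) < N + 1 - a := by
          have := Nat.cast_nonneg (α := ℝ) N
          linarith
        exact_mod_cast this.ne'
      have e : (g N 1 : ℂ) = (1 / (N + a) - 1 / (N + 1 - a)) / 2 := by
        simp only [hg, Real.rpow_neg_one]
        push_cast
        simp only [one_div]
      have e2 : (1 : ℂ) / (a - (N + 1)) = -(1 / (N + 1 - a)) := by
        rw [← neg_sub, one_div_neg_eq_neg_one_div]
      rw [Finset.sum_range_succ, Finset.sum_range_succ, ih, e, cotTerm, e2]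
      push_cast
      ring
  rw [hval]
  refine tendsto_nhds_unique hS.hasSum.tendsto_sum_nat ?_
  simp_rw [hpart]
  have h := ((hcot.add_const (1 / (a : ℂ))).sub hinv).div_const 2
  convert h using 2
  ring

/-- The value `cot (π k / N)`. -/
noncomputable def cotVal (N k : ℕ) : ℂ := Complex.cot (Real.pi * ((k / N : ℝ) : ℂ))

theorem cotVal_add_self (N k : ℕ) (hN : N ≠ 0) : cotVal N (k + N) = cotVal N k := by
  have hN' : (N : ℝ) ≠ 0 := Nat.cast_ne_zero.mpr hN
  rw [cotVal, cotVal, Nat.cast_add, add_div, div_self hN', Complex.ofReal_add, mul_add,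
    Complex.ofReal_one, mul_one, Complex.cot, Complex.cot, Complex.cos_add_pi, Complex.sin_add_pi,
    neg_div_neg_eq]

theorem cotVal_congr {N k m : ℕ} (hN : N ≠ 0) (h : k ≡ m [MOD N]) : cotVal N k = cotVal N m := by
  have h1 : ∀ k, cotVal N k = cotVal N (k % N) := by
    intro k
    conv_lhs => rw [← Nat.mod_add_div k N]
    generalize k / N = q
    induction q with
    | zero => simp
    | succ q ih => rw [Nat.mul_succ, ← add_assoc, cotVal_add_self _ _ hN, ih]
  rw [h1 k, h1 m, h]

/-- By `hurwitzZetaOdd_one` the sum is a nonzero multiple of L(1, χ). -/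
theorem sum_mul_cotVal_ne_zero {N : ℕ} [NeZero N] {χ : DirichletCharacter ℂ N} (hχ : χ.Odd) :
    ∑ j : ZMod N, χ j * cotVal N j.val ≠ 0 := by
  have hχ1 : χ ≠ 1 := by
    rintro rfl
    have : (1 : DirichletCharacter ℂ N) (-1) = -1 := hχ
    rw [MulChar.one_apply isUnit_one.neg] at this
    norm_num at this
  have hL := DirichletCharacter.LFunction_apply_one_ne_zero hχ1
  rw [DirichletCharacter.LFunction, ZMod.LFunction_def_odd hχ.to_fun] at hL
  have h1 := right_ne_zero_of_mul hL
  contrapose! h1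
  have hN : (0 : ℝ) < N := Nat.cast_pos.mpr (NeZero.pos N)
  rw [← mul_zero (Real.pi / 2 : ℂ), ← h1, Finset.mul_sum]
  refine Finset.sum_congr rfl fun j _ => ?_
  by_cases hj : j = 0
  · have h0 : χ j = 0 := by
      rw [hj, MulChar.map_nonunit]
      intro hu
      rw [isUnit_zero_iff] at hu
      have : (-1 : ZMod N) = 1 := by rw [← mul_one (-1 : ZMod N), ← hu, mul_zero]
      have h2 : χ (-1) = -1 := hχ
      rw [this, map_one] at h2
      norm_num at h2
    simp [h0]
  · have hj0 : 0 < j.val := Nat.pos_of_ne_zero ((ZMod.val_eq_zero j).not.mpr hj)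
    rw [ZMod.toAddCircle_apply, hurwitzZetaOdd_one (by positivity)
      ((div_lt_one hN).mpr (by exact_mod_cast ZMod.val_lt j)), cotVal]
    ring

end CotangentSums

/-! ### Galois conjugation of rational relations between cotangents -/

section GaloisConjugation

/-- Summation by parts, using that the N-th roots' geometric sum vanishes. The rational coefficients
are what conjugation requires. -/
theorem inv_sub_one_eq_sum {N : ℕ} {ω : ℂ} (h : ω ^ N = 1) (h1 : ω ≠ 1) (hN : N ≠ 0) :
    (ω - 1)⁻¹ = ∑ j ∈ Finset.range N, ((j / N : ℚ) : ℂ) * ω ^ j := by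
  have hs : ∀ n : ℕ, (ω - 1) * ∑ j ∈ Finset.range n, (j : ℂ) * ω ^ j
      = n * ω ^ n - ∑ j ∈ Finset.range n, ω ^ (j + 1) := by
    intro n
    induction n with
    | zero => simp
    | succ n ih =>
      rw [Finset.sum_range_succ, mul_add, ih, Finset.sum_range_succ]
      push_cast
      ring
  have hg : ∑ j ∈ Finset.range N, ω ^ (j + 1) = 0 := by
    simp_rw [pow_succ]
    rw [← Finset.sum_mul, geom_sum_eq h1, h]
    simp
  have hN' : (N : ℂ) ≠ 0 := Nat.cast_ne_zero.mpr hN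
  have h3 := hs N
  rw [hg, h, mul_one, sub_zero] at h3
  rw [inv_eq_iff_eq_inv, ← one_div, eq_div_iff]
  · have : ∑ j ∈ Finset.range N, ((j / N : ℚ) : ℂ) * ω ^ j
        = (N : ℂ)⁻¹ * ∑ j ∈ Finset.range N, (j : ℂ) * ω ^ j := by
      rw [Finset.mul_sum]
      refine Finset.sum_congr rfl fun j _ => ?_
      push_cast
      ring
    rw [this, mul_left_comm, h3, inv_mul_cancel₀ hN']
  · intro h0
    have : ∑ j ∈ Finset.range N, ((j / N : ℚ) : ℂ) * ω ^ j
        = (N : ℂ)⁻¹ * ∑ j ∈ Finset.range N, (j : ℂ) * ω ^ j := by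
      rw [Finset.mul_sum]
      refine Finset.sum_congr rfl fun j _ => ?_
      push_cast
      ring
    rw [this] at h0
    have h4 := (mul_eq_zero.mp h0).resolve_left (inv_ne_zero hN')
    rw [h4, mul_zero] at h3
    exact hN' h3.symm

theorem exp_pow_ne_one {N k : ℕ} (hN : 2 ≤ N) (hk : k.Coprime N) :
    Complex.exp (2 * Real.pi * Complex.I / N) ^ k ≠ 1 := by
  have hprim := Complex.isPrimitiveRoot_exp N (by omega)
  rw [Ne, hprim.pow_eq_one_iff_dvd]
  intro h
  have := Nat.Coprime.eq_one_of_dvd hk.symm h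
  omega

theorem cotVal_eq_inv {N k : ℕ} (hN : 2 ≤ N) (hk : k.Coprime N) :
    cotVal N k = Complex.I * (1 + 2 *
      (Complex.exp (2 * Real.pi * Complex.I / N) ^ k - 1)⁻¹) := by
  have h1 := exp_pow_ne_one hN hk
  have h2 : Complex.exp (2 * Real.pi * Complex.I / N) ^ k
      = Complex.exp (2 * Complex.I * (Real.pi * ((k / N : ℝ) : ℂ))) := by
    rw [← Complex.exp_nat_mul]
    congr 1
    push_cast
    ring
  rw [cotVal, Complex.cot_eq_exp_ratio, ← h2]
  generalize Complex.exp (2 * Real.pi * Complex.I / N) ^ k = ω at h1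
  have h3 : ω - 1 ≠ 0 := sub_ne_zero.mpr h1
  have h4 : 1 - ω ≠ 0 := sub_ne_zero.mpr h1.symm
  have hI := Complex.I_ne_zero
  field_simp
  linear_combination -(ω + 1) * (1 - ω) * Complex.I_sq

/-- Up to the factor i, the sum is the value at a power of the primitive M-th root ζ of a polynomial
over ℚ. A zero at ζ forces divisibility by the cyclotomic polynomial, hence a zero at ζ^k. -/
theorem sum_cotVal_eq_zero_of_coprime (S : Finset ℕ) (b : ℕ → ℚ) (M : ℕ) (hM : M ≠ 0)
    (hS : ∀ N ∈ S, 2 ≤ N ∧ N ∣ M) (h : ∑ N ∈ S, (b N : ℂ) * cotVal N 1 = 0)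
    {k : ℕ} (hk : k.Coprime M) : ∑ N ∈ S, (b N : ℂ) * cotVal N k = 0 := by
  set ζ := Complex.exp (2 * Real.pi * Complex.I / M) with hζ
  have hprim : IsPrimitiveRoot ζ M := Complex.isPrimitiveRoot_exp M hM
  set P : Polynomial ℚ := ∑ N ∈ S, Polynomial.C (b N) * (1 + 2 *
    ∑ j ∈ Finset.range N, Polynomial.C (j / N : ℚ) * Polynomial.X ^ (M / N * j)) with hP
  have hPk : ∀ k : ℕ, k.Coprime M → Complex.I * Polynomial.aeval (ζ ^ k) P
      = ∑ N ∈ S, (b N : ℂ) * cotVal N k := by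
    intro k hk
    rw [hP, map_sum, Finset.mul_sum]
    refine Finset.sum_congr rfl fun N hN => ?_
    obtain ⟨hN2, d, rfl⟩ := hS N hN
    have hN0 : 0 < N := by omega
    have hd : d ≠ 0 := fun h0 => hM (by rw [h0, mul_zero])
    have hkN : k.Coprime N := Nat.Coprime.coprime_mul_right_right hk
    have hω : (ζ ^ k) ^ d = Complex.exp (2 * Real.pi * Complex.I / N) ^ k := by
      rw [← pow_mul, mul_comm k, pow_mul, hζ, ← Complex.exp_nat_mul]
      congr 2
      have : (d : ℂ) ≠ 0 := Nat.cast_ne_zero.mpr hd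
      push_cast
      field_simp
    have hω1 : (Complex.exp (2 * Real.pi * Complex.I / N) ^ k) ^ N = 1 := by
      rw [← pow_mul, mul_comm k N, pow_mul,
        (Complex.isPrimitiveRoot_exp N hN0.ne').pow_eq_one, one_pow]
    rw [cotVal_eq_inv hN2 hkN, inv_sub_one_eq_sum hω1 (exp_pow_ne_one hN2 hkN) hN0.ne',
      Nat.mul_div_cancel_left d hN0]
    simp only [map_mul, map_add, map_one, map_sum, map_pow, Polynomial.aeval_X,
      Polynomial.aeval_C, map_ofNat, pow_mul, hω, eq_ratCast]
    ring
  have h1 : Polynomial.aeval ζ P = 0 := by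
    have h2 := hPk 1 (Nat.coprime_one_left M)
    rw [h, pow_one] at h2
    exact (mul_eq_zero.mp h2).resolve_left Complex.I_ne_zero
  have h2 : Polynomial.cyclotomic M ℚ ∣ P := by
    rw [Polynomial.cyclotomic_eq_minpoly_rat hprim (Nat.pos_of_ne_zero hM)]
    exact minpoly.dvd ℚ ζ h1
  rw [← hPk k hk]
  have h3 : Polynomial.aeval (ζ ^ k) (Polynomial.cyclotomic M ℚ) = 0 := by
    rw [Polynomial.cyclotomic_eq_minpoly_rat (hprim.pow_of_coprime k hk) (Nat.pos_of_ne_zero hM)]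
    exact minpoly.aeval ℚ _
  obtain ⟨Q, hQ⟩ := h2
  rw [hQ, map_mul, h3, zero_mul, mul_zero]

end GaloisConjugation

end Eulerian

namespace Eulerian

open Filter

/-! ### Odd characters that factor through no N/p -/

section OddCharacters

theorem unitsMap_eq_one_iff {m N : ℕ} [NeZero N] (h : m ∣ N) (u : (ZMod N)ˣ) :
    ZMod.unitsMap h u = 1 ↔ (m : ℤ) ∣ ((u : ZMod N).val : ℤ) - 1 := by
  rw [Units.ext_iff, ZMod.unitsMap_val, Units.val_one]
  have h1 : ((u : ZMod N).cast : ZMod m) = (((u : ZMod N).val : ℤ) : ZMod m) := by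
    rw [Int.cast_natCast, ← ZMod.natCast_val]
  have h2 : (1 : ZMod m) = ((1 : ℤ) : ZMod m) := by simp
  rw [h1, h2, ZMod.intCast_eq_intCast_iff_dvd_sub, ← dvd_neg, neg_sub]

theorem unitsMap_eq_one_of_dvd {l m N : ℕ} [NeZero N] (hl : l ∣ m) (h : m ∣ N) {u : (ZMod N)ˣ}
    (hu : ZMod.unitsMap h u = 1) : ZMod.unitsMap (hl.trans h) u = 1 := by
  rw [unitsMap_eq_one_iff] at hu ⊢
  exact (Int.natCast_dvd_natCast.mpr hl).trans hu

theorem eq_one_of_unitsMap_eq_one {l m N : ℕ} [NeZero N] (hl : l ∣ N) (hm : m ∣ N)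
    (hN : N ∣ l.lcm m) {u : (ZMod N)ˣ} (h1 : ZMod.unitsMap hl u = 1)
    (h2 : ZMod.unitsMap hm u = 1) : u = 1 := by
  rw [unitsMap_eq_one_iff, Int.natCast_dvd] at h1 h2
  have h3 := hN.trans (Nat.lcm_dvd h1 h2)
  rw [← Int.natCast_dvd, ← unitsMap_eq_one_iff dvd_rfl] at h3
  simpa using h3

theorem dvd_two_of_one_eq_neg_one {m : ℕ}
    (hu : (1 : (ZMod m)ˣ) = -1) : m ∣ 2 := by
  have h1 := congrArg Units.val hu
  rw [Units.val_neg, Units.val_one] at h1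
  have h2 : ((2 : ℕ) : ZMod m) = 0 := by
    push_cast
    linear_combination h1
  exact (ZMod.natCast_eq_zero_iff 2 m).mp h2

theorem unitsMap_neg_one {m N : ℕ} (h : m ∣ N) : ZMod.unitsMap h (-1) = -1 := by
  ext
  rw [ZMod.unitsMap_def]
  simp

theorem totient_prime_mul {p : ℕ} (hp : p.Prime) (m : ℕ) :
    (p - 1) * m.totient ≤ (p * m).totient ∧ (p ∣ m → (p * m).totient = p * m.totient) := by
  by_cases h : p ∣ m
  · rw [Nat.totient_mul_of_prime_of_dvd hp h]
    exact ⟨Nat.mul_le_mul_right _ (Nat.sub_le _ _), fun _ => rfl⟩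
  · rw [Nat.totient_mul_of_prime_of_not_dvd hp h]
    exact ⟨le_rfl, fun h' => absurd h' h⟩

/-- Pigeonhole: φ(N/p) < φ(N), which for p = 2 needs 4 ∣ N. -/
theorem exists_ne_one_unitsMap_eq_one {N p : ℕ} [NeZero N] (hp : p.Prime) (hpN : p ∣ N)
    (h2 : p = 2 → 4 ∣ N) :
    ∃ u : (ZMod N)ˣ, ZMod.unitsMap (Nat.div_dvd_of_dvd hpN) u = 1 ∧ u ≠ 1 := by
  obtain ⟨m, rfl⟩ := hpN
  have hm : 0 < m := Nat.pos_of_ne_zero fun h0 => NeZero.ne (p * m) (by rw [h0, mul_zero])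
  have hdiv : p * m / p = m := Nat.mul_div_cancel_left m hp.pos
  have : NeZero (p * m / p) := ⟨by rw [hdiv]; exact hm.ne'⟩
  have hφ : 0 < m.totient := Nat.totient_pos.mpr hm
  have hcard : Fintype.card (ZMod (p * m / p))ˣ < Fintype.card (ZMod (p * m))ˣ := by
    rw [ZMod.card_units_eq_totient, ZMod.card_units_eq_totient, hdiv]
    obtain ⟨h3, h4⟩ := totient_prime_mul hp m
    rcases hp.eq_two_or_odd' with rfl | hodd
    · have : 2 ∣ m := by
        have := h2 rfl
        omega
      rw [h4 this]
      omega
    · have : 3 ≤ p := by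
        have := hp.two_le
        rcases hodd with ⟨k, rfl⟩
        omega
      have : 2 * m.totient ≤ (p - 1) * m.totient := Nat.mul_le_mul_right _ (by omega)
      omega
  obtain ⟨u, v, huv, h⟩ := Fintype.exists_ne_map_eq_of_card_lt
    (ZMod.unitsMap (Nat.div_dvd_of_dvd (Dvd.intro m rfl : p ∣ p * m))) hcard
  exact ⟨u * v⁻¹, by rw [map_mul, map_inv, h, mul_inv_cancel], fun h1 =>
    huv (mul_inv_eq_one.mp h1)⟩

/-- For p ≥ 5 one has φ(N) ≥ 4 φ(N/p), so some fibre has three elements; quotients of them lie in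
the kernel. -/
theorem exists_third_unitsMap_eq_one {N p : ℕ} [NeZero N] (hp : p.Prime) (hpN : p ∣ N)
    (h5 : 5 ≤ p) (w : (ZMod N)ˣ) :
    ∃ u : (ZMod N)ˣ, ZMod.unitsMap (Nat.div_dvd_of_dvd hpN) u = 1 ∧ u ≠ 1 ∧ u ≠ w := by
  obtain ⟨m, rfl⟩ := hpN
  have hm : 0 < m := Nat.pos_of_ne_zero fun h0 => NeZero.ne (p * m) (by rw [h0, mul_zero])
  have hdiv : p * m / p = m := Nat.mul_div_cancel_left m hp.pos
  have : NeZero (p * m / p) := ⟨by rw [hdiv]; exact hm.ne'⟩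
  have hφ : 0 < m.totient := Nat.totient_pos.mpr hm
  have hcard : Fintype.card (ZMod (p * m / p))ˣ * 2 < Fintype.card (ZMod (p * m))ˣ := by
    rw [ZMod.card_units_eq_totient, ZMod.card_units_eq_totient, hdiv]
    have h3 := (totient_prime_mul hp m).1
    have : 4 * m.totient ≤ (p - 1) * m.totient := Nat.mul_le_mul_right _ (by omega)
    omega
  obtain ⟨y, hy⟩ := Fintype.exists_lt_card_fiber_of_mul_lt_card
    (ZMod.unitsMap (Nat.div_dvd_of_dvd (Dvd.intro m rfl : p ∣ p * m))) hcard
  obtain ⟨a, b, c, ha, hb, hc, hab, hac, hbc⟩ := Finset.two_lt_card_iff.mp hy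
  simp only [Finset.mem_filter, Finset.mem_univ, true_and] at ha hb hc
  have key : ∀ x, ZMod.unitsMap (Nat.div_dvd_of_dvd (Dvd.intro m rfl : p ∣ p * m)) x = y → a ≠ x →
      ZMod.unitsMap (Nat.div_dvd_of_dvd (Dvd.intro m rfl : p ∣ p * m)) (x * a⁻¹) = 1 ∧
        x * a⁻¹ ≠ 1 := fun x hx hax =>
    ⟨by rw [map_mul, map_inv, hx, ha, mul_inv_cancel], fun h => hax (mul_inv_eq_one.mp h).symm⟩
  by_cases hw : b * a⁻¹ = w
  · refine ⟨c * a⁻¹, (key c hc hac).1, (key c hc hac).2, fun h => hbc ?_⟩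
    exact mul_right_cancel (hw.trans h.symm)
  · exact ⟨b * a⁻¹, (key b hb hab).1, (key b hb hab).2, hw⟩

/-- For q ≠ p the p-part of N divides N/q, so κ q is invisible there and each κ p acts on its own
prime only. -/
theorem unitsMap_ordProj_of_ne {N : ℕ} [NeZero N] (κ : ℕ → (ZMod N)ˣ)
    (h1 : ∀ p (hp : p ∈ N.primeFactors),
      ZMod.unitsMap (Nat.div_dvd_of_dvd (Nat.dvd_of_mem_primeFactors hp)) (κ p) = 1)
    {p q : ℕ} (hp : p ∈ N.primeFactors) (hq : q ∈ N.primeFactors)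
    (hqp : q ≠ p) : ZMod.unitsMap (Nat.ordProj_dvd N p) (κ q) = 1 := by
  have hd : ordProj[p] N ∣ N / q := by
    refine (Nat.dvd_div_iff_mul_dvd (Nat.dvd_of_mem_primeFactors hq)).mpr ?_
    refine Nat.Coprime.mul_dvd_of_dvd_of_dvd ?_ (Nat.dvd_of_mem_primeFactors hq)
      (Nat.ordProj_dvd N p)
    exact Nat.Coprime.pow_right _ ((Nat.coprime_primes (Nat.prime_of_mem_primeFactors hq)
      (Nat.prime_of_mem_primeFactors hp)).mpr hqp)
  exact unitsMap_eq_one_of_dvd hd _ (h1 q hq)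

theorem unitsMap_ordProj_prod {N : ℕ} [NeZero N] (κ : ℕ → (ZMod N)ˣ)
    (h1 : ∀ p (hp : p ∈ N.primeFactors),
      ZMod.unitsMap (Nat.div_dvd_of_dvd (Nat.dvd_of_mem_primeFactors hp)) (κ p) = 1)
    {p : ℕ} (hp : p ∈ N.primeFactors) {S : Finset ℕ}
    (hS : S ⊆ N.primeFactors) : ZMod.unitsMap (Nat.ordProj_dvd N p) (∏ q ∈ S, κ q)
      = if p ∈ S then ZMod.unitsMap (Nat.ordProj_dvd N p) (κ p) else 1 := by
  rw [map_prod, ← Finset.prod_ite_eq' S p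
    (fun _ => ZMod.unitsMap (Nat.ordProj_dvd N p) (κ p))]
  refine Finset.prod_congr rfl fun q hq => ?_
  split_ifs with h
  · rw [h]
  · exact unitsMap_ordProj_of_ne κ h1 hp (hS hq) h

theorem dvd_lcm_ordProj {N : ℕ} [NeZero N] {p : ℕ} (hp : p ∈ N.primeFactors) :
    N ∣ (ordProj[p] N).lcm (N / p) := by
  have hpp := Nat.prime_of_mem_primeFactors hp
  have h0 := Nat.ordProj_mul_ordCompl_eq_self N p
  conv_lhs => rw [← h0]
  refine Nat.Coprime.mul_dvd_of_dvd_of_dvd ?_ (Nat.dvd_lcm_left _ _) (Dvd.dvd.trans ?_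
    (Nat.dvd_lcm_right _ _))
  · exact (Nat.coprime_ordCompl hpp (NeZero.ne N)).pow_left _
  · exact Nat.div_dvd_div_left (Nat.ordProj_dvd N p)
      (dvd_pow_self p (hpp.factorization_pos_of_dvd (NeZero.ne N)
        (Nat.dvd_of_mem_primeFactors hp)).ne')

/-- For p in S, κ p would be 1 modulo the p-part of N as well as modulo N/p, whose least common
multiple is N. -/
theorem prod_eq_one_iff {N : ℕ} [NeZero N] (κ : ℕ → (ZMod N)ˣ)
    (h1 : ∀ p (hp : p ∈ N.primeFactors),
      ZMod.unitsMap (Nat.div_dvd_of_dvd (Nat.dvd_of_mem_primeFactors hp)) (κ p) = 1)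
    (h2 : ∀ p ∈ N.primeFactors, κ p ≠ 1) {S : Finset ℕ}
    (hS : S ⊆ N.primeFactors) : ∏ q ∈ S, κ q = 1 ↔ S = ∅ := by
  constructor
  · intro h
    by_contra hne
    obtain ⟨p, hpS⟩ := Finset.nonempty_iff_ne_empty.mpr hne
    have hp := hS hpS
    have h3 := unitsMap_ordProj_prod κ h1 hp hS
    rw [h, map_one, if_pos hpS] at h3
    exact h2 p hp (eq_one_of_unitsMap_eq_one _ _ (dvd_lcm_ordProj hp) h3.symm (h1 p hp))
  · rintro rfl
    simp

theorem two_lt_ordProj {N : ℕ} [NeZero N] (hN : Odd N ∨ 4 ∣ N) {p : ℕ} (hp : p ∈ N.primeFactors) :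
    2 < ordProj[p] N := by
  have hpp := Nat.prime_of_mem_primeFactors hp
  have hpN := Nat.dvd_of_mem_primeFactors hp
  rcases hpp.eq_two_or_odd' with rfl | hodd
  · have h4 : 2 ^ 2 ∣ N := by
      rcases hN with h | h
      · exact absurd (even_iff_two_dvd.mpr hpN) (Nat.not_even_iff_odd.mpr h)
      · simpa using h
    have := (hpp.pow_dvd_iff_le_factorization (NeZero.ne N)).mp h4
    calc 2 < 2 ^ 2 := by norm_num
      _ ≤ 2 ^ N.factorization 2 := Nat.pow_le_pow_right two_pos this
  · have h3 : 3 ≤ p := by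
      have := hpp.two_le
      rcases hodd with ⟨k, rfl⟩
      omega
    have := hpp.factorization_pos_of_dvd (NeZero.ne N) hpN
    calc 2 < p := h3
      _ ≤ p ^ N.factorization p := Nat.le_self_pow this.ne' p

/-- A prime missing from S would give 1 = -1 modulo its part of N, which exceeds 2. -/
theorem eq_primeFactors_of_prod_eq_neg_one {N : ℕ} [NeZero N] (κ : ℕ → (ZMod N)ˣ)
    (h1 : ∀ p (hp : p ∈ N.primeFactors),
      ZMod.unitsMap (Nat.div_dvd_of_dvd (Nat.dvd_of_mem_primeFactors hp)) (κ p) = 1)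
    (hN : Odd N ∨ 4 ∣ N) {S : Finset ℕ}
    (hS : S ⊆ N.primeFactors) (h : ∏ q ∈ S, κ q = -1) : S = N.primeFactors := by
  refine hS.antisymm fun p hp => ?_
  by_contra hpS
  have h3 := unitsMap_ordProj_prod κ h1 hp hS
  rw [h, if_neg hpS] at h3
  have h4 : (1 : (ZMod (ordProj[p] N))ˣ) = -1 :=
    h3.symm.trans (unitsMap_neg_one _)
  have h5 := Nat.le_of_dvd two_pos (dvd_two_of_one_eq_neg_one h4)
  have := two_lt_ordProj hN hp
  omega

/-- With p^v the p-part of N, κ p is -1 modulo p^v but 1 modulo p^(v-1). -/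
theorem ordProj_div_dvd_two {N : ℕ} [NeZero N] (κ : ℕ → (ZMod N)ˣ)
    (h1 : ∀ p (hp : p ∈ N.primeFactors),
      ZMod.unitsMap (Nat.div_dvd_of_dvd (Nat.dvd_of_mem_primeFactors hp)) (κ p) = 1)
    {p : ℕ} (hp : p ∈ N.primeFactors)
    (h : ∏ q ∈ N.primeFactors, κ q = -1) : ordProj[p] N / p ∣ 2 := by
  have hpp := Nat.prime_of_mem_primeFactors hp
  have hpd : p ∣ ordProj[p] N := dvd_pow_self p (hpp.factorization_pos_of_dvd (NeZero.ne N)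
        (Nat.dvd_of_mem_primeFactors hp)).ne'
  have h3 := unitsMap_ordProj_prod κ h1 hp subset_rfl
  rw [if_pos hp, h, unitsMap_neg_one] at h3
  have h4 := congrArg (ZMod.unitsMap (Nat.div_dvd_of_dvd hpd)) h3
  rw [unitsMap_neg_one, ← MonoidHom.comp_apply, ZMod.unitsMap_comp] at h4
  have h5 := unitsMap_eq_one_of_dvd (Nat.div_dvd_div hpd (Nat.ordProj_dvd N p)) _
    (h1 p hp)
  rw [h5] at h4
  exact dvd_two_of_one_eq_neg_one h4.symm

/-- The excluded configuration is the one in which the character sum of `exists_odd_character`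
vanishes. A prime p ≥ 5 allows another choice of κ p, which changes the product. Otherwise
`ordProj_div_dvd_two` leaves only N = 12, whose primitive character is even. -/
theorem exists_kernel_family {N : ℕ} [NeZero N] (hN : Odd N ∨ 4 ∣ N) (hN1 : N ≠ 1)
    (h12 : N ≠ 12) : ∃ κ : ℕ → (ZMod N)ˣ,
    (∀ p (hp : p ∈ N.primeFactors),
      ZMod.unitsMap (Nat.div_dvd_of_dvd (Nat.dvd_of_mem_primeFactors hp)) (κ p) = 1) ∧
    (∀ p ∈ N.primeFactors, κ p ≠ 1) ∧
    ¬ (Even N.primeFactors.card ∧ ∏ p ∈ N.primeFactors, κ p = -1) := by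
  have hex : ∀ p (hp : p ∈ N.primeFactors), ∃ u : (ZMod N)ˣ,
      ZMod.unitsMap (Nat.div_dvd_of_dvd (Nat.dvd_of_mem_primeFactors hp)) u = 1 ∧ u ≠ 1 := by
    intro p hp
    refine exists_ne_one_unitsMap_eq_one (Nat.prime_of_mem_primeFactors hp)
      (Nat.dvd_of_mem_primeFactors hp) ?_
    rintro rfl
    exact hN.resolve_left fun h => Nat.not_even_iff_odd.mpr h
      (even_iff_two_dvd.mpr (Nat.dvd_of_mem_primeFactors hp))
  classical
  obtain ⟨κ, h1, h2⟩ : ∃ κ : ℕ → (ZMod N)ˣ,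
      (∀ p (hp : p ∈ N.primeFactors),
        ZMod.unitsMap (Nat.div_dvd_of_dvd (Nat.dvd_of_mem_primeFactors hp)) (κ p) = 1) ∧
      (∀ p ∈ N.primeFactors, κ p ≠ 1) := by
    refine ⟨fun p => if hp : p ∈ N.primeFactors then (hex p hp).choose else 1,
      fun p hp => ?_, fun p hp => ?_⟩
    · simp only [dif_pos hp]
      exact (hex p hp).choose_spec.1
    · simp only [dif_pos hp]
      exact (hex p hp).choose_spec.2
  by_cases hbad : Even N.primeFactors.card ∧ ∏ p ∈ N.primeFactors, κ p = -1
  swap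
  · exact ⟨κ, h1, h2, hbad⟩
  by_cases h5 : ∃ p ∈ N.primeFactors, 5 ≤ p
  · obtain ⟨p, hp, hp5⟩ := h5
    obtain ⟨u, hu1, hu2, hu3⟩ := exists_third_unitsMap_eq_one (Nat.prime_of_mem_primeFactors hp)
      (Nat.dvd_of_mem_primeFactors hp) hp5 (κ p)
    refine ⟨Function.update κ p u, fun q hq => ?_, fun q hq => ?_, fun h => hu3 ?_⟩
    · by_cases hqp : q = p
      · subst hqp; rw [Function.update_self]; exact hu1
      · rw [Function.update_of_ne hqp]; exact h1 q hq
    · by_cases hqp : q = p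
      · subst hqp; rw [Function.update_self]; exact hu2
      · rw [Function.update_of_ne hqp]; exact h2 q hq
    · have h3 := h.2.trans hbad.2.symm
      have h4 : ∏ q ∈ N.primeFactors.erase p, Function.update κ p u q
          = ∏ q ∈ N.primeFactors.erase p, κ q := Finset.prod_congr rfl fun q hq =>
        Function.update_of_ne (Finset.ne_of_mem_erase hq) _ _
      rw [← Finset.mul_prod_erase _ _ hp, ← Finset.mul_prod_erase _ κ hp, Function.update_self,
        h4] at h3
      exact mul_right_cancel h3
  · exfalso
    push Not at h5
    have hsub : N.primeFactors ⊆ {2, 3} := by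
      intro p hp
      have h4 := h5 p hp
      have hpp := Nat.prime_of_mem_primeFactors hp
      have := hpp.two_le
      interval_cases p
      · simp
      · simp
      · exact absurd hpp (by norm_num)
    have hfac : ∀ p ∈ N.primeFactors, p ^ N.factorization p / p ∣ 2 := fun p hp =>
      ordProj_div_dvd_two κ h1 hp hbad.2
    have hne : N.primeFactors ≠ ∅ := by
      rw [Ne, Nat.primeFactors_eq_empty]
      have := NeZero.ne N
      omega
    have hall : N.primeFactors = {2, 3} := by
      refine Finset.eq_of_subset_of_card_le hsub ?_
      have h6 := Finset.card_pos.mpr (Finset.nonempty_iff_ne_empty.mpr hne)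
      obtain ⟨k, hk⟩ := hbad.1
      rw [Finset.card_pair (by norm_num)]
      omega
    have hprod := Nat.prod_factorization_pow_eq_self (NeZero.ne N)
    rw [Nat.prod_factorization_eq_prod_primeFactors, hall, Finset.prod_pair (by norm_num)] at hprod
    have h2m : 2 ∈ N.primeFactors := by simp [hall]
    have h3m : 3 ∈ N.primeFactors := by simp [hall]
    have e2 := two_lt_ordProj hN h2m
    have e3 := two_lt_ordProj hN h3m
    have d2 := Nat.le_of_dvd two_pos (hfac 2 h2m)
    have d3 := hfac 3 h3m
    have f2 : N.factorization 2 = 2 := by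
      have l2 : 2 ≤ N.factorization 2 := by
        by_contra! hlt
        interval_cases N.factorization 2 <;> omega
      have u2 : N.factorization 2 < 3 := by
        by_contra! hlt
        have := Nat.pow_le_pow_right two_pos hlt
        omega
      omega
    have f3 : N.factorization 3 = 1 := by
      obtain ⟨k, hk⟩ : ∃ k, N.factorization 3 = k + 1 :=
        ⟨N.factorization 3 - 1, by
          have : N.factorization 3 ≠ 0 := fun h0 => by rw [h0] at e3; omega
          omega⟩
      rw [hk, pow_succ, Nat.mul_div_cancel _ (by norm_num)] at d3
      rcases k with _ | k
      · exact hk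
      · have : 3 ∣ 2 := (dvd_pow_self 3 k.succ_ne_zero).trans d3
        omega
    rw [f2, f3] at hprod
    omega

/-- For a modulus other than `1`, `12` and the numbers `≡ 2 mod 4`, there is an odd character that
does not factor through any proper divisor. -/
theorem exists_odd_character {N : ℕ} [NeZero N] (hN : Odd N ∨ 4 ∣ N) (hN1 : N ≠ 1)
    (h12 : N ≠ 12) : ∃ χ : DirichletCharacter ℂ N, χ.Odd ∧
    ∀ p (hp : p ∈ N.primeFactors), ∃ u : (ZMod N)ˣ,
      ZMod.unitsMap (Nat.div_dvd_of_dvd (Nat.dvd_of_mem_primeFactors hp)) u = 1 ∧ χ u ≠ 1 := by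
  classical
  obtain ⟨κ, h1, h2, h3⟩ := exists_kernel_family hN hN1 h12
  have hφ : (N.totient : ℂ) ≠ 0 := Nat.cast_ne_zero.mpr (Nat.totient_pos.mpr (NeZero.pos N)).ne'
  -- By orthogonality the sum is φ(N), minus (-1)^ω φ(N) if the product of all κ p is -1, where ω is
  -- the number of prime factors. A nonzero summand gives the required χ.
  have hsum : ∑ χ : DirichletCharacter ℂ N,
      (1 - χ (-1)) * ∏ p ∈ N.primeFactors, (1 - χ (κ p)) ≠ 0 := by
    have hexp : ∀ χ : DirichletCharacter ℂ N,
        (1 - χ (-1)) * ∏ p ∈ N.primeFactors, (1 - χ (κ p))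
          = ∑ S ∈ N.primeFactors.powerset, (-1) ^ S.card *
            (χ ((∏ p ∈ S, κ p : (ZMod N)ˣ) : ZMod N) -
              χ ((-∏ p ∈ S, κ p : (ZMod N)ˣ) : ZMod N)) := by
      intro χ
      have : ∀ p, (1 - χ (κ p)) = -χ (κ p) + 1 := fun p => by ring
      simp_rw [this, Finset.prod_add_one, Finset.mul_sum]
      refine Finset.sum_congr rfl fun S _ => ?_
      have hneg : ∀ x : ZMod N, χ (-x) = χ (-1) * χ x := fun x => by rw [← map_mul, neg_one_mul]
      rw [Finset.prod_neg, Units.val_neg,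
        hneg ((∏ p ∈ S, κ p : (ZMod N)ˣ) : ZMod N), Units.coe_prod, map_prod]
      ring
    simp_rw [hexp]
    rw [Finset.sum_comm]
    simp_rw [← Finset.mul_sum, Finset.sum_sub_distrib, DirichletCharacter.sum_characters_eq]
    have hone : ∀ v : (ZMod N)ˣ, ((v : ZMod N) = 1) = (v = 1) := fun v => by simp
    simp_rw [hone]
    have hterm : ∀ S ∈ N.primeFactors.powerset, ((-1 : ℂ) ^ S.card *
        ((if ∏ p ∈ S, κ p = 1 then (N.totient : ℂ) else 0) -
          (if -∏ p ∈ S, κ p = 1 then (N.totient : ℂ) else 0)))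
        = (if S = ∅ then (N.totient : ℂ) else 0) - (if S = N.primeFactors then
          (if ∏ p ∈ N.primeFactors, κ p = -1 then (-1) ^ N.primeFactors.card * (N.totient : ℂ)
            else 0) else 0) := by
      intro S hS
      have hS := Finset.mem_powerset.mp hS
      rw [mul_sub]
      congr 1
      · simp only [prod_eq_one_iff κ h1 h2 hS]
        split_ifs with h
        · simp [h]
        · simp
      · simp only [neg_eq_iff_eq_neg]
        by_cases hh : ∏ p ∈ S, κ p = -1
        · have := eq_primeFactors_of_prod_eq_neg_one κ h1 hN hS hh
          subst this
          simp [hh]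
        · rw [if_neg hh, mul_zero]
          split_ifs with h h'
          · rw [h] at hh; exact absurd h' hh
          · rfl
          · rfl
    rw [Finset.sum_congr rfl hterm, Finset.sum_sub_distrib,
      Finset.sum_ite_eq' _ (∅ : Finset ℕ), Finset.sum_ite_eq' _ N.primeFactors,
      if_pos (Finset.empty_mem_powerset _), if_pos (Finset.mem_powerset_self _)]
    split_ifs with h
    · have hodd : Odd N.primeFactors.card := Nat.not_even_iff_odd.mp fun he => h3 ⟨he, h⟩
      rw [hodd.neg_one_pow]
      intro h0
      apply hφ
      linear_combination h0 / 2
    · simpa using hφ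
  obtain ⟨χ, -, hχ⟩ := Finset.exists_ne_zero_of_sum_ne_zero hsum
  refine ⟨χ, ?_, fun p hp => ⟨κ p, h1 p hp, fun h => ?_⟩⟩
  · refine χ.even_or_odd.resolve_left fun he => hχ ?_
    rw [show χ (-1) = 1 from he, sub_self, zero_mul]
  · refine hχ ?_
    rw [Finset.prod_eq_zero hp (by rw [h, sub_self]), mul_zero]

end OddCharacters

end Eulerian

namespace Eulerian

open Filter

/-! ### Isolating one cotangent by a character twist -/

section CotRelations

theorem cotVal_unitsMap {M N : ℕ} [NeZero M] [NeZero N] (h : N ∣ M) (u : (ZMod M)ˣ) :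
    cotVal N (ZMod.unitsMap h u : ZMod N).val = cotVal N (u : ZMod M).val := by
  refine cotVal_congr (NeZero.ne N) ?_
  rw [← ZMod.natCast_eq_natCast_iff, ZMod.natCast_zmod_val, ZMod.unitsMap_val, ZMod.natCast_val]

/-- Chinese remaindering modulo lcm(N, N'), followed by lifting units to level M. -/
theorem exists_unitsMap_eq_and_unitsMap_eq_one {M N N' : ℕ} [NeZero M] [NeZero N] [NeZero N']
    (hN : N ∣ M) (hN' : N' ∣ M) (u : (ZMod N)ˣ) (hu : (u : ZMod N).val ≡ 1 [MOD N.gcd N']) :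
    ∃ v : (ZMod M)ˣ, ZMod.unitsMap hN v = u ∧ ZMod.unitsMap hN' v = 1 := by
  obtain ⟨k, hk, hk'⟩ := Nat.chineseRemainder' hu
  have c1 : k.Coprime N := by
    rw [Nat.Coprime, hk.gcd_eq]
    exact ZMod.val_coe_unit_coprime u
  have c2 : k.Coprime N' := by
    rw [Nat.Coprime, hk'.gcd_eq]
    exact Nat.gcd_one_left _
  have c3 : k.Coprime (N.lcm N') := Nat.Coprime.coprime_dvd_right
    (Nat.lcm_dvd_mul N N') (Nat.Coprime.mul_right c1 c2)
  obtain ⟨v, hv⟩ := ZMod.unitsMap_surjective (Nat.lcm_dvd hN hN') (ZMod.unitOfCoprime k c3)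
  have key : ∀ {d : ℕ} (hd : d ∣ N.lcm N'), (ZMod.unitsMap (hd.trans (Nat.lcm_dvd hN hN')) v :
      ZMod d) = k := by
    intro d hd
    rw [← ZMod.unitsMap_comp hd (Nat.lcm_dvd hN hN'), MonoidHom.comp_apply, hv, ZMod.unitsMap_def]
    simp
  refine ⟨v, Units.ext ?_, Units.ext ?_⟩
  · rw [key (Nat.dvd_lcm_left N N'), ← ZMod.natCast_zmod_val (u : ZMod N),
      ZMod.natCast_eq_natCast_iff]
    exact hk
  · rw [key (Nat.dvd_lcm_right N N'), Units.val_one, ← Nat.cast_one, ZMod.natCast_eq_natCast_iff]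
    exact hk'

/-- Some p has gcd(N, N') ∣ N/p. Translation by a unit that is 1 mod N' and u mod N fixes the
cotangents but multiplies the sum by χ(u) ≠ 1. -/
theorem sum_unitsMap_cotVal_eq_zero {M N N' : ℕ} [NeZero M] [NeZero N] [NeZero N']
    (hN : N ∣ M) (hN' : N' ∣ M) (h : ¬ N ∣ N') (χ : DirichletCharacter ℂ N)
    (hχ : ∀ p (hp : p ∈ N.primeFactors), ∃ u : (ZMod N)ˣ,
      ZMod.unitsMap (Nat.div_dvd_of_dvd (Nat.dvd_of_mem_primeFactors hp)) u = 1 ∧ χ u ≠ 1) :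
    ∑ u : (ZMod M)ˣ, χ (ZMod.unitsMap hN u : ZMod N) * cotVal N' (u : ZMod M).val = 0 := by
  obtain ⟨p, hp, hpd⟩ : ∃ p, p.Prime ∧ p ∣ N / N.gcd N' := by
    refine Nat.exists_prime_and_dvd fun h1 => h ?_
    rw [← Nat.eq_of_dvd_of_div_eq_one (Nat.gcd_dvd_left N N') h1]
    exact Nat.gcd_dvd_right N N'
  have hpm : N.gcd N' * p ∣ N := (Nat.dvd_div_iff_mul_dvd (Nat.gcd_dvd_left N N')).mp hpd
  have hpN : p ∈ N.primeFactors :=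
    Nat.mem_primeFactors.mpr ⟨hp, (dvd_mul_left _ _).trans hpm, NeZero.ne N⟩
  have hgd : N.gcd N' ∣ N / p := by
    rw [Nat.dvd_div_iff_mul_dvd (Nat.dvd_of_mem_primeFactors hpN), mul_comm]
    exact hpm
  obtain ⟨u, hu, hu1⟩ := hχ p hpN
  obtain ⟨v, hv, hv'⟩ := exists_unitsMap_eq_and_unitsMap_eq_one hN hN' u (by
    have := (unitsMap_eq_one_iff _ u).mp (unitsMap_eq_one_of_dvd hgd _ hu)
    exact ((Nat.modEq_iff_dvd (n := N.gcd N')).mpr (by simpa using this)).symm)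
  have hshift : ∑ w : (ZMod M)ˣ, χ (ZMod.unitsMap hN w : ZMod N) * cotVal N' (w : ZMod M).val
      = χ u * ∑ w : (ZMod M)ˣ, χ (ZMod.unitsMap hN w : ZMod N) * cotVal N' (w : ZMod M).val := by
    rw [Finset.mul_sum, ← Equiv.sum_comp (Equiv.mulRight v)]
    refine Finset.sum_congr rfl fun w _ => ?_
    rw [Equiv.coe_mulRight, ← cotVal_unitsMap hN', ← cotVal_unitsMap hN', map_mul, map_mul, hv,
      hv', mul_one, Units.val_mul, map_mul]
    ring
  by_contra h0
  exact hu1 (mul_right_cancel₀ h0 (by rw [one_mul]; exact hshift.symm))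

/-- All fibres of the reduction to level N have the size of its kernel, so `sum_mul_cotVal_ne_zero`
applies. -/
theorem sum_unitsMap_cotVal_ne_zero {M N : ℕ} [NeZero M] [NeZero N] (hN : N ∣ M)
    {χ : DirichletCharacter ℂ N} (hχ : χ.Odd) :
    ∑ u : (ZMod M)ˣ, χ (ZMod.unitsMap hN u : ZMod N) * cotVal N (u : ZMod M).val ≠ 0 := by
  classical
  have h1 : ∑ w : (ZMod N)ˣ, χ (w : ZMod N) * cotVal N (w : ZMod N).val ≠ 0 := by
    have h2 := sum_mul_cotVal_ne_zero hχ
    have h3 : ∑ j : ZMod N, χ j * cotVal N j.val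
        = ∑ w : (ZMod N)ˣ, χ (w : ZMod N) * cotVal N (w : ZMod N).val := by
      symm
      refine Finset.sum_of_injOn (fun w : (ZMod N)ˣ => (w : ZMod N))
        (fun a _ b _ h => Units.ext h) (fun _ _ => Finset.mem_coe.mpr (Finset.mem_univ _))
        (fun j _ hj => ?_) (fun _ _ => rfl)
      rw [χ.map_nonunit, zero_mul]
      rintro ⟨w, rfl⟩
      exact hj ⟨w, by simp, rfl⟩
    rwa [← h3]
  have hsurj := ZMod.unitsMap_surjective hN
  have h2 : ∑ u : (ZMod M)ˣ, χ (ZMod.unitsMap hN u : ZMod N) * cotVal N (u : ZMod M).val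
      = ∑ w : (ZMod N)ˣ, (Nat.card (ZMod.unitsMap hN).ker : ℂ) *
        (χ (w : ZMod N) * cotVal N (w : ZMod N).val) := by
    rw [← Finset.sum_fiberwise Finset.univ (ZMod.unitsMap hN)]
    refine Finset.sum_congr rfl fun w _ => ?_
    have h3 : ∀ u ∈ Finset.univ.filter fun u => ZMod.unitsMap hN u = w,
        χ (ZMod.unitsMap hN u : ZMod N) * cotVal N (u : ZMod M).val
          = χ (w : ZMod N) * cotVal N (w : ZMod N).val := by
      intro u hu
      rw [← cotVal_unitsMap hN, (Finset.mem_filter.mp hu).2]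
    rw [Finset.sum_congr rfl h3, Finset.sum_const, nsmul_eq_mul]
    congr 2
    obtain ⟨u₀, hu₀⟩ := hsurj w
    rw [Nat.card_eq_fintype_card, Fintype.card_subtype]
    refine Finset.card_bij' (fun u _ => u * u₀⁻¹) (fun u _ => u * u₀) ?_ ?_ ?_ ?_
    · intro u hu
      simp only [Finset.mem_filter, Finset.mem_univ, true_and] at hu
      simp [MonoidHom.mem_ker, hu, hu₀]
    · intro u hu
      simp only [Finset.mem_filter, Finset.mem_univ, true_and, MonoidHom.mem_ker] at hu
      simp [hu, hu₀]
    · intro u _; simp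
    · intro u _; simp
  rw [h2, ← Finset.mul_sum]
  exact mul_ne_zero (Nat.cast_ne_zero.mpr (ne_of_gt Nat.card_pos)) h1

/-- In a rational linear relation between the numbers `cot (π / N)`, the coefficient of an index
`≢ 2 mod 4`, other than `12`, that divides no other index, is zero. -/
theorem eq_zero_of_sum_mul_cotVal_one_eq_zero (S : Finset ℕ) (b : ℕ → ℚ) (hS : ∀ N ∈ S, 2 ≤ N)
    (h : ∑ N ∈ S, (b N : ℂ) * cotVal N 1 = 0) {N : ℕ} (hN : N ∈ S) (hmod : Odd N ∨ 4 ∣ N)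
    (h12 : N ≠ 12) (hmax : ∀ N' ∈ S, N' ≠ N → b N' ≠ 0 → ¬ N ∣ N') : b N = 0 := by
  set M := ∏ N ∈ S, N with hM
  have hM0 : M ≠ 0 := Finset.prod_ne_zero_iff.mpr fun N hN => by have := hS N hN; omega
  have : NeZero M := ⟨hM0⟩
  have hpos : ∀ N ∈ S, NeZero N := fun N hN => ⟨by have := hS N hN; omega⟩
  have := hpos N hN
  have hdvd : ∀ N ∈ S, N ∣ M := fun N hN => Finset.dvd_prod_of_mem _ hN
  obtain ⟨χ, hodd, hχ⟩ := exists_odd_character hmod (by have := hS N hN; omega) h12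
  have h1 : ∀ u : (ZMod M)ˣ, ∑ N' ∈ S, (b N' : ℂ) * cotVal N' (u : ZMod M).val = 0 := fun u =>
    sum_cotVal_eq_zero_of_coprime S b M hM0 (fun N hN => ⟨hS N hN, hdvd N hN⟩) h
      (ZMod.val_coe_unit_coprime u)
  -- Weighting the conjugate relations by χ and summing kills every index with nonzero coefficient
  -- other than N.
  have h2 : ∑ N' ∈ S, (b N' : ℂ) * ∑ u : (ZMod M)ˣ,
      χ (ZMod.unitsMap (hdvd N hN) u : ZMod N) * cotVal N' (u : ZMod M).val = 0 := by
    simp_rw [Finset.mul_sum]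
    rw [Finset.sum_comm]
    refine Finset.sum_eq_zero fun u _ => ?_
    rw [← mul_zero (χ (ZMod.unitsMap (hdvd N hN) u : ZMod N)), ← h1 u, Finset.mul_sum]
    exact Finset.sum_congr rfl fun N' _ => by ring
  rw [Finset.sum_eq_single_of_mem N hN] at h2
  · exact_mod_cast (mul_eq_zero.mp h2).resolve_right (sum_unitsMap_cotVal_ne_zero _ hodd)
  · intro N' hN' hne
    by_cases hb : b N' = 0
    · rw [hb, Rat.cast_zero, zero_mul]
    · have := hpos N' hN'
      rw [sum_unitsMap_cotVal_eq_zero (hdvd N hN) (hdvd N' hN') (hmax N' hN' hne hb) χ hχ, mul_zero]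

end CotRelations

end Eulerian

namespace Eulerian

open Filter

/-! ### Rational relations between the growth constants -/

section GrowthConstants

/-- The largest index `N` such that `cot (π / N)` occurs in `growthConst r`. -/
def growthIndex (r : ℕ+) : ℕ := if Even (r : ℕ) then 2 * r else r

/-- The limit of `log |F_r (-x)| / (π x)`, where `F_r` is the entire extension of `e^{ℓ_r}`. -/
noncomputable def growthConst (r : ℕ+) : ℝ :=
  if Even (r : ℕ) then Real.cot (Real.pi / (2 * r : ℕ)) - Real.cot (Real.pi / r)
  else Real.cot (Real.pi / r)

theorem cotVal_one (N : ℕ) : cotVal N 1 = (Real.cot (Real.pi / N) : ℂ) := by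
  rw [cotVal, Complex.ofReal_cot]
  congr 1
  push_cast
  ring

theorem cot_half_sub_cot {x : ℝ} (hx : Real.sin x ≠ 0) :
    Real.cot (x / 2) - Real.cot x = 1 / Real.sin x := by
  obtain ⟨y, rfl⟩ : ∃ y, x = 2 * y := ⟨x / 2, by ring⟩
  rw [mul_div_cancel_left₀ _ (two_ne_zero' ℝ), Real.cot_eq_cos_div_sin, Real.cot_eq_cos_div_sin,
    Real.cos_two_mul]
  rw [Real.sin_two_mul] at hx ⊢
  have h1 : Real.sin y ≠ 0 := fun h => hx (by rw [h]; ring)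
  have h2 : Real.cos y ≠ 0 := fun h => hx (by rw [h]; ring)
  field_simp
  ring

theorem growthConst_two : growthConst 2 = 1 := by
  have h := cot_half_sub_cot (x := Real.pi / 2) (by simp)
  rw [Real.sin_pi_div_two] at h
  rw [growthConst, if_pos (by decide)]
  have h2 : Real.pi / 2 / 2 = Real.pi / ((2 * (2 : ℕ+) : ℕ) : ℝ) := by
    push_cast
    ring
  have h3 : Real.pi / 2 = Real.pi / (((2 : ℕ+) : ℕ) : ℝ) := by
    push_cast
    ring
  rw [← h2, ← h3, h, div_one]

theorem growthConst_six : growthConst 6 = 2 := by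
  have h := cot_half_sub_cot (x := Real.pi / 6) (by rw [Real.sin_pi_div_six]; norm_num)
  rw [Real.sin_pi_div_six] at h
  rw [growthConst, if_pos (by decide)]
  have h2 : Real.pi / 6 / 2 = Real.pi / ((2 * (6 : ℕ+) : ℕ) : ℝ) := by
    push_cast
    ring
  have h3 : Real.pi / 6 = Real.pi / (((6 : ℕ+) : ℕ) : ℝ) := by
    push_cast
    ring
  rw [← h2, ← h3, h]
  norm_num

theorem growthIndex_injective : Function.Injective growthIndex := by
  intro r s h
  rw [growthIndex, growthIndex] at h
  apply PNat.coe_injective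
  split_ifs at h with h1 h2 h2
  · omega
  · exact absurd (h ▸ even_two_mul _) h2
  · exact absurd (h ▸ even_two_mul _) h1
  · exact h

/-- Take r₀ of largest growth index with d r₀ ≠ 0. That index is odd or divisible by 4, is not 12,
comes from r₀ alone and divides no other index that occurs. -/
theorem eq_zero_of_sum_mul_growthConst_eq_zero (T : Finset ℕ+) (d : ℕ+ → ℚ) (h1 : 1 ∉ T)
    (h6 : 6 ∉ T) (h : ∑ r ∈ T, (d r : ℝ) * growthConst r = 0) : ∀ r ∈ T, d r = 0 := by
  classical
  by_contra! hne
  obtain ⟨r₁, hr₁, hd₁⟩ := hne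
  obtain ⟨r₀, hr₀, hmax⟩ := Finset.exists_max_image (T.filter fun r => d r ≠ 0) growthIndex
    ⟨r₁, Finset.mem_filter.mpr ⟨hr₁, hd₁⟩⟩
  obtain ⟨hr₀T, hd₀⟩ := Finset.mem_filter.mp hr₀
  have hmax' : ∀ r ∈ T, d r ≠ 0 → growthIndex r ≤ growthIndex r₀ := fun r hr hd =>
    hmax r (Finset.mem_filter.mpr ⟨hr, hd⟩)
  have h2 : ∀ r ∈ T, 2 ≤ (r : ℕ) := fun r hr => two_le_of_ne_one fun h => h1 (h ▸ hr)
  -- Coefficient of cot(π/N) in the growth constant of r; an even r also contributes -cot(π/r).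
  set coef : ℕ+ → ℕ → ℚ := fun r N =>
    (if N = growthIndex r then 1 else 0) - (if Even (r : ℕ) ∧ N = r then 1 else 0) with hcoef
  set b : ℕ → ℚ := fun N => ∑ r ∈ T, d r * coef r N with hb
  set S : Finset ℕ := T.image growthIndex ∪ T.image (fun r : ℕ+ => (r : ℕ)) with hS
  have hcoef_le : ∀ r N, coef r N ≠ 0 → N ≤ growthIndex r := by
    intro r N hN
    by_contra! hlt
    apply hN
    have : (r : ℕ) ≤ growthIndex r := by
      rw [growthIndex]
      split_ifs <;> omega
    rw [hcoef]
    simp only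
    rw [if_neg (by omega), if_neg (by omega), sub_zero]
  have hb_ne : ∀ N, b N ≠ 0 → N ≤ growthIndex r₀ := by
    intro N hN
    obtain ⟨r, hr, hr'⟩ := Finset.exists_ne_zero_of_sum_ne_zero hN
    exact (hcoef_le r N (right_ne_zero_of_mul hr')).trans (hmax' r hr (left_ne_zero_of_mul hr'))
  have hS2 : ∀ N ∈ S, 2 ≤ N := by
    intro N hN
    rw [hS, Finset.mem_union, Finset.mem_image, Finset.mem_image] at hN
    rcases hN with ⟨r, hr, rfl⟩ | ⟨r, hr, rfl⟩
    · have := h2 r hr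
      rw [growthIndex]
      split_ifs <;> omega
    · exact h2 r hr
  have hconst : ∀ r ∈ T, ∑ N ∈ S, (coef r N : ℂ) * cotVal N 1 = (growthConst r : ℂ) := by
    intro r hr
    have m1 : growthIndex r ∈ S := Finset.mem_union_left _ (Finset.mem_image_of_mem _ hr)
    have m2 : (r : ℕ) ∈ S := Finset.mem_union_right _ (Finset.mem_image_of_mem _ hr)
    simp only [hcoef, Rat.cast_sub, sub_mul, Finset.sum_sub_distrib]
    have e1 : ∑ N ∈ S, (((if N = growthIndex r then 1 else 0 : ℚ)) : ℂ) * cotVal N 1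
        = cotVal (growthIndex r) 1 := by
      rw [Finset.sum_eq_single_of_mem _ m1 (fun N _ hN => by rw [if_neg hN]; simp)]
      simp
    have e2 : ∑ N ∈ S, (((if Even (r : ℕ) ∧ N = r then 1 else 0 : ℚ)) : ℂ) * cotVal N 1
        = if Even (r : ℕ) then cotVal r 1 else 0 := by
      rw [Finset.sum_eq_single_of_mem _ m2 (fun N _ hN => by rw [if_neg fun h => hN h.2]; simp)]
      split_ifs <;> simp_all
    rw [e1, e2, growthConst, growthIndex]
    split_ifs
    · rw [cotVal_one, cotVal_one, Complex.ofReal_sub]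
    · rw [cotVal_one, sub_zero]
  have hsum : ∑ N ∈ S, (b N : ℂ) * cotVal N 1 = 0 := by
    simp only [hb, Rat.cast_sum, Rat.cast_mul, Finset.sum_mul]
    rw [Finset.sum_comm]
    have : ∀ r ∈ T, ∑ N ∈ S, (d r : ℂ) * (coef r N : ℂ) * cotVal N 1
        = ((d r : ℝ) * growthConst r : ℝ) := by
      intro r hr
      simp_rw [mul_assoc]
      rw [← Finset.mul_sum, hconst r hr]
      push_cast
      rfl
    rw [Finset.sum_congr rfl this, ← Complex.ofReal_sum, h, Complex.ofReal_zero]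
  have hb₀ : b (growthIndex r₀) = d r₀ := by
    rw [hb]
    simp only
    rw [Finset.sum_eq_single_of_mem r₀ hr₀T]
    · have := h2 r₀ hr₀T
      rw [hcoef]
      simp only
      rw [if_pos trivial, if_neg, sub_zero, mul_one]
      rintro ⟨he, h'⟩
      rw [growthIndex, if_pos he] at h'
      omega
    · intro r hr hne
      by_cases hd : d r = 0
      · rw [hd, zero_mul]
      · rw [hcoef]
        simp only
        rw [if_neg fun h => hne (growthIndex_injective h).symm, if_neg, sub_zero, mul_zero]
        rintro ⟨he, h'⟩
        have h3 := hmax' r hr hd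
        have := h2 r hr
        rw [h', growthIndex, if_pos he] at h3
        omega
  refine hd₀ (hb₀ ▸ eq_zero_of_sum_mul_cotVal_one_eq_zero S b hS2 hsum
    (Finset.mem_union_left _ (Finset.mem_image_of_mem _ hr₀T)) ?_ ?_ ?_)
  · rw [growthIndex]
    split_ifs with he
    · right
      obtain ⟨k, hk⟩ := he
      exact ⟨k, by omega⟩
    · exact Or.inl (Nat.not_even_iff_odd.mp he)
  · intro h12
    have : r₀ = 6 := growthIndex_injective (h12.trans (by decide))
    exact h6 (this ▸ hr₀T)
  · intro N hN hne hbN hdvd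
    have h3 := Nat.le_of_dvd (by have := hS2 N hN; omega) hdvd
    exact hne (le_antisymm (hb_ne N hbN) h3)

/-- The rational linear relations between the growth constants are spanned by `C_6 = 2 C_2`. -/
theorem sum_mul_growthConst_eq_zero (T : Finset ℕ+) (d : ℕ+ → ℤ) (h1 : 1 ∉ T) (h2 : 2 ∈ T)
    (h6 : 6 ∈ T) (h : ∑ r ∈ T, (d r : ℝ) * growthConst r = 0) :
    (∀ r ∈ T, r ≠ 2 → r ≠ 6 → d r = 0) ∧ d 2 + 2 * d 6 = 0 := by
  classical
  have h26 : (2 : ℕ+) ∈ T.erase 6 := Finset.mem_erase.mpr ⟨by decide, h2⟩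
  -- As C_6 = 2 C_2, the index 6 is absorbed into the coefficient at 2.
  have key := eq_zero_of_sum_mul_growthConst_eq_zero (T.erase 6)
    (Function.update (fun r => (d r : ℚ)) 2 (d 2 + 2 * d 6)) (fun h => h1 (Finset.mem_of_mem_erase h))
    (Finset.notMem_erase _ _) (by
      rw [← Finset.add_sum_erase _ _ h6, ← Finset.add_sum_erase _ _ h26, growthConst_two,
        growthConst_six] at h
      rw [← Finset.add_sum_erase _ _ h26, Function.update_self, growthConst_two, ← h]
      have : ∀ r ∈ (T.erase 6).erase 2, ((Function.update (fun r => (d r : ℚ)) 2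
          (d 2 + 2 * d 6 : ℚ) r : ℚ) : ℝ) * growthConst r = (d r : ℝ) * growthConst r := by
        intro r hr
        rw [Function.update_of_ne (Finset.ne_of_mem_erase hr), Rat.cast_intCast]
      rw [Finset.sum_congr rfl this]
      push_cast
      ring)
  refine ⟨fun r hr hr2 hr6 => ?_, ?_⟩
  · have := key r (Finset.mem_erase.mpr ⟨hr6, hr⟩)
    rw [Function.update_of_ne hr2] at this
    exact_mod_cast this
  · have := key 2 h26
    rw [Function.update_self] at this
    exact_mod_cast this

end GrowthConstants

end Eulerian

namespace Eulerian

open Filter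

/-! ### Power sums over the integers on either side of x = m + 1/2 -/

section PowerMeans

/-- Midpoint inequality for the integral of the convex function t^p over [v, u]. -/
theorem succ_mul_pow_mul_sub_le {u v w : ℝ} (hv : 0 ≤ v) (hvu : v ≤ u) (hw : 0 ≤ w)
    (hwuv : w ≤ (u + v) / 2) (p : ℕ) :
    (p + 1) * w ^ p * (u - v) ≤ u ^ (p + 1) - v ^ (p + 1) := by
  induction p with
  | zero => simp
  | succ p ih =>
    have h1 : w ^ (p + 1) ≤ (u ^ (p + 1) + v ^ (p + 1)) / 2 := by
      refine (pow_le_pow_left₀ hw hwuv _).trans ?_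
      have := add_pow_le (hv.trans hvu) hv (p + 1)
      rw [Nat.add_sub_cancel] at this
      rw [div_pow, div_le_div_iff₀ (by positivity) two_pos, pow_succ 2 p]
      linarith
    have h2 : u ^ (p + 1 + 1) - v ^ (p + 1 + 1) = (u ^ (p + 1) - v ^ (p + 1)) * ((u + v) / 2)
        + (u - v) * ((u ^ (p + 1) + v ^ (p + 1)) / 2) := by ring
    have h3 : 0 ≤ u ^ (p + 1) - v ^ (p + 1) := sub_nonneg.mpr (pow_le_pow_left₀ hv hvu _)
    have h4 := sub_nonneg.mpr hvu
    calc ((p + 1 : ℕ) + 1 : ℝ) * w ^ (p + 1) * (u - v)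
        = ((p + 1) * w ^ p * (u - v)) * w + (u - v) * w ^ (p + 1) := by
          push_cast
          ring
      _ ≤ (u ^ (p + 1) - v ^ (p + 1)) * ((u + v) / 2)
          + (u - v) * ((u ^ (p + 1) + v ^ (p + 1)) / 2) :=
        add_le_add (mul_le_mul ih hwuv hw h3) (mul_le_mul_of_nonneg_left h1 h4)
      _ = _ := h2.symm

theorem pow_succ_sub_pow_succ_le {u v : ℝ} (hv : 0 ≤ v) (hvu : v ≤ u) (p : ℕ) :
    u ^ (p + 1) - v ^ (p + 1) ≤ (p + 1) * u ^ p * (u - v) := by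
  induction p with
  | zero => simp
  | succ p ih =>
    have h4 := sub_nonneg.mpr hvu
    have h1 : v ^ (p + 1) ≤ u ^ (p + 1) := pow_le_pow_left₀ hv hvu _
    calc u ^ (p + 1 + 1) - v ^ (p + 1 + 1)
        = u * (u ^ (p + 1) - v ^ (p + 1)) + v ^ (p + 1) * (u - v) := by ring
      _ ≤ u * ((p + 1) * u ^ p * (u - v)) + u ^ (p + 1) * (u - v) :=
        add_le_add (mul_le_mul_of_nonneg_left ih (hv.trans hvu)) (mul_le_mul_of_nonneg_right h1 h4)
      _ = _ := by
        push_cast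
        ring

/-- The right side is the integral of t^{-(q+2)} over [y - 1/2, y + 1/2]. Summed over integers the
endpoints telescope to x = m + 1/2, so the bounds below carry no error term and are uniform in m. -/
theorem inv_pow_le {y : ℝ} (hy : 1 ≤ y) (q : ℕ) :
    (1 / y) ^ (q + 2) ≤ ((1 / (y - 1 / 2)) ^ (q + 1) - (1 / (y + 1 / 2)) ^ (q + 1)) / (q + 1) := by
  have h1 : 0 < y - 1 / 2 := by linarith
  have h2 : 0 < y + 1 / 2 := by linarith
  have h3 : 0 < y := by linarith
  have hle : 1 / (y + 1 / 2) ≤ 1 / (y - 1 / 2) := one_div_le_one_div_of_le h1 (by linarith)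
  have hdiff : (1 / y) ^ 2 ≤ 1 / (y - 1 / 2) - 1 / (y + 1 / 2) := by
    rw [div_sub_div _ _ h1.ne' h2.ne', div_pow, div_le_div_iff₀ (by positivity) (by positivity)]
    nlinarith
  have hmid : 1 / y ≤ (1 / (y - 1 / 2) + 1 / (y + 1 / 2)) / 2 := by
    rw [div_add_div _ _ h1.ne' h2.ne', div_div, div_le_div_iff₀ h3 (by positivity)]
    nlinarith
  rw [le_div_iff₀ (by positivity)]
  refine le_trans ?_ (succ_mul_pow_mul_sub_le (by positivity) hle (by positivity) hmid q)
  rw [pow_add, mul_comm _ ((q : ℝ) + 1), ← mul_assoc]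
  exact mul_le_mul_of_nonneg_left hdiff (by positivity)

theorem le_inv_pow {y : ℝ} (hy : 1 ≤ y) (q : ℕ) :
    ((1 / y) ^ (q + 1) - (1 / (y + 1)) ^ (q + 1)) / (q + 1) ≤ (1 / y) ^ (q + 2) := by
  have h3 : 0 < y := by linarith
  have h2 : 0 < y + 1 := by linarith
  have hle : 1 / (y + 1) ≤ 1 / y := one_div_le_one_div_of_le h3 (by linarith)
  have hdiff : 1 / y - 1 / (y + 1) ≤ (1 / y) ^ 2 := by
    rw [div_sub_div _ _ h3.ne' h2.ne', div_pow, div_le_div_iff₀ (by positivity) (by positivity)]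
    nlinarith
  rw [div_le_iff₀ (by positivity)]
  refine (pow_succ_sub_pow_succ_le (by positivity) hle q).trans ?_
  rw [pow_add, mul_comm _ ((q : ℝ) + 1), ← mul_assoc]
  exact mul_le_mul_of_nonneg_left hdiff (by positivity)

theorem sum_inv_pow_le (m q J : ℕ) :
    ∑ j ∈ Finset.range J, (1 / ((m : ℝ) + 1 + j)) ^ (q + 2)
      ≤ (1 / ((m : ℝ) + 1 / 2)) ^ (q + 1) / (q + 1) := by
  have h1 : ∀ j ∈ Finset.range J, (1 / ((m : ℝ) + 1 + j)) ^ (q + 2)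
      ≤ (1 / ((m : ℝ) + 1 / 2 + j)) ^ (q + 1) / (q + 1)
        - (1 / ((m : ℝ) + 1 / 2 + (j + 1 : ℕ))) ^ (q + 1) / (q + 1) := by
    intro j _
    have hmj : 0 ≤ (m : ℝ) + j := by positivity
    have := inv_pow_le (y := (m : ℝ) + 1 + j) (by linarith) q
    have e1 : (m : ℝ) + 1 + j - 1 / 2 = m + 1 / 2 + j := by ring
    have e2 : (m : ℝ) + 1 + j + 1 / 2 = m + 1 / 2 + (j + 1 : ℕ) := by
      push_cast
      ring
    rwa [e1, e2, sub_div] at this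
  refine (Finset.sum_le_sum h1).trans ?_
  rw [Finset.sum_range_sub']
  simp only [Nat.cast_zero, add_zero]
  exact sub_le_self _ (by positivity)

theorem summable_inv_pow (m q : ℕ) : Summable fun j : ℕ => (1 / ((m : ℝ) + 1 + j)) ^ (q + 2) :=
  summable_of_sum_range_le (fun j => by positivity) (sum_inv_pow_le m q)

theorem le_tsum_inv_pow (m q : ℕ) : (1 / ((m : ℝ) + 1)) ^ (q + 1) / (q + 1)
    ≤ ∑' j : ℕ, (1 / ((m : ℝ) + 1 + j)) ^ (q + 2) := by
  have h1 : ∀ J : ℕ, (1 / ((m : ℝ) + 1)) ^ (q + 1) / (q + 1)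
      - (1 / ((m : ℝ) + 1 + J)) ^ (q + 1) / (q + 1)
        ≤ ∑' j : ℕ, (1 / ((m : ℝ) + 1 + j)) ^ (q + 2) := by
    intro J
    refine le_trans ?_ ((summable_inv_pow m q).sum_le_tsum (Finset.range J)
      (fun j _ => by positivity))
    have := Finset.sum_range_sub' (fun j : ℕ => (1 / ((m : ℝ) + 1 + j)) ^ (q + 1) / (q + 1)) J
    simp only [Nat.cast_zero, add_zero] at this
    rw [← this]
    refine Finset.sum_le_sum fun j _ => ?_
    have hmj : 0 ≤ (m : ℝ) + j := by positivity
    have := le_inv_pow (y := (m : ℝ) + 1 + j) (by linarith) q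
    have e2 : (m : ℝ) + 1 + j + 1 = m + 1 + (j + 1 : ℕ) := by
      push_cast
      ring
    rwa [e2, sub_div] at this
  have h2 : Tendsto (fun J : ℕ => (1 / ((m : ℝ) + 1)) ^ (q + 1) / (q + 1)
      - (1 / ((m : ℝ) + 1 + J)) ^ (q + 1) / (q + 1)) atTop
      (𝓝 ((1 / ((m : ℝ) + 1)) ^ (q + 1) / (q + 1) - 0 ^ (q + 1) / (q + 1))) := by
    refine Tendsto.sub tendsto_const_nhds (Tendsto.div_const (Tendsto.pow ?_ _) _)
    simp_rw [one_div]
    exact tendsto_inv_atTop_zero.comp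
      (tendsto_atTop_add_const_left _ _ tendsto_natCast_atTop_atTop)
  have h3 := le_of_tendsto' h2 h1
  simpa using h3

/-- The sum of the `(x / n) ^ s` for `n > x = m + 1 / 2`. -/
noncomputable def tailSum (s m : ℕ) : ℝ := ∑' j : ℕ, (((m : ℝ) + 1 / 2) / ((m : ℝ) + 1 + j)) ^ s

/-- The sum of the `(n / x) ^ s` for `1 ≤ n < x = m + 1 / 2`. -/
noncomputable def headSum (s m : ℕ) : ℝ :=
  ∑ j ∈ Finset.range m, (((j : ℝ) + 1) / ((m : ℝ) + 1 / 2)) ^ s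

theorem tailSum_nonneg (s m : ℕ) : 0 ≤ tailSum s m := tsum_nonneg fun j => by positivity

theorem headSum_nonneg (s m : ℕ) : 0 ≤ headSum s m := Finset.sum_nonneg fun j _ => by positivity

theorem summable_tailSum (q m : ℕ) :
    Summable fun j : ℕ => (((m : ℝ) + 1 / 2) / ((m : ℝ) + 1 + j)) ^ (q + 2) := by
  simp_rw [div_eq_mul_one_div ((m : ℝ) + 1 / 2), mul_pow]
  exact (summable_inv_pow m q).mul_left _

theorem tailSum_eq (q m : ℕ) : tailSum (q + 2) m
    = ((m : ℝ) + 1 / 2) ^ (q + 2) * ∑' j : ℕ, (1 / ((m : ℝ) + 1 + j)) ^ (q + 2) := by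
  rw [tailSum, ← tsum_mul_left]
  simp_rw [div_eq_mul_one_div ((m : ℝ) + 1 / 2), mul_pow]

theorem tailSum_div_le (q m : ℕ) : tailSum (q + 2) m / ((m : ℝ) + 1 / 2) ≤ 1 / (q + 1) := by
  have hx : 0 < (m : ℝ) + 1 / 2 := by positivity
  have := Real.tsum_le_of_sum_range_le (fun j => by positivity) (sum_inv_pow_le m q)
  rw [tailSum_eq, div_le_iff₀ hx]
  refine (mul_le_mul_of_nonneg_left this (by positivity)).trans_eq ?_
  generalize (m : ℝ) + 1 / 2 = x at hx
  rw [one_div, inv_pow, pow_succ x (q + 1)]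
  field_simp

theorem le_tailSum_div (q m : ℕ) :
    (((m : ℝ) + 1 / 2) / (m + 1)) ^ (q + 1) / (q + 1) ≤ tailSum (q + 2) m / ((m : ℝ) + 1 / 2) := by
  have hx : 0 < (m : ℝ) + 1 / 2 := by positivity
  rw [tailSum_eq, le_div_iff₀ hx]
  refine le_trans (le_of_eq ?_) (mul_le_mul_of_nonneg_left (le_tsum_inv_pow m q) (by positivity))
  generalize (m : ℝ) + 1 / 2 = x at hx
  rw [div_pow, div_pow, one_pow, pow_succ x (q + 1)]
  ring

theorem headSum_div_le (s m : ℕ) : headSum s m / ((m : ℝ) + 1 / 2) ≤ 1 / (s + 1) := by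
  have hx : 0 < (m : ℝ) + 1 / 2 := by positivity
  have h1 : ∑ j ∈ Finset.range m, ((j : ℝ) + 1) ^ s ≤ ((m : ℝ) + 1 / 2) ^ (s + 1) / (s + 1) := by
    have h2 : ∀ j ∈ Finset.range m, ((j : ℝ) + 1) ^ s ≤ (((j + 1 : ℕ) : ℝ) + 1 / 2) ^ (s + 1) / (s + 1)
        - ((j : ℝ) + 1 / 2) ^ (s + 1) / (s + 1) := by
      intro j _
      rw [← sub_div, le_div_iff₀ (by positivity)]
      have := succ_mul_pow_mul_sub_le (u := ((j + 1 : ℕ) : ℝ) + 1 / 2) (v := (j : ℝ) + 1 / 2)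
        (w := j + 1) (by positivity) (by push_cast; linarith) (by positivity)
        (by push_cast; linarith) s
      refine le_trans (le_of_eq ?_) this
      push_cast
      ring
    refine (Finset.sum_le_sum h2).trans ?_
    rw [Finset.sum_range_sub fun j : ℕ => ((j : ℝ) + 1 / 2) ^ (s + 1) / (s + 1)]
    exact sub_le_self _ (by positivity)
  rw [headSum, div_le_iff₀ hx]
  simp_rw [div_pow]
  rw [← Finset.sum_div, div_le_iff₀ (by positivity)]
  refine h1.trans_eq ?_
  rw [pow_succ]
  ring

theorem le_headSum_div (s m : ℕ) :
    ((m : ℝ) / (m + 1 / 2)) ^ (s + 1) / (s + 1) ≤ headSum s m / ((m : ℝ) + 1 / 2) := by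
  have hx : 0 < (m : ℝ) + 1 / 2 := by positivity
  have h1 : (m : ℝ) ^ (s + 1) / (s + 1) ≤ ∑ j ∈ Finset.range m, ((j : ℝ) + 1) ^ s := by
    have h2 : ∀ j ∈ Finset.range m, (((j + 1 : ℕ) : ℝ)) ^ (s + 1) / (s + 1)
        - (j : ℝ) ^ (s + 1) / (s + 1) ≤ ((j : ℝ) + 1) ^ s := by
      intro j _
      rw [← sub_div, div_le_iff₀ (by positivity)]
      have := pow_succ_sub_pow_succ_le (u := ((j + 1 : ℕ) : ℝ)) (v := (j : ℝ))
        (by positivity) (by push_cast; linarith) s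
      refine this.trans (le_of_eq ?_)
      push_cast
      ring
    refine le_trans ?_ (Finset.sum_le_sum h2)
    rw [Finset.sum_range_sub fun j : ℕ => (j : ℝ) ^ (s + 1) / (s + 1)]
    simp
  rw [headSum]
  simp_rw [div_pow _ _ s]
  rw [← Finset.sum_div, div_div, div_pow, div_div, mul_comm ((_ : ℝ) ^ (s + 1)), ← div_div,
    ← pow_succ]
  exact div_le_div_of_nonneg_right h1 (by positivity)

theorem tendsto_add_half_div_add_one :
    Tendsto (fun m : ℕ => ((m : ℝ) + 1 / 2) / (m + 1)) atTop (𝓝 1) := by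
  have h : Tendsto (fun m : ℕ => 1 - (1 / 2) * (1 / ((m : ℝ) + 1))) atTop
      (𝓝 (1 - (1 / 2) * 0)) :=
    tendsto_const_nhds.sub (tendsto_one_div_add_atTop_nhds_zero_nat.const_mul _)
  rw [mul_zero, sub_zero] at h
  refine h.congr fun m => ?_
  have : (m : ℝ) + 1 ≠ 0 := by positivity
  field_simp
  ring

theorem tendsto_div_add_half : Tendsto (fun m : ℕ => (m : ℝ) / (m + 1 / 2)) atTop (𝓝 1) :=
  tendsto_natCast_div_add_atTop (1 / 2 : ℝ)

theorem tendsto_tailSum_div (q : ℕ) :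
    Tendsto (fun m : ℕ => tailSum (q + 2) m / ((m : ℝ) + 1 / 2)) atTop (𝓝 (1 / (q + 1))) := by
  refine tendsto_of_tendsto_of_tendsto_of_le_of_le ?_ tendsto_const_nhds (le_tailSum_div q)
    (tailSum_div_le q)
  simpa using (tendsto_add_half_div_add_one.pow (q + 1)).div_const ((q : ℝ) + 1)

theorem tendsto_headSum_div (s : ℕ) :
    Tendsto (fun m : ℕ => headSum s m / ((m : ℝ) + 1 / 2)) atTop (𝓝 (1 / (s + 1))) := by
  refine tendsto_of_tendsto_of_tendsto_of_le_of_le ?_ tendsto_const_nhds (le_headSum_div s)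
    (headSum_div_le s)
  simpa using (tendsto_div_add_half.pow (s + 1)).div_const ((s : ℝ) + 1)

end PowerMeans

/-! ### Stirling's formula at half-integers -/

section Factorial

theorem tendsto_log_factorial_div :
    Tendsto (fun m : ℕ => (m * Real.log ((m : ℝ) + 1 / 2) - Real.log m.factorial)
      / ((m : ℝ) + 1 / 2)) atTop (𝓝 1) := by
  have h1 : ∀ m : ℕ, (m * Real.log ((m : ℝ) + 1 / 2) - Real.log m.factorial) / ((m : ℝ) + 1 / 2)
      = (m : ℝ) / (m + 1 / 2) * Real.log (1 + 1 / 2 / m) + (m : ℝ) / (m + 1 / 2)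
        - Real.log (Stirling.stirlingSeq m) / (m + 1 / 2)
        - 1 / 2 * (Real.log (2 * m) / (2 * m + 1) * 2) := by
    intro m
    rcases Nat.eq_zero_or_pos m with rfl | hm
    · simp
    have hm' : (0 : ℝ) < m := Nat.cast_pos.mpr hm
    have hx : (m : ℝ) + 1 / 2 ≠ 0 := by positivity
    have e1 : Real.log ((m : ℝ) + 1 / 2) = Real.log m + Real.log (1 + 1 / 2 / m) := by
      rw [← Real.log_mul hm'.ne' (by positivity)]
      congr 1
      field_simp
    have e2 : (2 * m + 1 : ℝ) = 2 * (m + 1 / 2) := by ring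
    rw [Stirling.log_stirlingSeq_formula, Real.log_div hm'.ne' (Real.exp_pos 1).ne', Real.log_exp,
      e1, e2]
    generalize (m : ℝ) + 1 / 2 = x at hx
    field_simp
    ring
  have hinv : Tendsto (fun m : ℕ => ((m : ℝ) + 1 / 2)) atTop atTop :=
    tendsto_atTop_add_const_right _ _ tendsto_natCast_atTop_atTop
  have l1 : Tendsto (fun m : ℕ => Real.log (1 + 1 / 2 / (m : ℝ))) atTop (𝓝 0) := by
    have h2 : Tendsto (fun m : ℕ => 1 + 1 / 2 / (m : ℝ)) atTop (𝓝 (1 + 0)) :=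
      tendsto_const_nhds.add (tendsto_const_div_atTop_nhds_zero_nat _)
    have := h2.log (by norm_num)
    simpa using this
  have l2 : Tendsto (fun m : ℕ => Real.log (Stirling.stirlingSeq m) / ((m : ℝ) + 1 / 2)) atTop
      (𝓝 0) :=
    (Stirling.tendsto_stirlingSeq_sqrt_pi.log (by positivity)).div_atTop hinv
  have l3 : Tendsto (fun m : ℕ => Real.log (2 * m) / (2 * m + 1)) atTop (𝓝 0) := by
    have h2 : Tendsto (fun x : ℝ => Real.log x ^ 1 / (1 * x + 1)) atTop (𝓝 0) :=
      Real.tendsto_pow_log_div_mul_add_atTop 1 1 1 one_ne_zero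
    have h3 : Tendsto (fun m : ℕ => (2 * m : ℝ)) atTop atTop :=
      tendsto_natCast_atTop_atTop.const_mul_atTop two_pos
    refine (h2.comp h3).congr fun m => ?_
    simp
  have := (((tendsto_div_add_half.mul l1).add tendsto_div_add_half).sub l2).sub
    ((l3.mul_const 2).const_mul (1 / 2))
  simp only [mul_zero, zero_mul, zero_add, sub_zero] at this
  exact this.congr fun m => (h1 m).symm

end Factorial

end Eulerian

namespace Eulerian

open Filter

/-! ### Logarithm of the product at half-integers -/

section LogSum

theorem hasSum_of_forall_eq {α : Type*} [AddCommMonoid α] [TopologicalSpace α] {f g : ℕ → α} {a : α}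
    (h : HasSum f a) (hfg : ∀ k, f k = g k) : HasSum g a := by
  rwa [← funext hfg]

variable {r : ℕ} {ε : ℝ}

theorem add_half_div_pow_lt_one (hr : 2 ≤ r) (m j : ℕ) :
    (((m : ℝ) + 1 / 2) / ((m : ℝ) + 1 + j)) ^ r < 1 := by
  refine pow_lt_one₀ (by positivity) ?_ (by omega)
  rw [div_lt_one (by positivity)]
  linarith [j.cast_nonneg (α := ℝ)]

theorem one_add_mul_pos {ε q : ℝ} (hε : |ε| = 1) (h0 : 0 ≤ q) (h1 : q < 1) : 0 < 1 + ε * q := by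
  have h2 : |ε * q| < 1 := by rwa [abs_mul, hε, one_mul, abs_of_nonneg h0]
  linarith [(abs_lt.mp h2).1]

theorem hasSum_neg_log_one_add {q : ℝ} (hε : |ε| = 1) (h0 : 0 ≤ q) (h1 : q < 1) :
    HasSum (fun k : ℕ => (-ε) ^ (k + 1) / (k + 1) * q ^ (k + 1)) (-Real.log (1 + ε * q)) := by
  have h2 : |-ε * q| < 1 := by rwa [abs_mul, abs_neg, hε, one_mul, abs_of_nonneg h0]
  have := Real.hasSum_pow_div_log_of_abs_lt_one h2
  rw [neg_mul, sub_neg_eq_add] at this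
  refine hasSum_of_forall_eq this fun k => ?_
  rw [← neg_mul, mul_pow]
  ring

theorem norm_coeff_le (hε : |ε| = 1) (k : ℕ) :
    ‖(-ε) ^ (k + 1) / ((k : ℝ) + 1)‖ = 1 / ((k : ℝ) + 1) := by
  rw [norm_div, norm_pow, norm_neg, Real.norm_eq_abs, hε, one_pow, Real.norm_of_nonneg (by positivity)]

theorem exists_mul_succ_eq (hr : 2 ≤ r) (k : ℕ) : ∃ q, r * (k + 1) = q + 2 ∧ k ≤ q := by
  refine ⟨r * (k + 1) - 2, ?_, ?_⟩
  · have : 2 * (k + 1) ≤ r * (k + 1) := Nat.mul_le_mul_right _ hr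
    omega
  · have : 2 * (k + 1) ≤ r * (k + 1) := Nat.mul_le_mul_right _ hr
    omega

theorem tailSum_mul_succ_div_le (hr : 2 ≤ r) (k m : ℕ) :
    tailSum (r * (k + 1)) m / ((m : ℝ) + 1 / 2) ≤ 1 / ((k : ℝ) + 1) := by
  obtain ⟨q, hq, hkq⟩ := exists_mul_succ_eq hr k
  rw [hq]
  refine (tailSum_div_le q m).trans (one_div_le_one_div_of_le (by positivity) ?_)
  exact_mod_cast Nat.succ_le_succ hkq

theorem headSum_mul_succ_div_le (hr : 2 ≤ r) (k m : ℕ) :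
    headSum (r * (k + 1)) m / ((m : ℝ) + 1 / 2) ≤ 1 / ((k : ℝ) + 1) := by
  obtain ⟨q, hq, hkq⟩ := exists_mul_succ_eq hr k
  refine (headSum_div_le _ m).trans (one_div_le_one_div_of_le (by positivity) ?_)
  rw [hq]
  exact_mod_cast Nat.succ_le_succ (hkq.trans (Nat.le_add_right _ _))

theorem summable_one_div_succ_mul_self :
    Summable fun k : ℕ => 1 / ((k : ℝ) + 1) * (1 / ((k : ℝ) + 1)) := by
  have := (summable_nat_add_iff 1).mpr (Real.summable_one_div_nat_pow.mpr one_lt_two)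
  refine this.congr fun k => ?_
  push_cast
  field_simp

/-- For n > x the logarithms are expanded and the sums interchanged; the uniform tail bound makes
the double series dominated by a multiple of ∑ 1/(k+1)². -/
theorem hasSum_log_tail (hr : 2 ≤ r) (hε : |ε| = 1) (m : ℕ) :
    Summable (fun k : ℕ => (-ε) ^ (k + 1) / (k + 1) * tailSum (r * (k + 1)) m) ∧
    HasSum (fun j : ℕ => Real.log (1 + ε * (((m : ℝ) + 1 / 2) / ((m : ℝ) + 1 + j)) ^ r))
      (-∑' k : ℕ, (-ε) ^ (k + 1) / (k + 1) * tailSum (r * (k + 1)) m) := by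
  have hx : 0 < (m : ℝ) + 1 / 2 := by positivity
  set g : ℕ × ℕ → ℝ := fun p => (-ε) ^ (p.1 + 1) / (p.1 + 1) *
    (((m : ℝ) + 1 / 2) / ((m : ℝ) + 1 + p.2)) ^ (r * (p.1 + 1)) with hg
  have hrow : ∀ k : ℕ, HasSum (fun j : ℕ => (((m : ℝ) + 1 / 2) / ((m : ℝ) + 1 + j)) ^ (r * (k + 1)))
      (tailSum (r * (k + 1)) m) := by
    intro k
    obtain ⟨q, hq, -⟩ := exists_mul_succ_eq hr k
    rw [hq]
    exact (summable_tailSum q m).hasSum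
  have hgs : Summable g := by
    refine Summable.of_norm ?_
    have hn : (fun p => ‖g p‖) = fun p : ℕ × ℕ => 1 / ((p.1 : ℝ) + 1) *
        (((m : ℝ) + 1 / 2) / ((m : ℝ) + 1 + p.2)) ^ (r * (p.1 + 1)) := by
      ext p
      rw [hg, norm_mul, norm_coeff_le hε, Real.norm_of_nonneg (by positivity)]
    rw [hn, summable_prod_of_nonneg fun p => by positivity]
    refine ⟨fun k => (hrow k).summable.mul_left (1 / ((k : ℝ) + 1)), ?_⟩
    refine Summable.of_nonneg_of_le (fun k => tsum_nonneg fun j => by positivity) (fun k => ?_)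
      (summable_one_div_succ_mul_self.mul_left ((m : ℝ) + 1 / 2))
    rw [((hrow k).mul_left (1 / ((k : ℝ) + 1))).tsum_eq]
    have := (div_le_iff₀ hx).mp (tailSum_mul_succ_div_le hr k m)
    calc 1 / ((k : ℝ) + 1) * tailSum (r * (k + 1)) m
        ≤ 1 / ((k : ℝ) + 1) * (1 / ((k : ℝ) + 1) * ((m : ℝ) + 1 / 2)) := by gcongr
      _ = _ := by ring
  have h1 := hgs.hasSum.prod_fiberwise fun k => (hrow k).mul_left ((-ε) ^ (k + 1) / ((k : ℝ) + 1))
  have h2 : HasSum (fun j : ℕ =>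
      -Real.log (1 + ε * (((m : ℝ) + 1 / 2) / ((m : ℝ) + 1 + j)) ^ r)) (∑' p, g p) := by
    have h3 : HasSum (g ∘ Prod.swap) (∑' p, g p) := (Equiv.prodComm ℕ ℕ).hasSum_iff.mpr hgs.hasSum
    refine h3.prod_fiberwise fun j => ?_
    have := hasSum_neg_log_one_add hε (q := (((m : ℝ) + 1 / 2) / ((m : ℝ) + 1 + j)) ^ r)
      (by positivity) (add_half_div_pow_lt_one hr m j)
    refine hasSum_of_forall_eq this fun k => ?_
    simp [hg, pow_mul]
  refine ⟨h1.summable, ?_⟩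
  rw [h1.tsum_eq]
  simpa using h2.neg

theorem sum_log_div (m : ℕ) {x : ℝ} (hx : 0 < x) :
    ∑ j ∈ Finset.range m, Real.log (x / ((j : ℝ) + 1)) = m * Real.log x - Real.log m.factorial := by
  induction m with
  | zero => simp
  | succ m ih =>
    have h1 : ((m : ℝ) + 1) ≠ 0 := by positivity
    rw [Finset.sum_range_succ, ih, Real.log_div hx.ne' h1, Nat.factorial_succ, Nat.cast_mul,
      Real.log_mul (by positivity) (by positivity)]
    push_cast
    ring

/-- For n < x the factor (x/n)^r is pulled out first: |1 + ε q^r| = q^r (1 + ε q^{-r}). The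
extracted factors give the factorial term. -/
theorem sum_log_head (hr : 2 ≤ r) (hε : |ε| = 1) (m : ℕ) :
    Summable (fun k : ℕ => (-ε) ^ (k + 1) / (k + 1) * headSum (r * (k + 1)) m) ∧
    ∑ j ∈ Finset.range m, Real.log |1 + ε * (((m : ℝ) + 1 / 2) / ((j : ℝ) + 1)) ^ r|
      = r * (m * Real.log ((m : ℝ) + 1 / 2) - Real.log m.factorial)
        - ∑' k : ℕ, (-ε) ^ (k + 1) / (k + 1) * headSum (r * (k + 1)) m := by
  have hx : 0 < (m : ℝ) + 1 / 2 := by positivity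
  have hlt : ∀ j ∈ Finset.range m, (((j : ℝ) + 1) / ((m : ℝ) + 1 / 2)) ^ r < 1 := by
    intro j hj
    refine pow_lt_one₀ (by positivity) ?_ (by omega)
    rw [div_lt_one hx]
    have : (j : ℝ) + 1 ≤ m := by exact_mod_cast Finset.mem_range.mp hj
    linarith
  have h1 := hasSum_sum (s := Finset.range m) fun j hj => hasSum_neg_log_one_add hε
    (q := (((j : ℝ) + 1) / ((m : ℝ) + 1 / 2)) ^ r) (by positivity) (hlt j hj)
  have h2 : ∀ k : ℕ, ∑ j ∈ Finset.range m, (-ε) ^ (k + 1) / ((k : ℝ) + 1) *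
      ((((j : ℝ) + 1) / ((m : ℝ) + 1 / 2)) ^ r) ^ (k + 1)
        = (-ε) ^ (k + 1) / ((k : ℝ) + 1) * headSum (r * (k + 1)) m := by
    intro k
    simp_rw [headSum, Finset.mul_sum, pow_mul]
  simp_rw [h2] at h1
  refine ⟨h1.summable, ?_⟩
  rw [h1.tsum_eq, ← sum_log_div m hx, Finset.mul_sum, ← Finset.sum_sub_distrib]
  refine Finset.sum_congr rfl fun j hj => ?_
  have hj0 : (0 : ℝ) < (j : ℝ) + 1 := by positivity
  have hpos := one_add_mul_pos hε (by positivity) (hlt j hj)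
  have hq : 0 < ((m : ℝ) + 1 / 2) / ((j : ℝ) + 1) := by positivity
  have hinv : (((j : ℝ) + 1) / ((m : ℝ) + 1 / 2)) = (((m : ℝ) + 1 / 2) / ((j : ℝ) + 1))⁻¹ :=
    (inv_div _ _).symm
  rw [sub_neg_eq_add, ← Real.log_pow, ← Real.log_mul (by positivity) hpos.ne', hinv]
  generalize ((m : ℝ) + 1 / 2) / ((j : ℝ) + 1) = q at hq
  have hεε : ε * ε = 1 := by rw [← abs_mul_abs_self, hε, one_mul]
  rw [← Real.log_abs (q ^ r * _)]
  have hq' : q ^ r ≠ 0 := by positivity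
  have h3 : q ^ r * (1 + ε * q⁻¹ ^ r) = ε * (1 + ε * q ^ r) := by
    rw [inv_pow, mul_add, mul_left_comm, mul_inv_cancel₀ hq', mul_add, ← mul_assoc, hεε]
    ring
  rw [h3, abs_mul, hε, one_mul]

/-- The sum of `log |1 + ε (x / n) ^ r|` over `n ≥ 1`, where `x = m + 1 / 2` and `ε = ± 1`. -/
noncomputable def logSum (r : ℕ) (ε : ℝ) (m : ℕ) : ℝ :=
  r * (m * Real.log ((m : ℝ) + 1 / 2) - Real.log m.factorial)
    - ∑' k : ℕ, (-ε) ^ (k + 1) / (k + 1) * (headSum (r * (k + 1)) m + tailSum (r * (k + 1)) m)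

theorem hasSum_logSum (hr : 2 ≤ r) (hε : |ε| = 1) (m : ℕ) :
    HasSum (fun n : ℕ => Real.log |1 + ε * (((m : ℝ) + 1 / 2) / ((n : ℝ) + 1)) ^ r|)
      (logSum r ε m) := by
  obtain ⟨h1, h2⟩ := hasSum_log_tail hr hε m
  obtain ⟨h3, h4⟩ := sum_log_head hr hε m
  have e1 : logSum r ε m - ∑ j ∈ Finset.range m,
      Real.log |1 + ε * (((m : ℝ) + 1 / 2) / ((j : ℝ) + 1)) ^ r|
        = -∑' k : ℕ, (-ε) ^ (k + 1) / (k + 1) * tailSum (r * (k + 1)) m := by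
    rw [h4, logSum]
    simp_rw [mul_add ((-ε) ^ _ / _)]
    rw [h3.tsum_add h1]
    abel
  rw [← hasSum_nat_add_iff' m, e1]
  refine hasSum_of_forall_eq h2 fun j => ?_
  have e : ((j + m : ℕ) : ℝ) + 1 = m + 1 + j := by
    push_cast
    ring
  rw [e, abs_of_pos (one_add_mul_pos hε (by positivity) (add_half_div_pow_lt_one hr m j))]

/-- Dominated convergence in k; Stirling's formula supplies the term r. -/
theorem tendsto_logSum_div (hr : 2 ≤ r) (hε : |ε| = 1) :
    Tendsto (fun m : ℕ => logSum r ε m / ((m : ℝ) + 1 / 2)) atTop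
      (𝓝 (r - ∑' k : ℕ, (-ε) ^ (k + 1) / (k + 1) *
        (1 / ((r : ℝ) * (k + 1) + 1) + 1 / ((r : ℝ) * (k + 1) - 1)))) := by
  have h1 : ∀ m : ℕ, logSum r ε m / ((m : ℝ) + 1 / 2)
      = r * ((m * Real.log ((m : ℝ) + 1 / 2) - Real.log m.factorial) / ((m : ℝ) + 1 / 2))
        - ∑' k : ℕ, (-ε) ^ (k + 1) / (k + 1) * (headSum (r * (k + 1)) m / ((m : ℝ) + 1 / 2)
          + tailSum (r * (k + 1)) m / ((m : ℝ) + 1 / 2)) := by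
    intro m
    rw [logSum, sub_div, mul_div_assoc, ← tsum_div_const]
    simp_rw [mul_div_assoc, add_div]
  simp_rw [h1]
  refine Tendsto.sub (by simpa using tendsto_log_factorial_div.const_mul (r : ℝ)) ?_
  refine tendsto_tsum_of_dominated_convergence (bound := fun k : ℕ =>
    2 * (1 / ((k : ℝ) + 1) * (1 / ((k : ℝ) + 1)))) (summable_one_div_succ_mul_self.mul_left 2)
    (fun k => ?_) (Eventually.of_forall fun m k => ?_)
  · refine Tendsto.const_mul _ (Tendsto.add ?_ ?_)
    · have := tendsto_headSum_div (r * (k + 1))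
      push_cast at this
      exact this
    · obtain ⟨q, hq, -⟩ := exists_mul_succ_eq hr k
      have h2 : (r : ℝ) * (k + 1) - 1 = q + 1 := by
        have : (r : ℝ) * (k + 1) = q + 2 := by exact_mod_cast hq
        rw [this]
        ring
      rw [hq, h2]
      exact tendsto_tailSum_div q
  · have hx : 0 < (m : ℝ) + 1 / 2 := by positivity
    have h2 : 0 ≤ headSum (r * (k + 1)) m / ((m : ℝ) + 1 / 2)
          + tailSum (r * (k + 1)) m / ((m : ℝ) + 1 / 2) :=
      add_nonneg (div_nonneg (headSum_nonneg _ _) hx.le) (div_nonneg (tailSum_nonneg _ _) hx.le)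
    rw [norm_mul, norm_coeff_le hε, Real.norm_of_nonneg h2]
    have h3 := add_le_add (headSum_mul_succ_div_le hr k m) (tailSum_mul_succ_div_le hr k m)
    calc _ ≤ 1 / ((k : ℝ) + 1) * (1 / ((k : ℝ) + 1) + 1 / ((k : ℝ) + 1)) := by gcongr
      _ = _ := by ring

end LogSum

/-! ### Evaluation of the limits by the partial fractions of the cotangent -/

section Limits

theorem hasSum_pi_mul_cot (r : ℕ) (hr : 2 ≤ r) :
    HasSum (fun k : ℕ => 1 / ((k : ℝ) + 1) *
        (1 / ((r : ℝ) * (k + 1) + 1) + 1 / ((r : ℝ) * (k + 1) - 1)))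
      (r - Real.pi * Real.cot (Real.pi / r)) := by
  have hr0 : (r : ℝ) ≠ 0 := by positivity
  have hr1 : (2 : ℝ) ≤ r := by exact_mod_cast hr
  have hz : (1 / (r : ℂ)) ∈ Complex.integerComplement := by
    rw [Complex.mem_integerComplement_iff]
    rintro ⟨n, hn⟩
    have h1 : (n : ℝ) = 1 / r := by
      apply_fun Complex.re at hn
      simpa using hn
    have h2 : (n : ℝ) * r = 1 := by rw [h1]; field_simp
    have h3 : n * (r : ℤ) = 1 := by exact_mod_cast h2
    have := Int.eq_one_or_neg_one_of_mul_eq_one (mul_comm n (r : ℤ) ▸ h3)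
    omega
  have h1 := (Summable.hasSum (summable_cotTerm hz)).neg
  rw [← cot_series_rep' hz] at h1
  have h2 : -(Real.pi * Complex.cot (Real.pi * (1 / (r : ℂ))) - 1 / (1 / (r : ℂ)))
      = ((r - Real.pi * Real.cot (Real.pi / r) : ℝ) : ℂ) := by
    push_cast
    rw [mul_one_div, one_div_one_div]
    ring
  rw [h2] at h1
  rw [← Complex.hasSum_ofReal]
  refine hasSum_of_forall_eq h1 fun k => ?_
  have h3 : (r : ℝ) * (k + 1) - 1 ≠ 0 := by nlinarith [k.cast_nonneg (α := ℝ)]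
  have h4 : (r : ℝ) * (k + 1) + 1 ≠ 0 := by positivity
  have h5 : (k : ℝ) + 1 ≠ 0 := by positivity
  have h6 : 1 / (r : ℝ) - (k + 1) ≠ 0 := by
    intro h
    apply h3
    field_simp at h
    linarith
  have h7 : 1 / (r : ℝ) + (k + 1) ≠ 0 := by positivity
  have key : -(1 / (1 / (r : ℝ) - (k + 1)) + 1 / (1 / (r : ℝ) + (k + 1)))
      = 1 / ((k : ℝ) + 1) * (1 / ((r : ℝ) * (k + 1) + 1) + 1 / ((r : ℝ) * (k + 1) - 1)) := by
    have e1 : 1 / (1 / (r : ℝ) - (k + 1)) = -(r / (r * (k + 1) - 1)) := by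
      rw [← div_neg, div_eq_div_iff h6 (neg_ne_zero.mpr h3)]
      field_simp
      ring
    have e2 : 1 / (1 / (r : ℝ) + (k + 1)) = r / (r * (k + 1) + 1) := by
      rw [div_eq_div_iff h7 h4]
      field_simp
      ring
    rw [e1, e2]
    generalize (k : ℝ) + 1 = n at *
    field_simp
    ring
  rw [← key]
  push_cast
  rfl

/-- The alternating sum is twice the sum over even n = k + 1 minus the full sum, and the doubled
even part is the same series for 2r. -/
theorem hasSum_neg_one_pow_cot (r : ℕ) (hr : 2 ≤ r) :
    HasSum (fun k : ℕ => (-1) ^ (k + 1) / ((k : ℝ) + 1) *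
        (1 / ((r : ℝ) * (k + 1) + 1) + 1 / ((r : ℝ) * (k + 1) - 1)))
      (r - Real.pi * (Real.cot (Real.pi / (2 * r : ℕ)) - Real.cot (Real.pi / r))) := by
  set a : ℕ → ℝ := fun k => 1 / ((k : ℝ) + 1) *
        (1 / ((r : ℝ) * (k + 1) + 1) + 1 / ((r : ℝ) * (k + 1) - 1)) with ha
  have h1 := hasSum_pi_mul_cot r hr
  have h2 := hasSum_pi_mul_cot (2 * r) (by omega)
  have h3 : HasSum (fun k => if Odd k then 2 * a k else 0)
      (((2 * r : ℕ) : ℝ) - Real.pi * Real.cot (Real.pi / (2 * r : ℕ))) := by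
    have hinj : Function.Injective fun j : ℕ => 2 * j + 1 := fun i j h => by
      simp only at h
      omega
    refine (hinj.hasSum_iff ?_).mp ?_
    · intro k hk
      rw [if_neg]
      rintro ⟨j, rfl⟩
      exact hk ⟨j, rfl⟩
    · refine hasSum_of_forall_eq h2 fun j => ?_
      rw [Function.comp_apply, if_pos (odd_two_mul_add_one j), ha]
      have e : ((2 * j + 1 : ℕ) : ℝ) + 1 = 2 * (j + 1) := by
        push_cast
        ring
      have e' : (r : ℝ) * (2 * (j + 1)) = ((2 * r : ℕ) : ℝ) * (j + 1) := by
        push_cast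
        ring
      simp only
      rw [e, e']
      field_simp
  have h4 := h3.sub h1
  have e : ((2 * r : ℕ) : ℝ) - Real.pi * Real.cot (Real.pi / (2 * r : ℕ))
      - (r - Real.pi * Real.cot (Real.pi / r))
      = r - Real.pi * (Real.cot (Real.pi / (2 * r : ℕ)) - Real.cot (Real.pi / r)) := by
    push_cast
    ring
  rw [e] at h4
  refine hasSum_of_forall_eq h4 fun k => ?_
  split_ifs with hk
  · rw [(Odd.add_one hk).neg_one_pow]
    simp only [ha]
    ring
  · rw [(Even.add_one (Nat.not_odd_iff_even.mp hk)).neg_one_pow]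
    ring

/-- The logarithmic growth rate of the entire extension of `e^{ℓ_r}` along the half-integers. -/
theorem tendsto_logSum_growthConst (r : ℕ+) (hr : r ≠ 1) :
    Tendsto (fun m : ℕ => logSum r ((-1) ^ (r : ℕ)) m / ((m : ℝ) + 1 / 2)) atTop
      (𝓝 (Real.pi * growthConst r)) := by
  have h2 := two_le_of_ne_one hr
  have h := tendsto_logSum_div (r := r) (ε := (-1) ^ (r : ℕ)) h2 (by simp)
  rw [growthConst]
  split_ifs with he
  · rw [he.neg_one_pow] at h ⊢
    rw [(hasSum_neg_one_pow_cot r h2).tsum_eq, sub_sub_cancel] at h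
    exact h
  · have ho := Nat.not_even_iff_odd.mp he
    rw [ho.neg_one_pow] at h ⊢
    simp_rw [neg_neg, one_pow] at h
    rw [(hasSum_pi_mul_cot r h2).tsum_eq, sub_sub_cancel] at h
    exact h

end Limits

end Eulerian

namespace Eulerian

open Filter

/-! ### Size of the entire extensions at negative half-integers -/

section GrowthOnNegativeAxis

theorem one_add_neg_one_pow_mul_ne_zero (r : ℕ+) (m n : ℕ) :
    1 + (-1) ^ (r : ℕ) * (((m : ℝ) + 1 / 2) / ((n : ℝ) + 1)) ^ (r : ℕ) ≠ 0 := by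
  intro h
  have h1 : |(-1) ^ (r : ℕ) * (((m : ℝ) + 1 / 2) / ((n : ℝ) + 1)) ^ (r : ℕ)| = 1 := by
    rw [eq_neg_of_add_eq_zero_right h, abs_neg, abs_one]
  rw [abs_mul, abs_pow, abs_neg, abs_one, one_pow, one_mul, abs_of_nonneg (by positivity),
    pow_eq_one_iff_of_nonneg (by positivity) r.ne_zero, div_eq_one_iff_eq (by positivity)] at h1
  have h2 : ((2 * m + 1 : ℕ) : ℝ) = (2 * n + 2 : ℕ) := by
    push_cast
    linarith
  have h3 : 2 * m + 1 = 2 * n + 2 := by exact_mod_cast h2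
  omega

/-- The logarithm of `|F_r|` at the point `- (m + 1 / 2)`, for `F_r` the entire extension of
`e^{ℓ_r}`. -/
noncomputable def logNorm (r : ℕ+) (m : ℕ) : ℝ := Real.log ‖entireExp r (-((m : ℂ) + 1 / 2))‖

theorem norm_entireExp_neg_half (r : ℕ+) (hr : r ≠ 1) (m : ℕ) :
    ‖entireExp r (-((m : ℂ) + 1 / 2))‖ = Real.exp (logSum r ((-1) ^ (r : ℕ)) m) := by
  have h1 := (hasProd_entireExp hr (-((m : ℂ) + 1 / 2))).norm
  have h2 := Real.hasProd_of_hasSum_log (fun n => abs_pos.mpr (one_add_neg_one_pow_mul_ne_zero r m n))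
    (hasSum_logSum (two_le_of_ne_one hr) (ε := (-1) ^ (r : ℕ)) (by simp) m)
  refine h1.unique ?_
  convert h2 using 2 with n
  rw [← Real.norm_eq_abs, ← Complex.norm_real]
  congr 1
  push_cast
  rw [div_pow, neg_pow, mul_div_assoc]

/-- Reflection formula, with |sin(πx)| = 1 at half-integers. -/
theorem norm_entireExp_one_neg_half (m : ℕ) :
    ‖entireExp 1 (-((m : ℂ) + 1 / 2))‖ = Real.Gamma (m + 1 / 2) / Real.pi := by
  have h1 := Complex.Gamma_mul_Gamma_one_sub ((m : ℂ) + 1 / 2)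
  have h2 : ‖Complex.sin (Real.pi * ((m : ℂ) + 1 / 2))‖ = 1 := by
    have : (Real.pi : ℂ) * ((m : ℂ) + 1 / 2) = Real.pi / 2 + m * Real.pi := by ring
    rw [this, Complex.sin_antiperiodic.add_nat_mul_eq, Complex.sin_pi_div_two]
    simp
  have h3 := congrArg norm h1
  rw [norm_mul, norm_div, h2, div_one, Complex.norm_real, Real.norm_of_nonneg Real.pi_pos.le] at h3
  have h4 : Complex.Gamma ((m : ℂ) + 1 / 2) = (Real.Gamma (m + 1 / 2) : ℂ) := by
    rw [← Complex.Gamma_ofReal]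
    push_cast
    rfl
  have h5 : 0 < Real.Gamma ((m : ℝ) + 1 / 2) := Real.Gamma_pos_of_pos (by positivity)
  rw [h4, Complex.norm_real, Real.norm_of_nonneg h5.le] at h3
  rw [entireExp, if_pos rfl, norm_inv, ← sub_eq_add_neg, inv_eq_iff_eq_inv, inv_div,
    eq_div_iff h5.ne', mul_comm]
  exact h3

theorem entireExp_neg_half_ne_zero (r : ℕ+) (m : ℕ) : entireExp r (-((m : ℂ) + 1 / 2)) ≠ 0 := by
  rw [← norm_pos_iff]
  by_cases hr : r = 1
  · subst hr
    rw [norm_entireExp_one_neg_half]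
    exact div_pos (Real.Gamma_pos_of_pos (by positivity)) Real.pi_pos
  · rw [norm_entireExp_neg_half r hr]
    exact Real.exp_pos _

theorem exp_logNorm (r : ℕ+) (m : ℕ) :
    Real.exp (logNorm r m) = ‖entireExp r (-((m : ℂ) + 1 / 2))‖ :=
  Real.exp_log (norm_pos_iff.mpr (entireExp_neg_half_ne_zero r m))

theorem tendsto_logNorm_div {r : ℕ+} (hr : r ≠ 1) :
    Tendsto (fun m : ℕ => logNorm r m / ((m : ℝ) + 1 / 2)) atTop
      (𝓝 (Real.pi * growthConst r)) := by
  refine (tendsto_logSum_growthConst r hr).congr fun m => ?_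
  rw [logNorm, norm_entireExp_neg_half r hr, Real.log_exp]

theorem factorial_le_Gamma (m : ℕ) : (m.factorial : ℝ) / 2 ≤ Real.Gamma ((m + 1 : ℕ) + 1 / 2) := by
  induction m with
  | zero =>
    rw [Nat.cast_one, add_comm (1 : ℝ), Real.Gamma_add_one (by norm_num), Real.Gamma_one_half_eq]
    simp
    linarith [Real.pi_gt_three]
  | succ m ih =>
    have e : ((m + 1 + 1 : ℕ) : ℝ) + 1 / 2 = ((m + 1 : ℕ) + 1 / 2) + 1 := by
      push_cast
      ring
    rw [e, Real.Gamma_add_one (by positivity), Nat.factorial_succ, Nat.cast_mul, mul_div_assoc]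
    exact mul_le_mul (by linarith) ih (by positivity) (by positivity)

theorem tendsto_add_half_atTop : Tendsto (fun m : ℕ => (m : ℝ) + 1 / 2) atTop atTop :=
  tendsto_atTop_add_const_right _ _ tendsto_natCast_atTop_atTop

theorem tendsto_logNorm_one_div :
    Tendsto (fun m : ℕ => logNorm 1 m / ((m : ℝ) + 1 / 2)) atTop atTop := by
  have h1 : Tendsto (fun m : ℕ => Real.log m.factorial / ((m : ℝ) + 1 / 2)) atTop atTop := by
    have h2 : Tendsto (fun m : ℕ => (m : ℝ) / (m + 1 / 2) * Real.log ((m : ℝ) + 1 / 2)) atTop atTop :=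
      tendsto_div_add_half.pos_mul_atTop one_pos (Real.tendsto_log_atTop.comp tendsto_add_half_atTop)
    refine (h2.atTop_add tendsto_log_factorial_div.neg).congr fun m => ?_
    ring
  -- The factor 1/3 absorbs the index shift: m + 3/2 ≤ 3 (m + 1/2).
  have h2 : Tendsto (fun m : ℕ => Real.log m.factorial / ((m : ℝ) + 1 / 2) * (1 / 3)
      - Real.log (2 * Real.pi)) atTop atTop :=
    tendsto_atTop_add_const_right _ _ (h1.atTop_mul_const (by norm_num))
  rw [← tendsto_add_atTop_iff_nat 1]
  refine tendsto_atTop_mono (fun m => ?_) h2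
  have hx : (0 : ℝ) < ((m + 1 : ℕ) : ℝ) + 1 / 2 := by positivity
  have h3 : Real.log m.factorial - Real.log (2 * Real.pi) ≤ logNorm 1 (m + 1) := by
    rw [← Real.log_div (by positivity) (by positivity), logNorm, norm_entireExp_one_neg_half]
    refine Real.log_le_log (by positivity) ?_
    rw [← div_div]
    exact div_le_div_of_nonneg_right (factorial_le_Gamma m) Real.pi_pos.le
  have h4 : 0 ≤ Real.log m.factorial := Real.log_natCast_nonneg _
  have h5 : 0 ≤ Real.log (2 * Real.pi) := Real.log_nonneg (by linarith [Real.pi_gt_three])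
  have h6 : Real.log m.factorial / ((m : ℝ) + 1 / 2) * (1 / 3)
      ≤ Real.log m.factorial / (((m + 1 : ℕ) : ℝ) + 1 / 2) := by
    rw [div_mul_div_comm, mul_one]
    refine div_le_div_of_nonneg_left h4 hx ?_
    push_cast
    linarith [m.cast_nonneg (α := ℝ)]
  have h8 : Real.log (2 * Real.pi) / (((m + 1 : ℕ) : ℝ) + 1 / 2) ≤ Real.log (2 * Real.pi) := by
    refine div_le_self h5 ?_
    push_cast
    linarith [m.cast_nonneg (α := ℝ)]
  calc _ ≤ Real.log m.factorial / (((m + 1 : ℕ) : ℝ) + 1 / 2)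
        - Real.log (2 * Real.pi) / (((m + 1 : ℕ) : ℝ) + 1 / 2) := sub_le_sub h6 h8
    _ = (Real.log m.factorial - Real.log (2 * Real.pi)) / (((m + 1 : ℕ) : ℝ) + 1 / 2) := by
        rw [sub_div]
    _ ≤ _ := div_le_div_of_nonneg_right h3 hx.le

theorem norm_sin_le (w : ℂ) : ‖Complex.sin w‖ ≤ Real.exp |w.im| := by
  rw [Complex.sin, norm_div, norm_mul, Complex.norm_I, mul_one, Complex.norm_ofNat,
    div_le_iff₀ two_pos]
  refine (norm_sub_le _ _).trans ?_
  rw [Complex.norm_exp, Complex.norm_exp]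
  have h1 : (-w * Complex.I).re = w.im := by simp
  have h2 : (w * Complex.I).re = -w.im := by simp
  rw [h1, h2, mul_two]
  exact add_le_add (Real.exp_le_exp.mpr (le_abs_self _)) (Real.exp_le_exp.mpr (neg_le_abs _))

theorem le_norm_sin_mul_I {y : ℝ} (hy : 1 / 2 ≤ y) :
    Real.exp y / 4 ≤ ‖Complex.sin (y * Complex.I)‖ := by
  rw [Complex.sin_mul_I, norm_mul, Complex.norm_I, mul_one, ← Complex.ofReal_sinh, Complex.norm_real,
    Real.norm_of_nonneg (Real.sinh_nonneg_iff.mpr (by linarith)), Real.sinh_eq, Real.exp_neg]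
  have h1 : 2 ≤ Real.exp y * Real.exp y := by
    rw [← Real.exp_add]
    linarith [Real.add_one_le_exp (y + y)]
  have h2 : (Real.exp y)⁻¹ ≤ Real.exp y / 2 := by
    rw [inv_le_iff_one_le_mul₀ (Real.exp_pos y)]
    linarith
  linarith

theorem entireExp_two_neg {x : ℝ} (hx : 0 < x) : entireExp 2 (-(x : ℂ))
    = Complex.sin (Real.pi * (x * Complex.I)) / (Real.pi * (x * Complex.I)) := by
  have hx' : (x : ℂ) ≠ 0 := Complex.ofReal_ne_zero.mpr hx.ne'
  have h1 := (hasProd_entireExp (r := 2) (by decide) (-(x : ℂ))).tendsto_prod_nat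
  have h2 := tendsto_euler_sin_prod' (x := x * Complex.I) (mul_ne_zero hx' Complex.I_ne_zero)
  refine tendsto_nhds_unique h1 (h2.congr fun n => Finset.prod_congr rfl fun i _ => ?_)
  rw [sineTerm, mul_pow, Complex.I_sq]
  push_cast
  ring

/-- Factor 1 + y³ = (1 + y)(1 - yζ²)(1 - yη²) at y = x²/n² and use Euler's sine product. -/
theorem entireExp_six_neg {x : ℝ} {ζ η : ℂ} (hx : 0 < x) (h1 : ζ ^ 2 + η ^ 2 = 1)
    (h2 : ζ ^ 2 * η ^ 2 = 1) : entireExp 6 (-(x : ℂ)) = entireExp 2 (-(x : ℂ)) *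
      (Complex.sin (Real.pi * (x * ζ)) / (Real.pi * (x * ζ))) *
      (Complex.sin (Real.pi * (x * η)) / (Real.pi * (x * η))) := by
  have hx' : (x : ℂ) ≠ 0 := Complex.ofReal_ne_zero.mpr hx.ne'
  have hζ : ζ ≠ 0 := fun h => by simp [h] at h2
  have hη : η ≠ 0 := fun h => by simp [h] at h2
  have l1 := (hasProd_entireExp (r := 6) (by decide) (-(x : ℂ))).tendsto_prod_nat
  have l2 := (hasProd_entireExp (r := 2) (by decide) (-(x : ℂ))).tendsto_prod_nat
  have l3 := tendsto_euler_sin_prod' (x := x * ζ) (mul_ne_zero hx' hζ)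
  have l4 := tendsto_euler_sin_prod' (x := x * η) (mul_ne_zero hx' hη)
  refine tendsto_nhds_unique l1 (((l2.mul l3).mul l4).congr fun n => ?_)
  rw [← Finset.prod_mul_distrib, ← Finset.prod_mul_distrib]
  refine Finset.prod_congr rfl fun i _ => ?_
  rw [sineTerm, sineTerm]
  have hi : ((i + 1 : ℕ) : ℂ) ≠ 0 := Nat.cast_ne_zero.mpr i.succ_ne_zero
  push_cast at hi ⊢
  generalize (i : ℂ) + 1 = n at hi
  have e : ∀ y : ℂ, (1 + y) * (1 - y * ζ ^ 2) * (1 - y * η ^ 2) = 1 + y ^ 3 := by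
    intro y
    linear_combination (-(1 + y) * y) * h1 + (1 + y) * y ^ 2 * h2
  have := e (x ^ 2 / n ^ 2)
  calc _ = (1 + (x : ℂ) ^ 2 / n ^ 2) * (1 - x ^ 2 / n ^ 2 * ζ ^ 2) * (1 - x ^ 2 / n ^ 2 * η ^ 2) := by
        simp only [neg_pow_two]
        ring
    _ = _ := by
        rw [this]
        ring

theorem norm_entireExp_six_le {x : ℝ} (hx : 1 / 2 ≤ x) : ‖entireExp 6 (-(x : ℂ))‖
    ≤ 4 / (Real.pi * x) * ‖entireExp 2 (-(x : ℂ))‖ ^ 2 := by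
  have hx0 : 0 < x := by linarith
  have hpi := Real.pi_pos
  -- These are e^{5πi/6} and e^{πi/6}: each sine is at most e^{πx/2}. Together they grow no faster
  -- than the sine in F_2, but with an extra denominator πx.
  set ζ : ℂ := ⟨-(√3 / 2), 1 / 2⟩ with hζ
  set η : ℂ := ⟨√3 / 2, 1 / 2⟩ with hη
  have h3 : √3 * √3 = 3 := Real.mul_self_sqrt (by norm_num)
  have eζ : ζ ^ 2 = ⟨1 / 2, -(√3 / 2)⟩ := by
    rw [sq]
    apply Complex.ext
    · simp [hζ]
      linarith
    · simp [hζ]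
      ring
  have eη : η ^ 2 = ⟨1 / 2, √3 / 2⟩ := by
    rw [sq]
    apply Complex.ext
    · simp [hη]
      linarith
    · simp [hη]
      ring
  have h1 : ζ ^ 2 + η ^ 2 = 1 := by
    rw [eζ, eη]
    apply Complex.ext <;> (simp; try norm_num)
  have h2 : ζ ^ 2 * η ^ 2 = 1 := by
    rw [eζ, eη]
    apply Complex.ext
    · simp
      linarith
    · simp
      ring
  have hnorm : ∀ w : ℂ, w.re * w.re + w.im * w.im = 1 → ‖w‖ = 1 := by
    intro w hw
    rw [Complex.norm_def, Complex.normSq_apply, hw, Real.sqrt_one]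
  have nζ : ‖ζ‖ = 1 := hnorm ζ (by simp [hζ]; linarith)
  have nη : ‖η‖ = 1 := hnorm η (by simp [hη]; linarith)
  have hb : ∀ w : ℂ, w.im = 1 / 2 → ‖w‖ = 1 →
      ‖Complex.sin (Real.pi * (x * w)) / (Real.pi * (x * w))‖
        ≤ Real.exp (Real.pi * x / 2) / (Real.pi * x) := by
    intro w hw hw1
    rw [norm_div, norm_mul, norm_mul, hw1, Complex.norm_real, Complex.norm_real,
      Real.norm_of_nonneg hpi.le, Real.norm_of_nonneg hx0.le, mul_one]
    refine div_le_div_of_nonneg_right ((norm_sin_le _).trans_eq ?_) (by positivity)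
    have : ((Real.pi : ℂ) * (x * w)).im = Real.pi * x / 2 := by
      rw [Complex.im_ofReal_mul, Complex.im_ofReal_mul, hw]
      ring
    rw [this, abs_of_nonneg (by positivity)]
  have hS : Real.exp (Real.pi * x) / 4 / (Real.pi * x) ≤ ‖entireExp 2 (-(x : ℂ))‖ := by
    rw [entireExp_two_neg hx0, norm_div, norm_mul, norm_mul, Complex.norm_I, Complex.norm_real,
      Complex.norm_real, Real.norm_of_nonneg hpi.le, Real.norm_of_nonneg hx0.le, mul_one]
    refine div_le_div_of_nonneg_right ?_ (by positivity)
    have : (Real.pi : ℂ) * (x * Complex.I) = (Real.pi * x : ℝ) * Complex.I := by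
      push_cast
      ring
    rw [this]
    refine le_norm_sin_mul_I ?_
    nlinarith [Real.pi_gt_three]
  rw [entireExp_six_neg hx0 h1 h2, norm_mul, norm_mul]
  have hy : 0 < Real.pi * x := by positivity
  generalize Real.pi * x = y at *
  have e : Real.exp (y / 2) / y * (Real.exp (y / 2) / y) = 4 / y * (Real.exp y / 4 / y) := by
    rw [div_mul_div_comm, ← Real.exp_add, add_halves]
    field_simp
  calc _ ≤ ‖entireExp 2 (-(x : ℂ))‖ * (Real.exp (y / 2) / y) * (Real.exp (y / 2) / y) := by
        gcongr
        · exact hb ζ rfl nζ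
        · exact hb η rfl nη
    _ = 4 / y * (‖entireExp 2 (-(x : ℂ))‖ * (Real.exp y / 4 / y)) := by
        rw [mul_assoc, e]
        ring
    _ ≤ 4 / y * (‖entireExp 2 (-(x : ℂ))‖ * ‖entireExp 2 (-(x : ℂ))‖) := by
        gcongr
    _ = _ := by rw [sq]

theorem tendsto_logNorm_six_sub :
    Tendsto (fun m : ℕ => logNorm 6 m - 2 * logNorm 2 m) atTop atBot := by
  have h1 : Tendsto (fun m : ℕ => Real.log (4 / Real.pi) - Real.log ((m : ℝ) + 1 / 2)) atTop atBot :=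
    tendsto_const_nhds.add_atBot
      (tendsto_neg_atTop_atBot.comp (Real.tendsto_log_atTop.comp tendsto_add_half_atTop))
  refine tendsto_atBot_mono (fun m => ?_) h1
  have hx : (0 : ℝ) < (m : ℝ) + 1 / 2 := by positivity
  have h2 := norm_entireExp_six_le (x := (m : ℝ) + 1 / 2) (by simp)
  push_cast at h2
  rw [← exp_logNorm, ← exp_logNorm] at h2
  have h3 := Real.log_le_log (Real.exp_pos _) h2
  rw [Real.log_exp, Real.log_mul (by positivity) (by positivity), Real.log_pow, Real.log_exp,
    ← div_div, Real.log_div (by positivity) hx.ne'] at h3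
  push_cast at h3
  linarith

end GrowthOnNegativeAxis

end Eulerian

namespace Eulerian

open Filter

/-! ### Comparison of monomials and independence of the e^{ℓ_r} -/

section AlgebraicIndependence

/-- Three scales decide in turn: the superlinear term of index 1, the linear rate c, and, if both
vanish, a nonzero multiple of log|F_6| - 2 log|F_2|. -/
theorem tendsto_sum_logNorm (T : Finset ℕ+) (d : ℕ+ → ℤ) (h1 : 1 ∈ T) (h2 : 2 ∈ T) (h6 : 6 ∈ T)
    (hd : ∃ r ∈ T, d r ≠ 0) :
    Tendsto (fun m : ℕ => ∑ r ∈ T, (d r : ℝ) * logNorm r m) atTop atTop ∨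
    Tendsto (fun m : ℕ => ∑ r ∈ T, (d r : ℝ) * logNorm r m) atTop atBot := by
  set c : ℝ := Real.pi * ∑ r ∈ T.erase 1, (d r : ℝ) * growthConst r with hc
  have htail : Tendsto (fun m : ℕ => (∑ r ∈ T.erase 1, (d r : ℝ) * logNorm r m) /
      ((m : ℝ) + 1 / 2)) atTop (𝓝 c) := by
    have h : Tendsto (fun m : ℕ => ∑ r ∈ T.erase 1, (d r : ℝ) *
        (logNorm r m / ((m : ℝ) + 1 / 2))) atTop
        (𝓝 (∑ r ∈ T.erase 1, (d r : ℝ) * (Real.pi * growthConst r))) :=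
      tendsto_finsetSum _ fun r hr =>
        (tendsto_logNorm_div (Finset.ne_of_mem_erase hr)).const_mul _
    have e : ∑ r ∈ T.erase 1, (d r : ℝ) * (Real.pi * growthConst r) = c := by
      rw [hc, Finset.mul_sum]
      exact Finset.sum_congr rfl fun r _ => by ring
    rw [e] at h
    refine h.congr fun m => ?_
    rw [Finset.sum_div]
    exact Finset.sum_congr rfl fun r _ => (mul_div_assoc _ _ _).symm
  have hsplit : ∀ m : ℕ, ∑ r ∈ T, (d r : ℝ) * logNorm r m
      = (d 1 * (logNorm 1 m / ((m : ℝ) + 1 / 2)) + (∑ r ∈ T.erase 1, (d r : ℝ) * logNorm r m) /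
        ((m : ℝ) + 1 / 2)) * ((m : ℝ) + 1 / 2) := by
    intro m
    rw [← Finset.add_sum_erase _ _ h1, ← mul_div_assoc, ← add_div, div_mul_cancel₀]
    positivity
  rcases lt_trichotomy (d 1) 0 with h | h | h
  · right
    simp_rw [hsplit]
    refine Tendsto.atBot_mul_atTop₀ ?_ tendsto_add_half_atTop
    exact (tendsto_logNorm_one_div.const_mul_atTop_of_neg (Int.cast_lt_zero.mpr h)).atBot_add htail
  · have hsplit' : ∀ m : ℕ, ∑ r ∈ T, (d r : ℝ) * logNorm r m
        = (∑ r ∈ T.erase 1, (d r : ℝ) * logNorm r m) / ((m : ℝ) + 1 / 2) * ((m : ℝ) + 1 / 2) := by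
      intro m
      rw [hsplit, h, Int.cast_zero, zero_mul, zero_add]
    rcases lt_trichotomy c 0 with hc0 | hc0 | hc0
    · right
      simp_rw [hsplit']
      exact htail.neg_mul_atTop hc0 tendsto_add_half_atTop
    · have m2 : (2 : ℕ+) ∈ T.erase 1 := Finset.mem_erase.mpr ⟨by decide, h2⟩
      have m6 : (6 : ℕ+) ∈ T.erase 1 := Finset.mem_erase.mpr ⟨by decide, h6⟩
      obtain ⟨k1, k2⟩ := sum_mul_growthConst_eq_zero (T.erase 1) d (Finset.notMem_erase _ _) m2 m6
        ((mul_eq_zero.mp (hc.symm.trans hc0)).resolve_left Real.pi_ne_zero)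
      have hd2 : (d 2 : ℝ) = -(2 * d 6) := by
        have : d 2 = -(2 * d 6) := by omega
        exact_mod_cast this
      have hd6 : d 6 ≠ 0 := by
        intro h0
        obtain ⟨r, hr, hdr⟩ := hd
        apply hdr
        by_cases e1 : r = 1
        · rw [e1, h]
        by_cases e2 : r = 2
        · rw [e2]; omega
        by_cases e6 : r = 6
        · rw [e6, h0]
        exact k1 r (Finset.mem_erase.mpr ⟨e1, hr⟩) e2 e6
      have hs : ∀ m : ℕ, ∑ r ∈ T, (d r : ℝ) * logNorm r m
          = d 6 * (logNorm 6 m - 2 * logNorm 2 m) := by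
        intro m
        have m62 : (6 : ℕ+) ∈ (T.erase 1).erase 2 := Finset.mem_erase.mpr ⟨by decide, m6⟩
        rw [← Finset.add_sum_erase _ _ h1, ← Finset.add_sum_erase _ _ m2,
          Finset.sum_eq_single_of_mem 6 m62, h, hd2]
        · push_cast
          ring
        · intro r hr hr6
          have hr' := Finset.mem_erase.mp hr
          rw [k1 r hr'.2 hr'.1 hr6, Int.cast_zero, zero_mul]
      simp_rw [hs]
      rcases hd6.lt_or_gt with hlt | hgt
      · exact Or.inl (tendsto_logNorm_six_sub.const_mul_atBot_of_neg (Int.cast_lt_zero.mpr hlt))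
      · exact Or.inr (tendsto_logNorm_six_sub.const_mul_atBot (Int.cast_pos.mpr hgt))
    · left
      simp_rw [hsplit']
      exact htail.pos_mul_atTop hc0 tendsto_add_half_atTop
  · left
    simp_rw [hsplit]
    refine Tendsto.atTop_mul_atTop₀ ?_ tendsto_add_half_atTop
    exact (tendsto_logNorm_one_div.const_mul_atTop (Int.cast_pos.mpr h)).atTop_add htail

/-- The ratio of two distinct monomials at -(m + 1/2) has modulus exp of a nontrivial integer
combination of the `logNorm`, so it tends to 0 or to infinity. -/
theorem eq_zero_of_eval_entireExp_eq_zero (p : MvPolynomial ℕ+ ℂ)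
    (h : ∀ z, MvPolynomial.eval (fun r => entireExp r z) p = 0) : p = 0 := by
  classical
  by_contra hp
  set T : Finset ℕ+ := p.support.biUnion Finsupp.support ∪ {1, 2, 6} with hT
  have hsub : ∀ e ∈ p.support, e.support ⊆ T := fun e he =>
    (Finset.subset_biUnion_of_mem Finsupp.support he).trans Finset.subset_union_left
  set a : (ℕ+ →₀ ℕ) → ℕ → ℂ := fun e m =>
    p.coeff e * ∏ r ∈ e.support, entireExp r (-((m : ℂ) + 1 / 2)) ^ e r with ha
  have hnorm : ∀ e ∈ p.support, ∀ m, ‖a e m‖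
      = ‖p.coeff e‖ * Real.exp (∑ r ∈ T, (e r : ℝ) * logNorm r m) := by
    intro e he m
    rw [ha, norm_mul, norm_prod, Real.exp_sum]
    congr 1
    refine Finset.prod_subset_one_on_sdiff (hsub e he) (fun r hr => ?_) (fun r _ => ?_)
    · rw [Finsupp.notMem_support_iff.mp (Finset.mem_sdiff.mp hr).2, Nat.cast_zero, zero_mul,
        Real.exp_zero]
    · rw [norm_pow, Real.exp_nat_mul, exp_logNorm]
  have hlo : ∀ e ∈ p.support, ∀ e' ∈ p.support, Tendsto (fun m : ℕ => ∑ r ∈ T,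
      (((e' r : ℤ) - (e r : ℤ) : ℤ) : ℝ) * logNorm r m) atTop atTop → a e =o[atTop] a e' := by
    intro e he e' he' ht
    rw [← Asymptotics.isLittleO_norm_norm]
    simp_rw [hnorm e he, hnorm e' he']
    have hc : ‖p.coeff e'‖ ≠ 0 := norm_ne_zero_iff.mpr (MvPolynomial.mem_support_iff.mp he')
    refine ((Real.isLittleO_exp_comp_exp_comp.mpr (ht.congr fun m => ?_)).const_mul_left _
      ).trans_isBigO (Asymptotics.isBigO_self_const_mul hc _ _)
    rw [← Finset.sum_sub_distrib]
    refine Finset.sum_congr rfl fun r _ => ?_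
    push_cast
    ring
  refine not_sum_eventuallyEq_zero (l := atTop) p.support
    (MvPolynomial.support_nonempty.mpr hp) a (fun e he => Eventually.of_forall fun m => ?_) ?_
    (Eventually.of_forall fun m => ?_)
  · refine mul_ne_zero (MvPolynomial.mem_support_iff.mp he)
      (Finset.prod_ne_zero_iff.mpr fun r _ => pow_ne_zero _ (entireExp_neg_half_ne_zero r m))
  · intro e he e' he' hne
    obtain ⟨r, hr⟩ := Finsupp.ne_iff.mp hne
    have hrT : r ∈ T := by
      by_contra hrT
      exact hr ((Finsupp.notMem_support_iff.mp fun h => hrT (hsub e he h)).trans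
        (Finsupp.notMem_support_iff.mp fun h => hrT (hsub e' he' h)).symm)
    rcases tendsto_sum_logNorm T (fun r => (e' r : ℤ) - (e r : ℤ)) (by simp [hT]) (by simp [hT])
      (by simp [hT]) ⟨r, hrT, by omega⟩ with ht | ht
    · exact Or.inl (hlo e he e' he' ht)
    · refine Or.inr (hlo e' he' e he ((tendsto_neg_atBot_atTop.comp ht).congr fun m => ?_))
      rw [Function.comp_apply, ← Finset.sum_neg_distrib]
      refine Finset.sum_congr rfl fun r _ => ?_
      push_cast
      ring
  · rw [← h (-((m : ℂ) + 1 / 2)), MvPolynomial.eval_eq]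

theorem algebraicIndependent_expEllD : AlgebraicIndependent ℂ expEllD := by
  rw [algebraicIndependent_iff]
  intro p hp
  refine eq_zero_of_eval_entireExp_eq_zero p fun z => ?_
  have hF : Differentiable ℂ fun z => MvPolynomial.eval (fun r => entireExp r z) p := by
    simp_rw [MvPolynomial.eval_eq]
    refine Differentiable.fun_sum fun e _ => Differentiable.const_mul ?_ _
    exact Differentiable.fun_finsetProd fun r _ => (differentiable_entireExp r).pow _
  have h0 : ∀ᶠ z in 𝓝 (0 : ℂ), MvPolynomial.eval (fun r => entireExp r z) p = 0 := by
    filter_upwards [Metric.isOpen_ball.mem_nhds (Metric.mem_ball_self one_pos : (0 : ℂ) ∈ disc)]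
      with z hz
    have h1 := congrFun hp ⟨z, hz⟩
    have h2 : MvPolynomial.aeval expEllD p ⟨z, hz⟩
        = MvPolynomial.eval (fun r => entireExp r z) p := by
      have := MvPolynomial.map_aeval expEllD (Pi.evalRingHom (fun _ : disc => ℂ) ⟨z, hz⟩) p
      rw [Pi.evalRingHom_apply] at this
      rw [this]
      have e1 : (fun r => (Pi.evalRingHom (fun _ : disc => ℂ) ⟨z, hz⟩) (expEllD r))
          = fun r => entireExp r z := funext fun r => exp_ell r hz
      rw [e1]
      rfl
    rw [← h2, h1]
    rfl
  have h3 : AnalyticOnNhd ℂ (fun z => MvPolynomial.eval (fun r => entireExp r z) p) Set.univ :=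
    fun w _ => hF.analyticAt w
  exact h3.eqOn_zero_of_preconnected_of_eventuallyEq_zero isPreconnected_univ (Set.mem_univ 0) h0
    (Set.mem_univ z)

end AlgebraicIndependence

end Eulerian

namespace Eulerian

open Filter

/-! ### From algebraic to linear independence -/

section LinearIndependence

/-- A relation would be a polynomial 1 - ∑ c_i X_i, nonzero because its constant coefficient is 1.
-/
theorem one_notMem_span_of_algebraicIndependent {ι A : Type*} [CommRing A] [Algebra ℂ A]
    {v : ι → A} (hv : AlgebraicIndependent ℂ v) : (1 : A) ∉ Submodule.span ℂ (Set.range v) := by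
  intro h
  obtain ⟨c, hc⟩ := Finsupp.mem_span_range_iff_exists_finsupp.mp h
  have h1 := (algebraicIndependent_iff.mp hv) (1 - c.sum fun i a => a • MvPolynomial.X i) (by
    rw [map_sub, map_one, ← hc, map_finsuppSum]
    simp)
  have h2 := congrArg MvPolynomial.constantCoeff h1
  rw [map_sub, map_one, map_finsuppSum] at h2
  simp at h2

theorem linearIndependent_sub_one {ι A : Type*} [CommRing A] [Algebra ℂ A]
    {v : ι → A} (hv : AlgebraicIndependent ℂ v) : LinearIndependent ℂ fun i => v i - 1 := by
  rw [linearIndependent_iff]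
  intro c hc
  have h1 : Finsupp.linearCombination ℂ v c = (c.sum fun _ a => a) • (1 : A) := by
    rw [Finsupp.linearCombination_apply, Finsupp.sum, ← sub_eq_zero, Finsupp.sum, Finset.sum_smul,
      ← Finset.sum_sub_distrib, ← hc, Finsupp.linearCombination_apply, Finsupp.sum]
    simp_rw [smul_sub]
  by_cases hs : (c.sum fun _ a => a) = 0
  · rw [hs, zero_smul] at h1
    exact linearIndependent_iff.mp hv.linearIndependent c h1
  · refine absurd ?_ (one_notMem_span_of_algebraicIndependent hv)
    rw [← inv_smul_smul₀ hs (1 : A), ← h1]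
    exact Submodule.smul_mem _ _
      (Finsupp.mem_span_range_iff_exists_finsupp.mpr ⟨c, rfl⟩)

end LinearIndependence

/-! ### Kleene star of a letter -/

section KleeneStar

theorem conc_letter_cons (r : ℕ+) (T : Series) (a : ℕ+) (w : Word) :
    conc (letter r) T (a :: w) = if a = r then T w else 0 := by
  rw [conc, Finset.sum_eq_single_of_mem 1 (by simp)]
  · simp [letter]
  · intro i hmem hi
    rw [letter, if_neg, zero_mul]
    intro h
    rcases i with _ | _ | i
    · simp at h
    · exact hi rfl
    · rw [List.take_succ_cons, List.cons.injEq] at h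
      have h2 := h.2
      rcases w with _ | ⟨b, w⟩
      · simp at hmem
      · simp at h2

theorem concPow_letter (r : ℕ+) (n : ℕ) (w : Word) :
    concPow (letter r) n w = if w = List.replicate n r then 1 else 0 := by
  induction n generalizing w with
  | zero => rfl
  | succ n ih =>
    rw [concPow]
    rcases w with _ | ⟨a, w⟩
    · simp [conc, letter]
    · rw [conc_letter_cons, ih, List.replicate_succ]
      simp only [List.cons.injEq]
      split_ifs <;> simp_all

theorem kleeneStar_letter_replicate (r : ℕ+) (n : ℕ) :
    kleeneStar (letter r) (List.replicate n r) = 1 := by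
  rw [kleeneStar, Finset.sum_eq_single_of_mem n (by simp)]
  · rw [concPow_letter, if_pos rfl]
  · intro m _ hm
    rw [concPow_letter, if_neg]
    intro h
    exact hm (by simpa using (congrArg List.length h).symm)

theorem kleeneStar_letter_of_notMem_range (r : ℕ+) {w : Word}
    (hw : w ∉ Set.range fun n => List.replicate n r) : kleeneStar (letter r) w = 0 :=
  Finset.sum_eq_zero fun n _ => by
    rw [concPow_letter, if_neg]
    rintro rfl
    exact hw ⟨n, rfl⟩

end KleeneStar

/-! ### Iterated integrals of powers of a letter -/

section IteratedIntegrals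

variable {u : ℕ+ → ℂ → ℂ} {r : ℕ+} {G : ℂ → ℂ}

theorem ofReal_mul_mem_disc {t : ℝ} (ht : t ∈ Set.uIcc (0 : ℝ) 1) {z : ℂ} (hz : z ∈ disc) :
    (t : ℂ) * z ∈ disc := by
  rw [Set.uIcc_of_le zero_le_one] at ht
  rw [mem_disc] at hz ⊢
  rw [norm_mul, Complex.norm_real, Real.norm_of_nonneg ht.1]
  exact (mul_le_of_le_one_left (norm_nonneg _) ht.2).trans_lt hz

/-- Fundamental theorem of calculus along the segment: the integrand is the derivative of t ↦
G(tz)^(n+1)/(n+1)!, and G(0) = 0 removes the lower endpoint. -/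
theorem iterInt_replicate (hG : DifferentiableOn ℂ G disc) (h0 : G 0 = 0)
    (hu : ∀ z ∈ disc, u r z = deriv G z) (n : ℕ) {z : ℂ} (hz : z ∈ disc) :
    iterInt u (List.replicate n r) z = G z ^ n / n.factorial := by
  induction n generalizing z with
  | zero => simp [iterInt]
  | succ n ih =>
    have hder : ∀ t ∈ Set.uIcc (0 : ℝ) 1, HasDerivAt
        (fun t : ℝ => G ((t : ℂ) * z) ^ (n + 1) / (n + 1).factorial)
        (z * (u r ((t : ℂ) * z) * iterInt u (List.replicate n r) ((t : ℂ) * z))) t := by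
      intro t ht
      have hm := ofReal_mul_mem_disc ht hz
      have h1 : HasDerivAt G (deriv G ((t : ℂ) * z)) ((t : ℂ) * z) :=
        (hG.differentiableAt (Metric.isOpen_ball.mem_nhds hm)).hasDerivAt
      have h2 : HasDerivAt (fun t : ℝ => (t : ℂ) * z) (1 * z) t :=
        (HasDerivAt.ofReal_comp (hasDerivAt_id t)).mul_const z
      have h3 := ((h1.comp t h2).pow (n + 1)).div_const ((n + 1).factorial : ℂ)
      refine h3.congr_deriv ?_
      rw [hu _ hm, ih hm, Nat.factorial_succ, Nat.add_sub_cancel, one_mul, Function.comp_apply]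
      have e1 : ((n.factorial : ℕ) : ℂ) ≠ 0 := Nat.cast_ne_zero.mpr n.factorial_ne_zero
      have e2 : ((n + 1 : ℕ) : ℂ) ≠ 0 := Nat.cast_ne_zero.mpr n.succ_ne_zero
      push_cast at e2 ⊢
      field_simp
    have hcont : ContinuousOn (fun t : ℝ =>
        z * (u r ((t : ℂ) * z) * iterInt u (List.replicate n r) ((t : ℂ) * z)))
        (Set.uIcc 0 1) := by
      have hmaps : Set.MapsTo (fun t : ℝ => (t : ℂ) * z) (Set.uIcc 0 1) disc :=
        fun t ht => ofReal_mul_mem_disc ht hz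
      have hl : ContinuousOn (fun t : ℝ => (t : ℂ) * z) (Set.uIcc 0 1) := by fun_prop
      have c1 := (hG.deriv Metric.isOpen_ball).continuousOn.comp hl hmaps
      have c2 := ((hG.continuousOn.comp hl hmaps).pow n).div_const (n.factorial : ℂ)
      refine ((continuousOn_const (c := z)).mul (c1.mul c2)).congr fun t ht => ?_
      have hm := ofReal_mul_mem_disc ht hz
      simp only [hu _ hm, ih hm]
      rfl
    rw [List.replicate_succ, iterInt, ← intervalIntegral.integral_const_mul,
      intervalIntegral.integral_eq_sub_of_hasDerivAt hder hcont.intervalIntegrable]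
    simp [h0]

theorem hasSum_letter (hG : DifferentiableOn ℂ G disc) (h0 : G 0 = 0)
    (hu : ∀ z ∈ disc, u r z = deriv G z) {z : ℂ} (hz : z ∈ disc) :
    HasSum (fun w : Word => letter r w * iterInt u w z) (G z) := by
  have h1 := hasSum_single (f := fun w : Word => letter r w * iterInt u w z) [r] fun w hw => by
    rw [letter, if_neg hw, zero_mul]
  have h2 := iterInt_replicate hG h0 hu 1 hz
  rw [List.replicate_one] at h2
  rw [h2, letter, if_pos rfl] at h1
  simpa using h1

theorem hasSum_kleeneStar_letter (hG : DifferentiableOn ℂ G disc) (h0 : G 0 = 0)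
    (hu : ∀ z ∈ disc, u r z = deriv G z) {z : ℂ} (hz : z ∈ disc) :
    HasSum (fun w : Word => kleeneStar (letter r) w * iterInt u w z) (Complex.exp (G z)) := by
  have hinj : Function.Injective fun n => List.replicate n r := fun m n h => by
    simpa using congrArg List.length h
  refine (hinj.hasSum_iff fun w hw => ?_).mp ?_
  · rw [kleeneStar_letter_of_notMem_range r hw, zero_mul]
  · have h1 := NormedSpace.expSeries_div_hasSum_exp (G z)
    rw [← Complex.exp_eq_exp_ℂ] at h1
    have h2 : ((fun w : Word => kleeneStar (letter r) w * iterInt u w z) ∘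
        fun n => List.replicate n r) = fun n => G z ^ n / n.factorial := by
      ext n
      rw [Function.comp_apply, kleeneStar_letter_replicate, one_mul,
        iterInt_replicate hG h0 hu n hz]
    rw [h2]
    exact h1

variable {s : ℕ+ → Series} {f : ℕ+ → disc → ℂ}

theorem alpha_linearCombination
    (h : ∀ r (z : disc), HasSum (fun w : Word => s r w * iterInt u w z) (f r z)) (c : ℕ+ →₀ ℂ) :
    alpha u (Finsupp.linearCombination ℂ s c) = Finsupp.linearCombination ℂ f c := by
  ext z
  rw [alpha, Finsupp.linearCombination_apply, Finsupp.linearCombination_apply, Finsupp.sum,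
    Finsupp.sum, Finset.sum_apply]
  refine Eq.trans (tsum_congr fun w => ?_)
    (hasSum_sum fun r (_ : r ∈ c.support) => (h r z).mul_left (c r)).tsum_eq
  rw [Finset.sum_apply, Finset.sum_mul]
  exact Finset.sum_congr rfl fun r _ => mul_assoc _ _ _

theorem mapsTo_alpha_span
    (h : ∀ r (z : disc), HasSum (fun w : Word => s r w * iterInt u w z) (f r z))
    {V : Submodule ℂ (disc → ℂ)} (hf : ∀ r, f r ∈ V) :
    Set.MapsTo (alpha u) (Submodule.span ℂ (Set.range s) : Set Series) V := by
  intro S hS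
  obtain ⟨c, rfl⟩ := Finsupp.mem_span_range_iff_exists_finsupp.mp hS
  rw [← Finsupp.linearCombination_apply, alpha_linearCombination h,
    Finsupp.linearCombination_apply]
  exact V.sum_mem fun r _ => V.smul_mem _ (hf r)

theorem injOn_alpha_span
    (h : ∀ r (z : disc), HasSum (fun w : Word => s r w * iterInt u w z) (f r z))
    (hf : LinearIndependent ℂ f) :
    Set.InjOn (alpha u) (Submodule.span ℂ (Set.range s) : Set Series) := by
  intro S hS S' hS' hSS'
  obtain ⟨c, rfl⟩ := Finsupp.mem_span_range_iff_exists_finsupp.mp hS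
  obtain ⟨c', rfl⟩ := Finsupp.mem_span_range_iff_exists_finsupp.mp hS'
  rw [← Finsupp.linearCombination_apply, ← Finsupp.linearCombination_apply,
    alpha_linearCombination h, alpha_linearCombination h] at hSS'
  rw [hf hSS']

end IteratedIntegrals

/-! ### The two families of inputs -/

section Inputs

theorem hasSum_letter_inputLog (r : ℕ+) (z : disc) :
    HasSum (fun w : Word => letter r w * iterInt inputLog w z) (ellD r z) :=
  hasSum_letter (differentiableOn_ell r) (ell_zero r) (fun _ _ => rfl) z.2

theorem hasSum_kleeneStar_inputLog (r : ℕ+) (z : disc) :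
    HasSum (fun w : Word => kleeneStar (letter r) w * iterInt inputLog w z) (expEllD r z) :=
  hasSum_kleeneStar_letter (differentiableOn_ell r) (ell_zero r) (fun _ _ => rfl) z.2

theorem differentiableOn_exp_ell_sub_one (r : ℕ+) :
    DifferentiableOn ℂ (fun z => Complex.exp (ell r z) - 1) disc :=
  (differentiableOn_ell r).cexp.sub_const 1

/-- Subtracting 1 normalises the primitive e^{ℓ_r} to vanish at 0, as `iterInt_replicate` requires.
-/
theorem inputExp_eq_deriv (r : ℕ+) {z : ℂ} (hz : z ∈ disc) :
    inputExp r z = deriv (fun z => Complex.exp (ell r z) - 1) z := by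
  have h : HasDerivAt (ell r) (deriv (ell r) z) z :=
    ((differentiableOn_ell r).differentiableAt (Metric.isOpen_ball.mem_nhds hz)).hasDerivAt
  exact (h.cexp.sub_const 1).deriv.symm

theorem hasSum_letter_inputExp (r : ℕ+) (z : disc) :
    HasSum (fun w : Word => letter r w * iterInt inputExp w z) ((expEllD r - 1) z) :=
  hasSum_letter (differentiableOn_exp_ell_sub_one r) (by simp [ell_zero])
    (fun _ hz => inputExp_eq_deriv r hz) z.2

theorem hasSum_kleeneStar_inputExp (r : ℕ+) (z : disc) :
    HasSum (fun w : Word => kleeneStar (letter r) w * iterInt inputExp w z)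
      (Complex.exp (Complex.exp (ell r z) - 1)) :=
  hasSum_kleeneStar_letter (differentiableOn_exp_ell_sub_one r) (by simp [ell_zero])
    (fun _ hz => inputExp_eq_deriv r hz) z.2

end Inputs

end Eulerian

open Eulerian
theorem mainTheorem2 :
    -- the families are linearly free, and free from the constant function 1
    (LinearIndependent ℂ Eulerian.ellD ∧ (1 : Eulerian.disc → ℂ) ∉ Eulerian.spanL ∧
      LinearIndependent ℂ Eulerian.expEllD ∧ (1 : Eulerian.disc → ℂ) ∉ Eulerian.spanE) ∧
    -- the inputs `e^{ℓ_r} ∂ℓ_r`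
    ((∀ (r : ℕ+) (z : Eulerian.disc),
        Eulerian.alpha Eulerian.inputExp (Eulerian.letter r) z =
          Complex.exp (Eulerian.ell r z) - 1 ∧
        HasSum (fun w : Eulerian.Word => Eulerian.kleeneStar (Eulerian.letter r) w *
            Eulerian.iterInt Eulerian.inputExp w z)
          (Complex.exp (Complex.exp (Eulerian.ell r z) - 1))) ∧
      Set.MapsTo (Eulerian.alpha Eulerian.inputExp) (Eulerian.spanY : Set Eulerian.Series)
        (Eulerian.spanE ⊔ Submodule.span ℂ {(1 : Eulerian.disc → ℂ)} :
          Submodule ℂ (Eulerian.disc → ℂ)) ∧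
      Set.InjOn (Eulerian.alpha Eulerian.inputExp) (Eulerian.spanY : Set Eulerian.Series)) ∧
    -- the inputs `∂ℓ_r`
    ((∀ (r : ℕ+) (z : Eulerian.disc),
        Eulerian.alpha Eulerian.inputLog (Eulerian.letter r) z = Eulerian.ell r z ∧
        HasSum (fun w : Eulerian.Word => Eulerian.kleeneStar (Eulerian.letter r) w *
            Eulerian.iterInt Eulerian.inputLog w z)
          (Complex.exp (Eulerian.ell r z))) ∧
      Set.MapsTo (Eulerian.alpha Eulerian.inputLog) (Eulerian.spanY : Set Eulerian.Series)
        (Eulerian.spanL : Set (Eulerian.disc → ℂ)) ∧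
      Set.InjOn (Eulerian.alpha Eulerian.inputLog) (Eulerian.spanY : Set Eulerian.Series) ∧
      Set.MapsTo (Eulerian.alpha Eulerian.inputLog) (Eulerian.spanYStar : Set Eulerian.Series)
        (Eulerian.spanE : Set (Eulerian.disc → ℂ)) ∧
      Set.InjOn (Eulerian.alpha Eulerian.inputLog)
        (Eulerian.spanYStar : Set Eulerian.Series)) ∧
    -- algebraic independence of each of the two families
    (AlgebraicIndependent ℂ Eulerian.ellD ∧ AlgebraicIndependent ℂ Eulerian.expEllD) ∧
    (∀ r : ℕ+,
      AlgebraicIndependent ℂ ![Eulerian.ellD r, Eulerian.expEllD r] ∧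
      -- `ℓ_r` is holomorphic on the disc (where its defining series converges)
      ((∀ z ∈ Eulerian.disc, Summable (Eulerian.ellTerm r z)) ∧
        DifferentiableOn ℂ (Eulerian.ell r) Eulerian.disc) ∧
      -- `e^{ℓ_r}` is entire
      (∃ F : ℂ → ℂ, Differentiable ℂ F ∧
        (∀ z ∈ Eulerian.disc, F z = Complex.exp (Eulerian.ell r z) ∧
          F z = (Eulerian.gammaY r (1 + z))⁻¹) ∧
        {z | F z = 0} = ⋃ χ ∈ Eulerian.rootsG r, Eulerian.negRay χ) ∧
      -- `e^{-ℓ_r}` is meromorphic on the plane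
      (∃ M : ℂ → ℂ, MeromorphicOn M Set.univ ∧
        (∀ z ∈ Eulerian.disc, M z = Complex.exp (-Eulerian.ell r z) ∧
          M z = Eulerian.gammaY r (1 + z)) ∧
        {z | meromorphicOrderAt M z < 0} = ⋃ χ ∈ Eulerian.rootsG r, Eulerian.negRay χ) ∧
      -- the union is disjoint, countable, and consists of isolated points
      (Eulerian.rootsG r).PairwiseDisjoint Eulerian.negRay ∧
      (⋃ χ ∈ Eulerian.rootsG r, Eulerian.negRay χ).Countable ∧
      (∀ z ∈ ⋃ χ ∈ Eulerian.rootsG r, Eulerian.negRay χ,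
        ∀ᶠ w in 𝓝[≠] z, w ∉ ⋃ χ ∈ Eulerian.rootsG r, Eulerian.negRay χ)) := by
  have hell := algebraicIndependent_ellD
  have hexp := algebraicIndependent_expEllD
  refine ⟨⟨hell.linearIndependent, one_notMem_span_of_algebraicIndependent hell,
      hexp.linearIndependent, one_notMem_span_of_algebraicIndependent hexp⟩,
    ⟨fun r z => ⟨(hasSum_letter_inputExp r z).tsum_eq, hasSum_kleeneStar_inputExp r z⟩,
      mapsTo_alpha_span hasSum_letter_inputExp fun r => ?_,
      injOn_alpha_span hasSum_letter_inputExp (linearIndependent_sub_one hexp)⟩,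
    ⟨fun r z => ⟨(hasSum_letter_inputLog r z).tsum_eq, hasSum_kleeneStar_inputLog r z⟩,
      mapsTo_alpha_span hasSum_letter_inputLog fun r => Submodule.subset_span ⟨r, rfl⟩,
      injOn_alpha_span hasSum_letter_inputLog hell.linearIndependent,
      mapsTo_alpha_span hasSum_kleeneStar_inputLog fun r => Submodule.subset_span ⟨r, rfl⟩,
      injOn_alpha_span hasSum_kleeneStar_inputLog hexp.linearIndependent⟩,
    ⟨hell, hexp⟩, fun r => ⟨algebraicIndependent_ellD_expEllD (hexp.transcendental r),
      ⟨fun z hz => summable_ellTerm r hz, differentiableOn_ell r⟩,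
      ⟨entireExp r, differentiable_entireExp r, fun z hz => ?_,
        Set.ext fun z => entireExp_eq_zero_iff r z⟩,
      ⟨(entireExp r)⁻¹, fun z _ => (analyticAt_entireExp r z).meromorphicAt.inv,
        fun z hz => ?_, Set.ext fun z => (meromorphicOrderAt_inv_entireExp_neg_iff r z).trans
          (entireExp_eq_zero_iff r z)⟩,
      pairwiseDisjoint_negRay r, countable_iUnion_negRay r,
      fun z _ => eventually_notMem_iUnion_negRay r z⟩⟩
  · refine Submodule.sub_mem _ (Submodule.mem_sup_left (Submodule.subset_span ⟨r, rfl⟩))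
      (Submodule.mem_sup_right (Submodule.mem_span_singleton_self _))
  · rw [gammaY, add_sub_cancel_left, Complex.exp_neg, inv_inv, exp_ell r hz]
    exact ⟨rfl, rfl⟩
  · rw [gammaY, add_sub_cancel_left, Complex.exp_neg, exp_ell r hz]
    exact ⟨rfl, rfl⟩
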